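/- **Groups.** Write $[a,b]=a^{-1}b^{-1}ab$. For $n\in\{361,373,374,385,386\}$ let $\langle 78125,n\rangle$ be the group with generators $x,y,s_2,s_3,s_4,s_5,u_5$ and the power-commutator relations $$x^5=W_n,\quad y^5=s_5^4,\quad [y,x]=s_2,\quad [s_2,x]=s_3,\quad [s_3,x]=s_4,\quad [s_4,x]=s_5,\quad [s_3,y]=[s_4,y]=u_5,\quad [s_3,s_2]=u_5^4,$$ where all fifth powers of generators and all commutators of pairs of generators that are not listed are trivial, and where $W_{361}=s_5$, $W_{373}=s_5u_5$, $W_{374}=s_5^2u_5$, $W_{385}=s_5u_5^2$, $W_{386}=s_5^2u_5^2$. Let $\langle 15625,635\rangle$ be the group obtained from $\langle 78125,361\rangle$ by adding the relation $u_5=1$. **Covers.** Let $p$ be a prime. For a finite $p$-group $G$ let $d_i(G)=\dim_{\mathbb{F}_p}H^i(G,\mathbb{F}_p)$ (trivial action); $d_2(G)$ is the relation rank. A group $G$ is metabelian if $G''=1$. For a finite metabelian $p$-group $\mathfrak{G}$, the cover $\mathrm{cov}(\mathfrak{G})$ is the set of isomorphism classes of finite $p$-groups $G$ with $G/G''\simeq\mathfrak{G}$.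 For a number field $K$ with $p$-class rank $\varrho=d_1(\mathrm{Cl}_p(K))$ and torsion-free unit rank $r$, the Shafarevich cover $\mathrm{cov}(\mathfrak{G},K)$ is the set of all $G\in\mathrm{cov}(\mathfrak{G})$ such that $\varrho\le d_2(G)\le\varrho+r+\vartheta$, where $\vartheta=1$ if $K$ contains the $p$-th roots of unity and $\vartheta=0$ otherwise. **Theorem.** Let $K$ be a real quadratic field of $5$-class rank $\varrho=2$. Then the Shafarevich cover (for $p=5$) of $\langle 15625,635\rangle$ with respect to $K$ consists of exactly five elements, $$\mathrm{cov}(\langle 15625,635\rangle,K)=\bigl\{\langle 78125,n\rangle \mid n\in\{361,373,374,385,386\}\bigr\}.$$ These five groups are pairwise non-isomorphic and non-metabelian, of order $78125=5^7$ and relation rank $3$. The group $\langle 15625,635\rangle$ itself is metabelian of order $15625=5^6$ and belongs to $\mathrm{cov}(\langle 15625,635\rangle)$, but it has relation rank $4>3$ and is therefore not in the Shafarevich cover. -/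

import Mathlib

universe u

/-- Five is prime. -/
theorem prime_five_fact : Fact (Nat.Prime 5) := ⟨by norm_num⟩

attribute [instance] prime_five_fact

/-! ### Isomorphism classes of groups, covers -/

/-- Two groups are identified when they are isomorphic. Every finite group is isomorphic to one
whose underlying type lives in `Type`. -/
def groupIsoSetoid : Setoid GrpCat.{0} where
  r G H := Nonempty (G ≃* H)
  iseqv :=
    { refl := fun G => ⟨MulEquiv.refl G⟩
      symm := fun ⟨e⟩ => ⟨e.symm⟩
      trans := fun ⟨e⟩ ⟨f⟩ => ⟨e.trans f⟩ }

/-- Isomorphism classes of groups. -/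
def GroupIsoClass : Type 1 := Quotient groupIsoSetoid

/-- The isomorphism class of a group. -/
def isoClass (G : Type) [Group G] : GroupIsoClass :=
  Quotient.mk groupIsoSetoid (GrpCat.of G)

/-- A group is metabelian if its second derived subgroup `G''` is trivial. -/
def IsMetabelianGroup (G : Type u) [Group G] : Prop := derivedSeries G 2 = ⊥

/-- The cover of a (finite metabelian `p`-)group `M`: the set of all isomorphism classes of finite
`p`-groups `G` with `G / G'' ≃ M`. -/
def cover (p : ℕ) (M : Type) [Group M] : Set GroupIsoClass :=
  {c | ∃ (G : Type) (_ : Group G), isoClass G = c ∧ Finite G ∧ IsPGroup p G ∧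
    Nonempty ((G ⧸ derivedSeries G 2) ≃* M)}

/-! ### Generator rank and relation rank -/

/-- `dim_{𝔽_p} H^n(G, 𝔽_p)` for the trivial action of `G` on `𝔽_p`. The field `𝔽_p = ZMod p` is
only lifted to the universe of `G`. -/
noncomputable def cohomologyRank (p n : ℕ) (G : Type u) [Group G] : ℕ :=
  Module.finrank (ULift.{u} (ZMod p))
    (groupCohomology (Rep.trivial (ULift.{u} (ZMod p)) G (ULift.{u} (ZMod p))) n)

/-- The generator rank `d₁ G = dim H¹(G, 𝔽_p)`. -/
noncomputable def generatorRank (p : ℕ) (G : Type u) [Group G] : ℕ := cohomologyRank p 1 G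

/-- The relation rank `d₂ G = dim H²(G, 𝔽_p)`. -/
noncomputable def relationRank (p : ℕ) (G : Type u) [Group G] : ℕ := cohomologyRank p 2 G

/-! ### Arithmetic invariants and the Shafarevich cover -/

/-- The `p`-class group of `K`: the Sylow `p`-subgroup of the (finite abelian) ideal class group. -/
noncomputable def pClassGroup (p : ℕ) [Fact p.Prime] (K : Type u) [Field K] [NumberField K] :
    Subgroup (ClassGroup (NumberField.RingOfIntegers K)) :=
  CommGroup.primaryComponent (ClassGroup (NumberField.RingOfIntegers K)) p

/-- The `p`-class rank of `K`. -/
noncomputable def pClassRank (p : ℕ) [Fact p.Prime] (K : Type u) [Field K] [NumberField K] : ℕ :=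
  generatorRank p (pClassGroup p K)

open scoped Classical in
/-- `1` if `K` contains the `p`-th roots of unity, and `0` otherwise. -/
noncomputable def rootOfUnityIndicator (p : ℕ) (K : Type u) [Field K] : ℕ :=
  if ∃ z : K, IsPrimitiveRoot z p then 1 else 0

/-- The Shafarevich cover of `M` with respect to the number field `K`: the classes in the cover
of `M` whose relation rank `d₂` satisfies `ϱ ≤ d₂ ≤ ϱ + r + ϑ`, where `ϱ` is the `p`-class rank,
`r` the torsion-free unit rank, and `ϑ` indicates the `p`-th roots of unity in `K`.
(The relation rank depends only on the isomorphism class.) -/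
def shafarevichCover (p : ℕ) [Fact p.Prime] (M : Type) [Group M]
    (K : Type u) [Field K] [NumberField K] : Set GroupIsoClass :=
  {c | c ∈ cover p M ∧ ∃ (G : Type) (_ : Group G), isoClass G = c ∧
    pClassRank p K ≤ relationRank p G ∧
    relationRank p G ≤ pClassRank p K + NumberField.Units.rank K + rootOfUnityIndicator p K}

/-! ### The groups, by power-commutator presentations -/

/-- The polycyclic generators. -/
inductive PcGen : Type
  | x | y | s2 | s3 | s4 | s5 | u5

/-- The commutator `[a, b] = a⁻¹ b⁻¹ a b` (the usual convention for power-commutator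
presentations). -/
def pcComm {G : Type u} [Group G] (a b : G) : G := a⁻¹ * b⁻¹ * a * b

/-- The exponents `(a, b)` of the relator word `W = s₅ᵃ u₅ᵇ` for the group number `n`; only the
five listed values of `n` are used. -/
def relatorExponents (n : ℕ) : ℕ × ℕ :=
  if n = 361 then (1, 0)
  else if n = 373 then (1, 1)
  else if n = 374 then (2, 1)
  else if n = 385 then (1, 2)
  else if n = 386 then (2, 2)
  else (0, 0)

/-- The generator `g` as an element of the free group. -/
def pcOf (g : PcGen) : FreeGroup PcGen := FreeGroup.of g

/-- The complete list of the pairs `(l, r)` standing for the relations `l = r` of the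
power-commutator presentation with `x⁵ = s₅ᵃ u₅ᵇ`, including those powers and commutators of
generators that are trivial. -/
def pcEquations (a b : ℕ) : Set (FreeGroup PcGen × FreeGroup PcGen) :=
  let x := pcOf PcGen.x
  let y := pcOf PcGen.y
  let s2 := pcOf PcGen.s2
  let s3 := pcOf PcGen.s3
  let s4 := pcOf PcGen.s4
  let s5 := pcOf PcGen.s5
  let u5 := pcOf PcGen.u5
  { (x ^ 5, s5 ^ a * u5 ^ b), (y ^ 5, s5 ^ 4),
    (s2 ^ 5, 1), (s3 ^ 5, 1), (s4 ^ 5, 1), (s5 ^ 5, 1), (u5 ^ 5, 1),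
    (pcComm y x, s2), (pcComm s2 x, s3), (pcComm s3 x, s4), (pcComm s4 x, s5),
    (pcComm s5 x, 1), (pcComm u5 x, 1),
    (pcComm s2 y, 1), (pcComm s3 y, u5), (pcComm s4 y, u5), (pcComm s5 y, 1), (pcComm u5 y, 1),
    (pcComm s3 s2, u5 ^ 4), (pcComm s4 s2, 1), (pcComm s5 s2, 1), (pcComm u5 s2, 1),
    (pcComm s4 s3, 1), (pcComm s5 s3, 1), (pcComm u5 s3, 1),
    (pcComm s5 s4, 1), (pcComm u5 s4, 1), (pcComm u5 s5, 1) }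

/-- The relators `l r⁻¹` of the presentation. -/
def pcRelators (a b : ℕ) : Set (FreeGroup PcGen) :=
  (fun e => e.1 * e.2⁻¹) '' pcEquations a b

/-- The group `⟨78125, n⟩`, for `n` one of `361, 373, 374, 385, 386`. -/
abbrev SmallGroup78125 (n : ℕ) : Type :=
  PresentedGroup (pcRelators (relatorExponents n).1 (relatorExponents n).2)

/-- The group `⟨15625, 635⟩`: the presentation with `W = s₅`, and `u₅` put equal to `1`. -/
abbrev SmallGroup15625n635 : Type :=
  PresentedGroup (pcRelators 1 0 ∪ {pcOf PcGen.u5})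

/-! ### Commutator calculus -/

section Calculus

variable {G H : Type*} [Group G] [Group H]

/-! All groups in question are quotients of one group Γ, generated by x, y subject to `CoveringRel`.
It has order 5¹⁰, and s₅, u, r = [s₂, y], x⁵, y⁵ generate a central elementary abelian subgroup on
which every homomorphism to ℤ/5 vanishes. The relations `CoverRel b d e` (x⁵ = s₅uᵇ, y⁵ = s₅⁴uᵈ, r =
uᵉ) define quotients of order 5⁷; adding u = 1 gives the metabelian group M of order 5⁶.

The heart is `CoverRel.lift`: commutator identities force `CoveringRel` in every central extension,
with kernel of exponent five, of a group satisfying `CoverRel`. This has two consequences. First, Γ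
acts as a covering group of its quotients G = Γ/V: H²(G, 𝔽₅) ≅ Hom(V, 𝔽₅) by
`pow_relationRank_eq_card_ker`, so 5^d₂ · |G| = 5¹⁰. Hence d₂ = 3 in order 5⁷, and d₂ = 4 for M.
Second, the whole cover of M is found by induction on the order, dividing G by a central subgroup of
order five inside G'' (`exists_coverRel_of_ker_eq`). Since G'' = ⟨u⟩ by
`CoveringRel.derivedSeries_eq`, the relations of M hold in G up to powers of u, so every member
satisfies some `CoverRel b d e` and has order 5⁶ or 5⁷.

A change of generators removes d and e (`exists_coverRel_zero_zero`), and b mod 5 is then an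
isomorphism invariant (`CoverRel.parameter_unique`), computed in the explicit model `CoverModel` of
Γ. The five residues b are the five groups. For a real quadratic field of 5-class rank 2 the bound
on d₂ is 2 + 1 + 0 = 3, which excludes only M. -/

theorem mul_eq_mul_pcComm (a b : G) : a * b = b * a * pcComm a b := by
  simp [pcComm, mul_assoc]

theorem pcComm_eq_iff {a b c : G} : pcComm a b = c ↔ a * b = b * a * c := by
  rw [mul_eq_mul_pcComm a b, mul_right_inj]

theorem pcComm_eq_one_iff {a b : G} : pcComm a b = 1 ↔ Commute a b := by
  rw [pcComm_eq_iff, mul_one]; rfl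

theorem Commute.pcComm_eq {a b : G} (h : Commute a b) : pcComm a b = 1 := pcComm_eq_one_iff.2 h

theorem map_pcComm (f : G →* H) (a b : G) : f (pcComm a b) = pcComm (f a) (f b) := by
  simp [pcComm]

theorem pcComm_inv (a b : G) : (pcComm a b)⁻¹ = pcComm b a := by
  simp [pcComm, mul_assoc]

theorem pcComm_mul_left {a b c : G} (h : Commute (pcComm a c) b) :
    pcComm (a * b) c = pcComm a c * pcComm b c := by
  rw [pcComm_eq_iff, mul_assoc a b c, mul_eq_mul_pcComm b c, ← mul_assoc, ← mul_assoc,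
    mul_eq_mul_pcComm a c]
  simp only [mul_assoc]
  rw [← mul_assoc (pcComm a c) b, h.eq, mul_assoc]

theorem pcComm_mul_right {a b c : G} (h : Commute (pcComm a b) c) :
    pcComm a (b * c) = pcComm a c * pcComm a b := by
  rw [pcComm_eq_iff, ← mul_assoc, mul_eq_mul_pcComm a b, mul_assoc, h.eq, ← mul_assoc,
    mul_assoc b a c, mul_eq_mul_pcComm a c]
  simp only [mul_assoc]

theorem pcComm_pow_left {a c : G} (h : Commute (pcComm a c) a) (n : ℕ) :
    pcComm (a ^ n) c = pcComm a c ^ n := by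
  induction n with
  | zero => simp [pcComm]
  | succ n ih => rw [pow_succ', pcComm_mul_left (h.pow_right n), ih, pow_succ']

theorem pcComm_pow_right {a c : G} (h : Commute (pcComm a c) c) (n : ℕ) :
    pcComm a (c ^ n) = pcComm a c ^ n := by
  induction n with
  | zero => simp [pcComm]
  | succ n ih =>
    rw [pow_succ, pcComm_mul_right (a := a) (b := c ^ n) (c := c), ih, pow_succ']
    rw [ih]; exact h.pow_left n

/-- Conjugating both entries of a commutator. -/
theorem pcComm_mul_pcComm (a b g : G) :
    pcComm (a * pcComm a g) (b * pcComm b g) = pcComm a b * pcComm (pcComm a b) g := by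
  simp only [pcComm]; group

theorem Commute.pcComm_right {z a b : G} (ha : Commute z a) (hb : Commute z b) :
    Commute z (pcComm a b) :=
  ((ha.inv_right.mul_right hb.inv_right).mul_right ha).mul_right hb

/-- If `z` commutes with `g` and `h` up to central elements then it commutes with `[g, h]`. -/
theorem commute_pcComm_of_central {z g h : G} (hg : ∀ w, Commute (pcComm z g) w)
    (hh : ∀ w, Commute (pcComm z h) w) : Commute z (pcComm g h) := by
  -- Expand [z, gh] = [z, hg[g, h]] on both sides; since [z, g] and [z, h] are central, they cancel
  -- and leave [z, [g, h]] = 1.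
  have h1 : pcComm z (g * h) = pcComm z (h * g * pcComm g h) := by rw [← mul_eq_mul_pcComm]
  have hgh : pcComm z (h * g) = pcComm z g * pcComm z h := pcComm_mul_right (hh _)
  rw [pcComm_mul_right (hg _), pcComm_mul_right (by rw [hgh]; exact (hg _).mul_left (hh _)), hgh,
    (hh (pcComm z g)).eq] at h1
  exact pcComm_eq_one_iff.1 (by simpa using h1.symm)

/-- The fifth power of a product in a group of class two. -/
theorem mul_pow_five {a b : G} (ha : Commute (pcComm b a) a) (hb : Commute (pcComm b a) b) :
    (a * b) ^ 5 = a ^ 5 * b ^ 5 * pcComm b a ^ 10 := by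
  set c := pcComm b a with hc
  have hba : b * a = a * b * c := mul_eq_mul_pcComm b a
  have key : ∀ n : ℕ, b ^ n * a = a * b ^ n * c ^ n := by
    intro n
    have : pcComm (b ^ n) a = c ^ n := pcComm_pow_left hb n
    rw [mul_eq_mul_pcComm, this]
  have hcb : ∀ n m : ℕ, c ^ n * b ^ m = b ^ m * c ^ n := fun n m => (hb.pow_pow n m).eq
  have hca : ∀ n m : ℕ, c ^ n * a ^ m = a ^ m * c ^ n := fun n m => (ha.pow_pow n m).eq
  -- Moving a past bⁿ costs cⁿ, so five factors produce the exponent 0 + 1 + 2 + 3 + 4 = 10.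
  have step : ∀ n k : ℕ, (a ^ n * b ^ n * c ^ k) * (a * b) = a ^ (n + 1) * b ^ (n + 1) *
      c ^ (k + n) := by
    intro n k
    calc (a ^ n * b ^ n * c ^ k) * (a * b) = a ^ n * b ^ n * (c ^ k * a ^ 1) * b := by
            simp [mul_assoc]
      _ = a ^ n * (b ^ n * a) * (c ^ k * b ^ 1) := by rw [hca]; simp [mul_assoc]
      _ = a ^ n * (a * b ^ n) * (c ^ n * b ^ 1) * c ^ k := by
            rw [key, hcb]; simp [mul_assoc]
      _ = a ^ (n + 1) * b ^ (n + 1) * c ^ (k + n) := by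
            rw [hcb, pow_one, add_comm k n, pow_add c, pow_succ a, pow_succ b]; simp only [mul_assoc]
  have h0 : (1 : G) = a ^ 0 * b ^ 0 * c ^ 0 := by simp
  calc (a * b) ^ 5 = a ^ 0 * b ^ 0 * c ^ 0 * (a * b) * (a * b) * (a * b) * (a * b) * (a * b) := by
          simp [pow_succ, mul_assoc]
    _ = _ := by simp only [step]

end Calculus

/-! ### The defining relations of the covers -/

section Relations

variable {G H : Type*} [Group G] [Group H]

/-- The other polycyclic generators as words in x and y, so that presentations become conditions on
a generating pair. `R2` is trivial for the presented generators, but can be a nontrivial power of u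
for other pairs. -/
def S2 (x y : G) : G := pcComm y x
def S3 (x y : G) : G := pcComm (S2 x y) x
def S4 (x y : G) : G := pcComm (S3 x y) x
def S5 (x y : G) : G := pcComm (S4 x y) x
def U5 (x y : G) : G := pcComm (S3 x y) y
def R2 (x y : G) : G := pcComm (S2 x y) y

theorem map_S2 (f : G →* H) (x y : G) : f (S2 x y) = S2 (f x) (f y) := map_pcComm _ _ _
theorem map_S3 (f : G →* H) (x y : G) : f (S3 x y) = S3 (f x) (f y) := by
  rw [S3, map_pcComm, map_S2]; rfl
theorem map_S4 (f : G →* H) (x y : G) : f (S4 x y) = S4 (f x) (f y) := by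
  rw [S4, map_pcComm, map_S3]; rfl
theorem map_S5 (f : G →* H) (x y : G) : f (S5 x y) = S5 (f x) (f y) := by
  rw [S5, map_pcComm, map_S4]; rfl
theorem map_U5 (f : G →* H) (x y : G) : f (U5 x y) = U5 (f x) (f y) := by
  rw [U5, map_pcComm, map_S3]; rfl
theorem map_R2 (f : G →* H) (x y : G) : f (R2 x y) = R2 (f x) (f y) := by
  rw [R2, map_pcComm, map_S2]; rfl

/-- The relations of the common covering group, in terms of the two generators. -/
structure CoveringRel (x y : G) : Prop where
  s5_x : Commute (S5 x y) x
  s5_y : Commute (S5 x y) y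
  u_x : Commute (U5 x y) x
  u_y : Commute (U5 x y) y
  r_x : Commute (R2 x y) x
  r_y : Commute (R2 x y) y
  px_y : Commute (x ^ 5) y
  py_x : Commute (y ^ 5) x
  s2_pow : S2 x y ^ 5 = 1
  s3_pow : S3 x y ^ 5 = 1
  s4_pow : S4 x y ^ 5 = 1
  s5_pow : S5 x y ^ 5 = 1
  u_pow : U5 x y ^ 5 = 1
  r_pow : R2 x y ^ 5 = 1
  px_pow : (x ^ 5) ^ 5 = 1
  py_pow : (y ^ 5) ^ 5 = 1
  s4_y : pcComm (S4 x y) y = U5 x y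
  s3_s2 : pcComm (S3 x y) (S2 x y) * U5 x y = 1
  s4_s2 : Commute (S4 x y) (S2 x y)
  s4_s3 : Commute (S4 x y) (S3 x y)

/-- The relations of the covers: the parameters describe `x⁵`, `y⁵` and `[s₂, y]`. -/
structure CoverRel (b d e : ℕ) (x y : G) : Prop extends CoveringRel x y where
  px : x ^ 5 = S5 x y * U5 x y ^ b
  py : y ^ 5 = S5 x y ^ 4 * U5 x y ^ d
  r : R2 x y = U5 x y ^ e

theorem CoveringRel.map {x y : G} (h : CoveringRel x y) (f : G →* H) :
    CoveringRel (f x) (f y) where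
  s5_x := by simpa [map_S5] using h.s5_x.map f
  s5_y := by simpa [map_S5] using h.s5_y.map f
  u_x := by simpa [map_U5] using h.u_x.map f
  u_y := by simpa [map_U5] using h.u_y.map f
  r_x := by simpa [map_R2] using h.r_x.map f
  r_y := by simpa [map_R2] using h.r_y.map f
  px_y := by simpa using h.px_y.map f
  py_x := by simpa using h.py_x.map f
  s2_pow := by simpa [map_S2] using congrArg f h.s2_pow
  s3_pow := by simpa [map_S3] using congrArg f h.s3_pow
  s4_pow := by simpa [map_S4] using congrArg f h.s4_pow
  s5_pow := by simpa [map_S5] using congrArg f h.s5_pow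
  u_pow := by simpa [map_U5] using congrArg f h.u_pow
  r_pow := by simpa [map_R2] using congrArg f h.r_pow
  px_pow := by simpa using congrArg f h.px_pow
  py_pow := by simpa using congrArg f h.py_pow
  s4_y := by simpa [map_pcComm, map_S4, map_U5] using congrArg f h.s4_y
  s3_s2 := by simpa [map_pcComm, map_S3, map_S2, map_U5] using congrArg f h.s3_s2
  s4_s2 := by simpa [map_S4, map_S2] using h.s4_s2.map f
  s4_s3 := by simpa [map_S4, map_S3] using h.s4_s3.map f

theorem CoverRel.map {b d e : ℕ} {x y : G} (h : CoverRel b d e x y) (f : G →* H) :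
    CoverRel b d e (f x) (f y) where
  toCoveringRel := h.toCoveringRel.map f
  px := by simpa [map_S5, map_U5] using congrArg f h.px
  py := by simpa [map_S5, map_U5] using congrArg f h.py
  r := by simpa [map_R2, map_U5] using congrArg f h.r

/-- An element commuting with `x` and `y` commutes with all the words. -/
theorem commute_words {z x y : G} (hx : Commute z x) (hy : Commute z y) :
    Commute z (S2 x y) ∧ Commute z (S3 x y) ∧ Commute z (S4 x y) ∧ Commute z (S5 x y) ∧
      Commute z (U5 x y) ∧ Commute z (R2 x y) := by
  have h2 : Commute z (S2 x y) := hy.pcComm_right hx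
  have h3 : Commute z (S3 x y) := h2.pcComm_right hx
  have h4 : Commute z (S4 x y) := h3.pcComm_right hx
  exact ⟨h2, h3, h4, h4.pcComm_right hx, h3.pcComm_right hy, h2.pcComm_right hy⟩

end Relations

/-! ### Central extensions of the covers satisfy the relations of the covering group -/

section Lifting

variable {G H : Type*} [Group G] [Group H]

theorem eq_one_of_pow_five_of_pow {g : G} {n : ℕ} (h5 : g ^ 5 = 1) (hn : g ^ n = 1)
    (h : Nat.Coprime 5 n) : g = 1 := by
  have := pow_gcd_eq_one.2 ⟨h5, hn⟩
  rwa [h, pow_one] at this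

/-- In a central extension, with kernel of exponent five, of a group with the relations of a cover,
the relations of the covering group hold. -/
theorem CoverRel.lift {b d e : ℕ} (q : H →* G) (hc : ∀ k ∈ q.ker, ∀ h, Commute k h)
    (hp : ∀ k ∈ q.ker, k ^ 5 = 1) {x y : H} (hG : CoverRel b d e (q x) (q y)) :
    CoveringRel x y := by
  -- commutation in the quotient
  have cen : ∀ {g h : H}, Commute (q g) (q h) → ∀ w, Commute (pcComm g h) w := by
    intro g h hgh w
    exact hc _ (by rw [MonoidHom.mem_ker, map_pcComm, hgh.pcComm_eq]) w
  have cen5 : ∀ {g h : H}, Commute (q g) (q h) → pcComm g h ^ 5 = 1 := by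
    intro g h hgh
    exact hp _ (by rw [MonoidHom.mem_ker, map_pcComm, hgh.pcComm_eq])
  have div : ∀ {g h : H}, q g = q h → ∃ k, g = h * k ∧ (∀ w, Commute k w) ∧ k ^ 5 = 1 := by
    intro g h hgh
    have : h⁻¹ * g ∈ q.ker := by rw [MonoidHom.mem_ker, map_mul, map_inv, hgh, inv_mul_cancel]
    exact ⟨h⁻¹ * g, by group, hc _ this, hp _ this⟩
  have qs2 := map_S2 q x y
  have qs3 := map_S3 q x y
  have qs4 := map_S4 q x y
  have qs5 := map_S5 q x y
  have qu := map_U5 q x y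
  have qr := map_R2 q x y
  set s2 := S2 x y with hs2
  set s3 := S3 x y with hs3
  set s4 := S4 x y with hs4
  set s5 := S5 x y with hs5
  set u := U5 x y with hu
  set r := R2 x y with hr
  -- elements central modulo the kernel
  have words : ∀ {z : H}, Commute (q z) (q x) → Commute (q z) (q y) →
      Commute z s2 ∧ Commute z s3 ∧ Commute z s4 ∧ Commute z s5 ∧ Commute z u ∧ Commute z r := by
    intro z hx hy
    have hw := commute_words hx hy
    rw [← qs2, ← qs3, ← qs4] at hw
    obtain ⟨h2, h3, h4, -⟩ := hw
    -- The image of z is central, so the commutators of z with both entries of each word lie in the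
    -- kernel and are central.
    exact ⟨commute_pcComm_of_central (cen hy) (cen hx),
      commute_pcComm_of_central (cen h2) (cen hx), commute_pcComm_of_central (cen h3) (cen hx),
      commute_pcComm_of_central (cen h4) (cen hx), commute_pcComm_of_central (cen h3) (cen hy),
      commute_pcComm_of_central (cen h2) (cen hy)⟩
  have qs5x : Commute (q s5) (q x) := by rw [qs5]; exact hG.s5_x
  have qs5y : Commute (q s5) (q y) := by rw [qs5]; exact hG.s5_y
  have qux : Commute (q u) (q x) := by rw [qu]; exact hG.u_x
  have quy : Commute (q u) (q y) := by rw [qu]; exact hG.u_y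
  have qrx : Commute (q r) (q x) := by rw [qr]; exact hG.r_x
  have qry : Commute (q r) (q y) := by rw [qr]; exact hG.r_y
  obtain ⟨s52, s53, s54, -, s5u, s5r⟩ := words qs5x qs5y
  obtain ⟨u2, u3, u4, u5, -, ur⟩ := words qux quy
  obtain ⟨r2, r3, r4, r5, ru, -⟩ := words qrx qry
  obtain ⟨p2, p3, p4, p5, pu, pr⟩ := words (z := x ^ 5)
    (by rw [map_pow]; exact (Commute.refl (q x)).pow_left 5) (by rw [map_pow]; exact hG.px_y)
  obtain ⟨q2, q3, q4, q5, qu', qr'⟩ := words (z := y ^ 5)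
    (by rw [map_pow]; exact hG.py_x) (by rw [map_pow]; exact (Commute.refl (q y)).pow_left 5)
  have q42 : Commute (q s4) (q s2) := by rw [qs4, qs2]; exact hG.s4_s2
  have q43 : Commute (q s4) (q s3) := by rw [qs4, qs3]; exact hG.s4_s3
  have t := cen q42
  have t5 := cen5 q42
  have t3 := cen q43
  have wx := cen qs5x
  have wy := cen qs5y
  have vx := cen qux
  have vy := cen quy
  -- the commutators of `s₄`
  have e2 : pcComm s2 x = s3 := rfl
  have e3 : pcComm s3 x = s4 := rfl
  have e4 : pcComm s4 x = s5 := rfl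
  have ey : pcComm y x = s2 := rfl
  have eu : pcComm s3 y = u := rfl
  have er : pcComm s2 y = r := rfl
  -- Conjugate [s₄, s₂] by x: being central it is fixed, while its entries become s₄s₅ and s₂s₃,
  -- which gives [s₄, s₃][s₄, s₂].
  have s43 : Commute s4 s3 := by
    have h := pcComm_mul_pcComm s4 s2 x
    rw [e4, e2, (t x).pcComm_eq, mul_one, pcComm_mul_left, pcComm_mul_right (t _),
      (s52.mul_right s53).pcComm_eq, mul_one] at h
    · exact pcComm_eq_one_iff.1 (by simpa using h)
    · rw [pcComm_mul_right (t _)]; exact (t3 _).mul_left (t _)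
  -- For the moment [s₄, y] = u and [s₃, s₂] = u⁻¹ hold only up to central factors k₄ and k₂.
  obtain ⟨k4, hk4, ck4, pk4⟩ := div (g := pcComm s4 y) (h := u)
    (by rw [map_pcComm, qs4, qu]; exact hG.s4_y)
  obtain ⟨k2, hk2, ck2, pk2⟩ := div (g := pcComm s3 s2) (h := u⁻¹)
    (by rw [map_pcComm, map_inv, qs3, qs2, qu]; exact eq_inv_of_mul_eq_one_left hG.s3_s2)
  -- Conjugating [s₄, y] by x gives [s₄s₅, ys₂]; k₄ drops out of the commutator with x.
  have ux : pcComm u x = pcComm s4 s2 * pcComm s5 y := by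
    have h := pcComm_mul_pcComm s4 y x
    have c1 : ∀ w, (Commute u w) → Commute (pcComm s4 y) w := by
      intro w hw; rw [hk4]; exact hw.mul_left (ck4 w)
    have e5 : pcComm (pcComm s4 y) x = pcComm u x := by
      rw [hk4, pcComm_mul_left (vx _), (ck4 x).pcComm_eq, mul_one]
    have e6 : pcComm s4 (y * s2) = pcComm s4 s2 * pcComm s4 y := pcComm_mul_right (c1 _ u2)
    have e7 : pcComm s5 (y * s2) = pcComm s5 y := by
      rw [pcComm_mul_right (wy _), s52.pcComm_eq, one_mul]
    rw [e4, ey, e5, pcComm_mul_left, e6, e7, (t (pcComm s4 y)).eq, mul_assoc] at h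
    · exact (mul_left_cancel h).symm
    · rw [e6]; exact (t _).mul_left (c1 _ u5)
  have c2 : ∀ w, (Commute u w) → Commute (pcComm s3 s2) w := by
    intro w hw; rw [hk2]; exact hw.inv_left.mul_left (ck2 w)
  -- Conjugating [s₃, s₂] = u⁻¹k₂ by x gives [s₃s₄, s₂s₃] = [s₃, s₂][s₄, s₂].
  have ux' : pcComm u x * pcComm s4 s2 = 1 := by
    have h := pcComm_mul_pcComm s3 s2 x
    have e5 : pcComm u x * pcComm (pcComm s3 s2) x = 1 := by
      have : pcComm (u * pcComm s3 s2) x = 1 := by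
        rw [hk2, mul_inv_cancel_left]; exact (ck2 x).pcComm_eq
      rwa [pcComm_mul_left (vx _)] at this
    have e6 : pcComm s3 (s2 * s3) = pcComm s3 s2 := by
      rw [pcComm_mul_right (c2 _ u3), (Commute.refl s3).pcComm_eq, one_mul]
    have e7 : pcComm s4 (s2 * s3) = pcComm s4 s2 := by
      rw [pcComm_mul_right (t _), s43.pcComm_eq, one_mul]
    rw [e3, e2, pcComm_mul_left (by rw [e6]; exact c2 _ u4), e6, e7] at h
    rw [mul_left_cancel h]; exact e5
  -- Conjugation by y turns [s₃, s₂] into [s₃u, s₂r], and the factors u and r do not contribute; so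
  -- [s₃, s₂], and with it u, commutes with y.
  have uy : Commute u y := by
    have h := pcComm_mul_pcComm s3 s2 y
    have e5 : pcComm u y * pcComm (pcComm s3 s2) y = 1 := by
      have : pcComm (u * pcComm s3 s2) y = 1 := by
        rw [hk2, mul_inv_cancel_left]; exact (ck2 y).pcComm_eq
      rwa [pcComm_mul_left (vy _)] at this
    have e6 : pcComm s3 (s2 * r) = pcComm s3 s2 := by
      rw [pcComm_mul_right (c2 _ ur), r3.symm.pcComm_eq, one_mul]
    rw [eu, er, pcComm_mul_left (by rw [e6]; exact c2 _ (Commute.refl u)), e6,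
      (u2.mul_right ur).pcComm_eq, mul_one] at h
    rw [eq_comm, mul_eq_left] at h
    rw [h, mul_one] at e5
    exact pcComm_eq_one_iff.1 e5
  -- the centre
  obtain ⟨kq, hkq, ckq, pkq⟩ := div (g := y ^ 5) (h := s5 ^ 4 * u ^ d)
    (by rw [map_pow, map_mul, map_pow, map_pow, qs5, qu]; exact hG.py)
  obtain ⟨kp, hkp, ckp, pkp⟩ := div (g := x ^ 5) (h := s5 * u ^ b)
    (by rw [map_pow, map_mul, map_pow, qs5, qu]; exact hG.px)
  obtain ⟨kr, hkr, ckr, pkr⟩ := div (g := r) (h := u ^ e)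
    (by rw [map_pow, qr, qu]; exact hG.r)
  -- The relation for y⁵ enters: y⁵ commutes with y and is s₅⁴ up to factors commuting with y. So
  -- [s₅, y] has trivial fourth and fifth powers.
  have s5y : Commute s5 y := by
    have h1 : Commute (y ^ 5) y := (Commute.refl y).pow_left 5
    have h2 : Commute (s5 ^ 4) y := by
      have : s5 ^ 4 = y ^ 5 * (kq⁻¹ * (u ^ d)⁻¹) := by rw [hkq]; group
      rw [this]
      exact h1.mul_left ((ckq y).inv_left.mul_left (uy.pow_left d).inv_left)
    have h3 : pcComm s5 y ^ 4 = 1 := by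
      rw [← pcComm_pow_left (wy _), h2.pcComm_eq]
    exact pcComm_eq_one_iff.1 (eq_one_of_pow_five_of_pow (cen5 qs5y) h3 (by norm_num))
  rw [s5y.pcComm_eq, mul_one] at ux
  -- [u, x] is now both [s₄, s₂] and its inverse; in exponent five an element of trivial square is
  -- trivial.
  have s42 : Commute s4 s2 := by
    rw [ux, ← pow_two] at ux'
    exact pcComm_eq_one_iff.1 (eq_one_of_pow_five_of_pow t5 ux' (by norm_num))
  have ux : Commute u x := by
    rw [s42.pcComm_eq] at ux
    exact pcComm_eq_one_iff.1 ux
  have s5x : Commute s5 x := by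
    have h1 : Commute (x ^ 5) x := (Commute.refl x).pow_left 5
    have : s5 = x ^ 5 * (kp⁻¹ * (u ^ b)⁻¹) := by rw [hkp]; group
    rw [this]
    exact h1.mul_left ((ckp x).inv_left.mul_left (ux.pow_left b).inv_left)
  have rx : Commute r x := by rw [hkr]; exact (ux.pow_left e).mul_left (ckr x)
  have ry : Commute r y := by rw [hkr]; exact (uy.pow_left e).mul_left (ckr y)
  have py : Commute (x ^ 5) y := by
    rw [hkp]; exact (s5y.mul_left (uy.pow_left b)).mul_left (ckp y)
  have qx : Commute (y ^ 5) x := by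
    rw [hkq]; exact ((s5x.pow_left 4).mul_left (ux.pow_left d)).mul_left (ckq x)
  -- the commutators `[s₃, s₂]` and `[s₄, y]`
  have s32 : pcComm s3 s2 * u = 1 := by
    -- Conjugating [s₂, y] = r by x gives [s₂s₃, ys₂] = r[s₃, s₂]u, and r commutes with x. This
    -- removes the ambiguity k₂.
    have h := pcComm_mul_pcComm s2 y x
    have e6 : pcComm s2 (y * s2) = r := by
      rw [pcComm_mul_right (by rw [er]; exact r2), (Commute.refl s2).pcComm_eq, one_mul, er]
    have e7 : pcComm s3 (y * s2) = pcComm s3 s2 * u := by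
      rw [pcComm_mul_right (by rw [eu]; exact u2), eu]
    rw [e2, ey, pcComm_mul_left (by rw [e6]; exact r3), e6, e7, er, rx.pcComm_eq] at h
    exact mul_left_cancel h
  have s4y : pcComm s4 y = u := by
    -- Conjugating [s₃, y] = u by x gives [s₃s₄, ys₂] = [s₃, s₂]u[s₄, y], whose first two factors
    -- cancel. This removes the ambiguity k₄.
    have h := pcComm_mul_pcComm s3 y x
    have e6 : pcComm s3 (y * s2) = pcComm s3 s2 * u := by
      rw [pcComm_mul_right (by rw [eu]; exact u2), eu]
    have e7 : pcComm s4 (y * s2) = pcComm s4 y := by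
      rw [pcComm_mul_right (by rw [hk4]; exact u2.mul_left (ck4 _)), s42.pcComm_eq, one_mul]
    rw [e3, ey, pcComm_mul_left (by rw [e6, s32]; exact Commute.one_left _), e6, e7, s32, eu,
      ux.pcComm_eq] at h
    simpa using h
  -- the powers
  have u_pow : u ^ 5 = 1 := by
    -- u⁵ = [s₃, y⁵], and y⁵ commutes with all the words.
    rw [← eu, ← pcComm_pow_right (by rw [eu]; exact uy), q3.symm.pcComm_eq]
  have upow : ∀ n : ℕ, (u ^ n) ^ 5 = 1 := fun n => by
    rw [← pow_mul, mul_comm, pow_mul, u_pow, one_pow]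
  have r_pow : r ^ 5 = 1 := by
    rw [hkr, ((ckr (u ^ e)).symm).mul_pow, upow, pkr, mul_one]
  -- If g⁵ commutes with x then g and its conjugate g[g, x] have the same fifth power. Applied to y,
  -- s₂, s₃, s₄ in turn, this kills the fifth power of the next word, since the correction [·, ·]¹⁰
  -- in class two is trivial.
  have conj5 : ∀ {g h w : H}, pcComm g x = h → g ^ 5 = w → Commute w x → (g * h) ^ 5 = w := by
    intro g h w h1 h2 h3
    have : g * h = x⁻¹ * g * x := by rw [← h1]; simp only [pcComm]; group
    rw [this]
    have h4 : (x⁻¹ * g * x) ^ 5 = x⁻¹ * g ^ 5 * x := by simp only [pow_succ, pow_zero]; group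
    rw [h4, h2, mul_assoc, h3.eq, inv_mul_cancel_left]
  have s2_pow : s2 ^ 5 = 1 := by
    have h := conj5 ey rfl qx
    rw [mul_pow_five (by rw [er]; exact ry) (by rw [er]; exact r2), er,
      show r ^ 10 = (r ^ 5) ^ 2 by rw [← pow_mul], r_pow, one_pow, mul_one] at h
    simpa using h
  have s3_pow : s3 ^ 5 = 1 := by
    have h := conj5 e2 s2_pow (Commute.one_left _)
    rw [mul_pow_five (c2 _ u2) (c2 _ u3), s2_pow, one_mul, eq_inv_of_mul_eq_one_left s32,
      inv_pow, show u ^ 10 = (u ^ 5) ^ 2 by rw [← pow_mul], u_pow] at h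
    simpa using h
  have s4_pow : s4 ^ 5 = 1 := by
    have h := conj5 e3 s3_pow (Commute.one_left _)
    rwa [s43.symm.mul_pow, s3_pow, one_mul] at h
  have s5_pow : s5 ^ 5 = 1 := by
    have h := conj5 e4 s4_pow (Commute.one_left _)
    rwa [s54.symm.mul_pow, s4_pow, one_mul] at h
  exact
    { s5_x := s5x
      s5_y := s5y
      u_x := ux
      u_y := uy
      r_x := rx
      r_y := ry
      px_y := py
      py_x := qx
      s2_pow := s2_pow
      s3_pow := s3_pow
      s4_pow := s4_pow
      s5_pow := s5_pow
      u_pow := u_pow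
      r_pow := r_pow
      px_pow := by
        rw [hkp, ((ckp _).symm).mul_pow, (s5u.pow_right b).mul_pow, s5_pow, upow, pkp]; simp
      py_pow := by
        rw [hkq, ((ckq _).symm).mul_pow, ((s5u.pow_right d).pow_left 4).mul_pow, ← pow_mul, mul_comm 4,
          pow_mul, s5_pow, upow, pkq]; simp
      s4_y := s4y
      s3_s2 := s32
      s4_s2 := s42
      s4_s3 := s43 }

end Lifting

/-! ### The second cohomology group by means of a covering group -/

section Cohomology

/-- The extension of `G` by `A` with trivial action, defined by a two-cocycle. -/
structure CocycleExt {G A : Type*} [Group G] [AddCommGroup A] (f : G → G → A)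
    (hf : ∀ g h j, f (g * h) j + f g h = f h j + f g (h * j)) where
  base : G
  fib : A

namespace CocycleExt

variable {G A : Type*} [Group G] [AddCommGroup A] {f : G → G → A}
  {hf : ∀ g h j, f (g * h) j + f g h = f h j + f g (h * j)}

theorem cocycle_one_left (hf : ∀ g h j, f (g * h) j + f g h = f h j + f g (h * j)) (g : G) :
    f 1 g = f 1 1 := by
  have := hf 1 1 g
  simp only [one_mul] at this
  exact (add_left_cancel this).symm

theorem cocycle_one_right (hf : ∀ g h j, f (g * h) j + f g h = f h j + f g (h * j)) (g : G) :
    f g 1 = f 1 1 := by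
  have := hf g 1 1
  simp only [mul_one] at this
  exact add_right_cancel this

@[ext]
theorem ext {a b : CocycleExt f hf} (h1 : a.base = b.base) (h2 : a.fib = b.fib) : a = b := by
  cases a; cases b; simp_all

instance : Mul (CocycleExt f hf) := ⟨fun a b => ⟨a.base * b.base, a.fib + b.fib + f a.base b.base⟩⟩
-- The cocycle is not assumed normalized, hence the shift by f(1, 1) here, in the inverse and in the
-- inclusion of the fibre.
instance : One (CocycleExt f hf) := ⟨⟨1, -f 1 1⟩⟩
instance : Inv (CocycleExt f hf) := ⟨fun a => ⟨a.base⁻¹, -a.fib - f a.base⁻¹ a.base - f 1 1⟩⟩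

@[simp] theorem mul_base (a b : CocycleExt f hf) : (a * b).base = a.base * b.base := rfl
@[simp] theorem mul_fib (a b : CocycleExt f hf) :
    (a * b).fib = a.fib + b.fib + f a.base b.base := rfl
@[simp] theorem one_base : (1 : CocycleExt f hf).base = 1 := rfl
@[simp] theorem one_fib : (1 : CocycleExt f hf).fib = -f 1 1 := rfl
@[simp] theorem inv_base (a : CocycleExt f hf) : (a⁻¹).base = a.base⁻¹ := rfl
@[simp] theorem inv_fib (a : CocycleExt f hf) :
    (a⁻¹).fib = -a.fib - f a.base⁻¹ a.base - f 1 1 := rfl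

instance : Group (CocycleExt f hf) :=
  Group.ofLeftAxioms
    (fun a b c => by
      ext
      · simp [mul_assoc]
      · simp only [mul_fib, mul_base]
        have := hf a.base b.base c.base
        rw [add_assoc (a.fib + b.fib + f a.base b.base), add_comm c.fib]
        calc a.fib + b.fib + f a.base b.base + (f (a.base * b.base) c.base + c.fib)
            = a.fib + b.fib + c.fib + (f (a.base * b.base) c.base + f a.base b.base) := by abel
          _ = _ := by rw [this]; abel)
    (fun a => by
      ext
      · simp
      · simp [cocycle_one_left hf])
    (fun a => by
      ext
      · simp
      · simp only [mul_fib, inv_fib, inv_base, one_fib]; abel)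

/-- The projection to the base. -/
def proj : CocycleExt f hf →* G where
  toFun := base
  map_one' := rfl
  map_mul' _ _ := rfl

theorem proj_surjective : Function.Surjective (proj (f := f) (hf := hf)) := fun g => ⟨⟨g, 0⟩, rfl⟩

/-- The inclusion of the fibre. -/
def incl : Multiplicative A →* CocycleExt f hf where
  toFun a := ⟨1, a.toAdd - f 1 1⟩
  map_one' := by ext <;> simp
  map_mul' a b := by
    ext
    · simp
    · simp only [mul_fib, toAdd_mul]; abel

theorem eq_incl {a : CocycleExt f hf} (h : a ∈ (proj (f := f) (hf := hf)).ker) :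
    a = incl (Multiplicative.ofAdd (a.fib + f 1 1)) := by
  ext
  · exact h
  · simp [incl]

theorem commute_of_mem_ker {a : CocycleExt f hf} (h : a ∈ (proj (f := f) (hf := hf)).ker)
    (b : CocycleExt f hf) : Commute a b := by
  have h1 : a.base = 1 := h
  ext
  · simp [h1]
  · simp [h1, cocycle_one_left hf, cocycle_one_right hf, add_comm]

theorem pow_of_mem_ker {p : ℕ} (hp : ∀ a : A, p • a = 0) {a : CocycleExt f hf}
    (h : a ∈ (proj (f := f) (hf := hf)).ker) : a ^ p = 1 := by
  rw [eq_incl h, ← map_pow, ← ofAdd_nsmul, hp, ofAdd_zero, map_one]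

end CocycleExt

theorem card_dual_zmod (p : ℕ) [Fact p.Prime] (A : Type*) [AddCommGroup A] [Finite A]
    [Module (ZMod p) A] : Nat.card (Module.Dual (ZMod p) A) = Nat.card A := by
  have : Module.Finite (ZMod p) A := Module.Finite.of_finite
  rw [Module.natCard_eq_pow_finrank (K := ZMod p) (V := Module.Dual (ZMod p) A),
    Module.natCard_eq_pow_finrank (K := ZMod p) (V := A), Subspace.dual_finrank_eq]

theorem card_addMonoidHom_zmod (p : ℕ) [Fact p.Prime] (A : Type*) [AddCommGroup A] [Finite A]
    (hA : ∀ a : A, p • a = 0) : Nat.card (A →+ ZMod p) = Nat.card A := by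
  let _ : Module (ZMod p) A := AddCommGroup.zmodModule hA
  rw [Nat.card_congr (AddMonoidHom.toZModLinearMapEquiv p).toEquiv]
  exact card_dual_zmod p A

open groupCohomology in
/-- If a central extension `π : Γ → G` with elementary abelian kernel `A` contained in the
`p`-Frattini subgroup of `Γ` factors through every central extension of `G` with kernel of exponent
`p`, then `H²(G, 𝔽_p)` is isomorphic to `Hom(A, 𝔽_p)`. -/
theorem pow_relationRank_eq_card_ker (p : ℕ) [Fact p.Prime] {Γ G : Type} [Group Γ] [Group G]
    (π : Γ →* G) (hπ : Function.Surjective π) (hc : ∀ a ∈ π.ker, ∀ g, Commute a g)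
    (hp : ∀ a ∈ π.ker, a ^ p = 1) (hfin : Finite π.ker)
    (hhom : ∀ ψ : Γ →* Multiplicative (ZMod p), ∀ a ∈ π.ker, ψ a = 1)
    (huniv : ∀ (H : Type) [Group H] (q : H →* G), Function.Surjective q →
      (∀ a ∈ q.ker, ∀ h, Commute a h) → (∀ a ∈ q.ker, a ^ p = 1) →
      ∃ l : Γ →* H, q.comp l = π) :
    p ^ relationRank p G = Nat.card π.ker := by
  classical
  let _ : CommGroup π.ker :=
    { (inferInstance : Group π.ker) with
      mul_comm := fun a b => Subtype.ext (hc a a.2 b) }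
  let k := ULift.{0} (ZMod p)
  let B : Rep k G := Rep.trivial k G k
  let σ : G → Γ := Function.surjInv hπ
  have hσ : ∀ g, π (σ g) = g := Function.surjInv_eq hπ
  let c : G → G → π.ker := fun g h => ⟨σ g * σ h * (σ (g * h))⁻¹, by
    rw [MonoidHom.mem_ker]; simp [hσ]⟩
  have hcoc : ∀ g h j, c (g * h) j * c g h = c h j * c g (h * j) := by
    intro g h j
    rw [mul_comm (c (g * h) j)]
    apply Subtype.ext
    have h1 : (σ h * σ j * (σ (h * j))⁻¹) * σ g = σ g * (σ h * σ j * (σ (h * j))⁻¹) :=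
      hc _ (c h j).2 _
    calc σ g * σ h * (σ (g * h))⁻¹ * (σ (g * h) * σ j * (σ (g * h * j))⁻¹)
        = σ g * (σ h * σ j * (σ (h * j))⁻¹) * σ (h * j) * (σ (g * h * j))⁻¹ := by group
      _ = σ h * σ j * (σ (h * j))⁻¹ * (σ g * σ (h * j) * (σ (g * (h * j)))⁻¹) := by
          rw [← h1, mul_assoc g h j]; group
  -- Push the factor set c of Γ over G forward along φ; on classes this is the transgression from
  -- Hom(A, 𝔽_p) to H².
  let F : (Additive π.ker →+ ZMod p) → cocycles₂ B := fun φ =>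
    ⟨fun gh => ULift.up (φ (Additive.ofMul (c gh.1 gh.2))), by
      rw [mem_cocycles₂_iff]
      intro g h j
      have := congrArg (fun a => φ (Additive.ofMul a)) (hcoc g h j)
      simp only [ofMul_mul, map_add] at this
      exact congrArg ULift.up this⟩
  have hFsub : ∀ φ ψ, F (φ - ψ) = F φ - F ψ := fun φ ψ => by
    apply cocycles₂_ext; intro g h; rfl
  let T : (Additive π.ker →+ ZMod p) → H2 B := fun φ => H2π B (F φ)
  -- If φ ∘ c is the coboundary of β, then γ ↦ φ(γ σ(πγ)⁻¹) + β(πγ) is a homomorphism on Γ extending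
  -- φ, and such homomorphisms vanish on the kernel.
  have hinj : ∀ φ, T φ = 0 → φ = 0 := by
    intro φ h
    obtain ⟨β, hβ⟩ := (H2π_eq_zero_iff _).1 h
    have hβ' : ∀ g h, φ (Additive.ofMul (c g h)) =
        (β h).down - (β (g * h)).down + (β g).down := by
      intro g h
      exact (congrArg ULift.down (congrFun hβ (g, h))).symm
    have hd : ∀ γ : Γ, γ * (σ (π γ))⁻¹ ∈ π.ker := fun γ => by
      rw [MonoidHom.mem_ker]; simp [hσ]
    let ψ : Γ →* Multiplicative (ZMod p) :=
      MonoidHom.mk' (fun γ => Multiplicative.ofAdd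
        (φ (Additive.ofMul ⟨γ * (σ (π γ))⁻¹, hd γ⟩) + (β (π γ)).down)) (by
        intro a b
        rw [← ofAdd_add]
        congr 1
        have e : (⟨a * b * (σ (π (a * b)))⁻¹, hd (a * b)⟩ : π.ker) =
            ⟨a * (σ (π a))⁻¹, hd a⟩ * ⟨b * (σ (π b))⁻¹, hd b⟩ * c (π a) (π b) := by
          apply Subtype.ext
          have h1 := hc _ (hd b) (σ (π a))
          calc a * b * (σ (π (a * b)))⁻¹
              = a * (σ (π a))⁻¹ * (σ (π a) * (b * (σ (π b))⁻¹)) * σ (π b) *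
                (σ (π a * π b))⁻¹ := by rw [map_mul]; group
            _ = _ := by
              rw [← h1.eq]
              show _ = a * (σ (π a))⁻¹ * (b * (σ (π b))⁻¹) *
                (σ (π a) * σ (π b) * (σ (π a * π b))⁻¹)
              group
        rw [e, ofMul_mul, ofMul_mul, map_add, map_add, hβ', map_mul]
        ring)
    -- The section need not send 1 to 1; the constant this produces is ψ(1), which is trivial.
    have hψ : ∀ a (ha : a ∈ π.ker), ψ a = Multiplicative.ofAdd (φ (Additive.ofMul ⟨a, ha⟩) +
        (ψ 1).toAdd) := by
      intro a ha
      have ha' : π a = 1 := ha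
      show Multiplicative.ofAdd _ = Multiplicative.ofAdd (_ + (φ _ + _))
      congr 1
      have e : (⟨a * (σ (π a))⁻¹, hd a⟩ : π.ker) = ⟨a, ha⟩ * ⟨1 * (σ (π 1))⁻¹, hd 1⟩ := by
        apply Subtype.ext; simp [ha']
      rw [e, ofMul_mul, map_add, show β (π a) = β (π 1) by rw [ha', map_one], add_assoc]
    refine AddMonoidHom.ext fun a => ?_
    have h1 := hψ a.toMul.1 a.toMul.2
    rw [hhom ψ _ a.toMul.2, map_one] at h1
    have h2 := congrArg Multiplicative.toAdd h1
    simpa using h2.symm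
  have hsurj : Function.Surjective T := by
    intro z
    induction z using H2_induction_on with
    | h f =>
      let f' : G → G → ZMod p := fun g h => (f (g, h)).down
      have hf' : ∀ g h j, f' (g * h) j + f' g h = f' h j + f' g (h * j) := fun g h j =>
        congrArg ULift.down ((mem_cocycles₂_iff f).1 f.2 g h j)
      let q : CocycleExt f' hf' →* G := CocycleExt.proj
      -- Lift Γ to the extension defined by the cocycle. The restriction of l to the kernel of π is
      -- the required φ, and the fibre coordinate of l ∘ σ is a cochain bounding the difference.
      obtain ⟨l, hl⟩ := huniv (CocycleExt f' hf') q CocycleExt.proj_surjective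
        (fun a ha => CocycleExt.commute_of_mem_ker ha)
        (fun a ha => CocycleExt.pow_of_mem_ker (fun a => by simp) ha)
      have hl' : ∀ γ, (l γ).base = π γ := fun γ => DFunLike.congr_fun hl γ
      let φ : Additive π.ker →+ ZMod p :=
        { toFun := fun a => (l a.toMul.1).fib + f' 1 1
          map_zero' := by
            show (l 1).fib + f' 1 1 = 0
            rw [map_one]; simp
          map_add' := fun a b => by
            show (l (a.toMul.1 * b.toMul.1)).fib + f' 1 1 = _
            have h1 : (l a.toMul.1).base = 1 := (hl' _).trans a.toMul.2
            have h2 : (l b.toMul.1).base = 1 := (hl' _).trans b.toMul.2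
            rw [map_mul, CocycleExt.mul_fib, h1, h2]; ring }
      refine ⟨φ, (H2π_eq_iff _ _).2 ⟨fun g => ULift.up (l (σ g)).fib, ?_⟩⟩
      funext ⟨g, h⟩
      apply ULift.down_injective
      show (l (σ h)).fib - (l (σ (g * h))).fib + (l (σ g)).fib =
        φ (Additive.ofMul (c g h)) - f' g h
      have e1 : l (σ g) * l (σ h) = l (c g h).1 * l (σ (g * h)) := by
        rw [← map_mul, ← map_mul]
        congr 1
        show σ g * σ h = σ g * σ h * (σ (g * h))⁻¹ * σ (g * h)
        group
      have e2 := congrArg CocycleExt.fib e1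
      have h3 : (l (c g h).1).base = 1 := (hl' _).trans (c g h).2
      rw [CocycleExt.mul_fib, CocycleExt.mul_fib, h3, hl', hl', hl', hσ, hσ, hσ,
        CocycleExt.cocycle_one_left hf'] at e2
      show _ = (l (c g h).1).fib + f' 1 1 - f' g h
      linear_combination e2
  have hbij : Function.Bijective T := by
    refine ⟨fun φ ψ h => ?_, hsurj⟩
    apply sub_eq_zero.1
    apply hinj
    show H2π B (F (φ - ψ)) = 0
    rw [hFsub, map_sub]
    exact sub_eq_zero.2 h
  have hcard : Nat.card (H2 B) = Nat.card π.ker := by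
    rw [← Nat.card_congr (Equiv.ofBijective T hbij),
      card_addMonoidHom_zmod p (Additive π.ker) (fun a => by
        show Additive.ofMul (a.toMul ^ p) = 0
        rw [show a.toMul ^ p = 1 from Subtype.ext (hp _ a.toMul.2)]; rfl)]
    rfl
  have hfinH : Finite (H2 B) := Nat.finite_of_card_ne_zero (by
    rw [hcard]; exact Nat.card_pos.ne')
  rw [← hcard]
  have hk : Nat.card k = p := by
    rw [Nat.card_congr Equiv.ulift, Nat.card_zmod]
  have := Module.natCard_eq_pow_finrank (K := k) (V := H2 B)
  rw [this, hk]
  rfl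

end Cohomology

/-! ### Generators, orders and derived subgroups -/

section Orders

universe v

variable {G H : Type*} [Group G] [Group H]

theorem commute_of_closure_eq_top {x y z : G} (hgen : Subgroup.closure {x, y} = ⊤)
    (hx : Commute z x) (hy : Commute z y) (g : G) : Commute z g := by
  have h : Subgroup.closure {x, y} ≤ Subgroup.centralizer {z} := by
    rw [Subgroup.closure_le]
    rintro w (rfl | rfl)
    · exact Subgroup.mem_centralizer_singleton_iff.2 hx.symm
    · exact Subgroup.mem_centralizer_singleton_iff.2 hy.symm
  rw [hgen] at h
  exact (Subgroup.mem_centralizer_singleton_iff.1 (h (Subgroup.mem_top g))).symm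

theorem closure_pair_map_eq_top {x y : G} (hgen : Subgroup.closure {x, y} = ⊤) (f : G →* H)
    (hf : Function.Surjective f) : Subgroup.closure {f x, f y} = ⊤ := by
  rw [← Set.image_pair, ← MonoidHom.map_closure, hgen]
  exact Subgroup.map_top_of_surjective f hf

theorem surjective_of_closure_eq_top {x y : H} (hgen : Subgroup.closure {x, y} = ⊤) (f : G →* H)
    (hx : x ∈ f.range) (hy : y ∈ f.range) : Function.Surjective f := by
  rw [← MonoidHom.range_eq_top, eq_top_iff, ← hgen, Subgroup.closure_le]
  rintro w (rfl | rfl)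
  · exact hx
  · exact hy

theorem finite_and_card_le_of_quotient (N : Subgroup G) [N.Normal] {m n : ℕ}
    (h1 : Finite N ∧ Nat.card N ≤ m) (h2 : Finite (G ⧸ N) ∧ Nat.card (G ⧸ N) ≤ n) :
    Finite G ∧ Nat.card G ≤ m * n := by
  obtain ⟨f1, c1⟩ := h1
  obtain ⟨f2, c2⟩ := h2
  have hc : Nat.card G = Nat.card (G ⧸ N) * Nat.card N :=
    Subgroup.card_eq_card_quotient_mul_card_subgroup N
  refine ⟨Nat.finite_of_card_ne_zero ?_, ?_⟩
  · rw [hc]; exact (Nat.mul_pos Nat.card_pos Nat.card_pos).ne'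
  · rw [hc, mul_comm]; exact Nat.mul_le_mul c1 c2

theorem normal_of_central (N : Subgroup G) (h : ∀ z ∈ N, ∀ g, Commute z g) : N.Normal :=
  ⟨fun z hz g => by rwa [← (h z hz g).eq, mul_inv_cancel_right]⟩

theorem zpowers_central {z : G} (h : ∀ g, Commute z g) : ∀ w ∈ Subgroup.zpowers z, ∀ g,
    Commute w g := by
  rintro _ ⟨n, rfl⟩ g
  exact (h g).zpow_left n

theorem finite_and_card_zpowers_le {z : G} (h5 : z ^ 5 = 1) :
    Finite (Subgroup.zpowers z) ∧ Nat.card (Subgroup.zpowers z) ≤ 5 := by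
  have h := orderOf_dvd_of_pow_eq_one h5
  refine ⟨?_, ?_⟩
  · exact finite_zpowers.2 (isOfFinOrder_iff_pow_eq_one.2 ⟨5, by norm_num, h5⟩)
  · rw [Nat.card_zpowers]; exact Nat.le_of_dvd (by norm_num) h

/-- A bound for the order of `G` from a bound for a quotient by a central element of order five. -/
theorem finite_and_card_le_of_central {G : Type v} [Group G] {x y z : G}
    (hgen : Subgroup.closure {x, y} = ⊤)
    (hx : Commute z x) (hy : Commute z y) (h5 : z ^ 5 = 1) {n : ℕ}
    (hq : ∀ (Q : Type v) [Group Q] (f : G →* Q), f z = 1 →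
      Subgroup.closure {f x, f y} = ⊤ → Finite Q ∧ Nat.card Q ≤ n) :
    Finite G ∧ Nat.card G ≤ 5 * n := by
  have hc := commute_of_closure_eq_top hgen hx hy
  have hN : Subgroup.normalClosure {z} = Subgroup.zpowers z := by
    have := normal_of_central _ (zpowers_central hc)
    apply le_antisymm
    · exact Subgroup.normalClosure_le_normal (by simp)
    · rw [Subgroup.zpowers_le]; exact Subgroup.subset_normalClosure rfl
  refine finite_and_card_le_of_quotient (Subgroup.normalClosure {z}) ?_
    (hq _ (QuotientGroup.mk' _) ?_ ?_)
  · rw [hN]; exact finite_and_card_zpowers_le h5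
  · exact (QuotientGroup.eq_one_iff z).2 (Subgroup.subset_normalClosure rfl)
  · exact closure_pair_map_eq_top hgen _ (QuotientGroup.mk'_surjective _)

/-! ### Upper bounds for orders, by removing central elements of order dividing five -/

section Bounds

theorem card_le_cyclic {G : Type v} [Group G] {x y : G} (hgen : Subgroup.closure {x, y} = ⊤)
    (hx : x = 1) (hy5 : y ^ 5 = 1) : Finite G ∧ Nat.card G ≤ 5 := by
  refine finite_and_card_le_of_central (n := 1) (z := y) hgen (hx ▸ Commute.one_right y)
    (Commute.refl y) hy5 fun Q _ f hf hg => ?_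
  rw [hx, map_one, hf, Set.pair_eq_singleton] at hg
  have : Subsingleton Q := by
    rw [← Subgroup.subsingleton_iff]
    rw [Subgroup.closure_singleton_one] at hg
    exact subsingleton_of_bot_eq_top hg
  exact ⟨inferInstance, Finite.card_le_one_iff_subsingleton.2 this⟩

theorem card_le_abelian {G : Type v} [Group G] {x y : G} (hgen : Subgroup.closure {x, y} = ⊤)
    (h2 : S2 x y = 1) (hx5 : x ^ 5 = 1) (hy5 : y ^ 5 = 1) : Finite G ∧ Nat.card G ≤ 5 ^ 2 := by
  refine finite_and_card_le_of_central (n := 5) (z := x) hgen (Commute.refl x)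
    (pcComm_eq_one_iff.1 h2).symm hx5 fun Q _ f hf hg => ?_
  exact card_le_cyclic hg hf (by rw [← map_pow, hy5, map_one])

theorem card_le_class_two {G : Type v} [Group G] {x y : G} (hgen : Subgroup.closure {x, y} = ⊤)
    (h3 : S3 x y = 1) (hr : R2 x y = 1) (h2 : S2 x y ^ 5 = 1) (hx5 : x ^ 5 = 1)
    (hy5 : y ^ 5 = 1) : Finite G ∧ Nat.card G ≤ 5 ^ 3 := by
  refine finite_and_card_le_of_central (n := 5 ^ 2) (z := S2 x y) hgen (pcComm_eq_one_iff.1 h3)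
    (pcComm_eq_one_iff.1 hr) h2 fun Q _ f hf hg => ?_
  exact card_le_abelian hg (by rw [← map_S2, hf]) (by rw [← map_pow, hx5, map_one])
    (by rw [← map_pow, hy5, map_one])

theorem card_le_class_three {G : Type v} [Group G] {x y : G} (hgen : Subgroup.closure {x, y} = ⊤)
    (h4 : S4 x y = 1) (hu : U5 x y = 1) (hr : R2 x y = 1) (h3 : S3 x y ^ 5 = 1)
    (h2 : S2 x y ^ 5 = 1) (hx5 : x ^ 5 = 1)
    (hy5 : y ^ 5 = 1) : Finite G ∧ Nat.card G ≤ 5 ^ 4 := by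
  refine finite_and_card_le_of_central (n := 5 ^ 3) (z := S3 x y) hgen (pcComm_eq_one_iff.1 h4)
    (pcComm_eq_one_iff.1 hu) h3 fun Q _ f hf hg => ?_
  exact card_le_class_two hg (by rw [← map_S3, hf]) (by rw [← map_R2, hr, map_one])
    (by rw [← map_S2, ← map_pow, h2, map_one]) (by rw [← map_pow, hx5, map_one])
    (by rw [← map_pow, hy5, map_one])

/-- Once s₅, u, r, x⁵, y⁵ are trivial, five factors remain: s₄, s₃, s₂, x, y, each central modulo
its predecessors. -/
theorem card_le_class_four {G : Type v} [Group G] {x y : G} (hgen : Subgroup.closure {x, y} = ⊤)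
    (hG : CoveringRel x y) (h5 : S5 x y = 1) (hu : U5 x y = 1) (hr : R2 x y = 1)
    (hx5 : x ^ 5 = 1) (hy5 : y ^ 5 = 1) : Finite G ∧ Nat.card G ≤ 5 ^ 5 := by
  refine finite_and_card_le_of_central (n := 5 ^ 4) (z := S4 x y) hgen (pcComm_eq_one_iff.1 h5)
    (pcComm_eq_one_iff.1 (hG.s4_y.trans hu)) hG.s4_pow fun Q _ f hf hg => ?_
  have hG' := hG.map f
  exact card_le_class_three hg (by rw [← map_S4, hf]) (by rw [← map_U5, hu, map_one])
    (by rw [← map_R2, hr, map_one]) hG'.s3_pow hG'.s2_pow (by rw [← map_pow, hx5, map_one])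
    (by rw [← map_pow, hy5, map_one])

/-- A group with the relations of the covering group has order at most `5¹⁰`. -/
theorem CoveringRel.card_le {G : Type v} [Group G] {x y : G}
    (hgen : Subgroup.closure {x, y} = ⊤) (hG : CoveringRel x y) :
    Finite G ∧ Nat.card G ≤ 5 ^ 10 := by
  refine finite_and_card_le_of_central (n := 5 ^ 9) (z := y ^ 5) hgen hG.py_x
    ((Commute.refl y).pow_left 5) hG.py_pow fun Q1 _ f1 k1 g1 => ?_
  have hG1 := hG.map f1
  refine finite_and_card_le_of_central (n := 5 ^ 8) (z := f1 x ^ 5) g1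
    ((Commute.refl _).pow_left 5) hG1.px_y hG1.px_pow fun Q2 _ f2 k2 g2 => ?_
  have hG2 := hG1.map f2
  refine finite_and_card_le_of_central (n := 5 ^ 7) (z := R2 (f2 (f1 x)) (f2 (f1 y))) g2
    hG2.r_x hG2.r_y hG2.r_pow fun Q3 _ f3 k3 g3 => ?_
  have hG3 := hG2.map f3
  refine finite_and_card_le_of_central (n := 5 ^ 6) (z := U5 _ _) g3
    hG3.u_x hG3.u_y hG3.u_pow fun Q4 _ f4 k4 g4 => ?_
  have hG4 := hG3.map f4
  refine finite_and_card_le_of_central (n := 5 ^ 5) (z := S5 _ _) g4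
    hG4.s5_x hG4.s5_y hG4.s5_pow fun Q5 _ f5 k5 g5 => ?_
  refine card_le_class_four g5 (hG4.map f5) ?_ ?_ ?_ ?_ ?_
  · rw [← map_S5, k5]
  · rw [← map_U5, ← map_U5, k4, map_one]
  · rw [← map_R2, ← map_R2, ← map_R2, k3, map_one, map_one]
  · rw [← map_pow, ← map_pow, ← map_pow, ← map_pow, k2, map_one, map_one, map_one]
  · rw [← map_pow, ← map_pow, ← map_pow, ← map_pow, ← map_pow, k1, map_one, map_one, map_one,
      map_one]

/-- When u = 1, r is trivial and x⁵, y⁵ are powers of s₅, so killing s₅ removes all of them. -/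
theorem CoverRel.card_le_of_u_eq_one {G : Type v} [Group G] {x y : G} {b d e : ℕ}
    (hgen : Subgroup.closure {x, y} = ⊤) (hG : CoverRel b d e x y) (hu : U5 x y = 1) :
    Finite G ∧ Nat.card G ≤ 5 ^ 6 := by
  refine finite_and_card_le_of_central (n := 5 ^ 5) (z := S5 _ _) hgen
    hG.s5_x hG.s5_y hG.s5_pow fun Q5 _ f5 k5 g5 => ?_
  have hG5 := hG.map f5
  have k5' : S5 (f5 x) (f5 y) = 1 := by rw [← map_S5, k5]
  have hu' : U5 (f5 x) (f5 y) = 1 := by rw [← map_U5, hu, map_one]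
  refine card_le_class_four g5 hG5.toCoveringRel k5' hu' ?_ ?_ ?_
  · rw [hG5.r, hu', one_pow]
  · rw [hG5.px, k5', hu', one_pow, one_mul]
  · rw [hG5.py, k5', hu', one_pow, one_pow, one_mul]

theorem CoverRel.card_le {G : Type v} [Group G] {x y : G} {b d e : ℕ}
    (hgen : Subgroup.closure {x, y} = ⊤) (hG : CoverRel b d e x y) :
    Finite G ∧ Nat.card G ≤ 5 ^ 7 := by
  refine finite_and_card_le_of_central (n := 5 ^ 6) (z := U5 _ _) hgen
    hG.u_x hG.u_y hG.u_pow fun Q5 _ f5 k5 g5 => ?_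
  exact (hG.map f5).card_le_of_u_eq_one g5 (by rw [← map_U5, k5])

end Bounds

/-! ### The second derived subgroup -/

/-- In G/N the image of h commutes with the generators, hence is central. -/
theorem mem_of_pcComm_mem {N : Subgroup G} [N.Normal] {x y h : G}
    (hgen : Subgroup.closure {x, y} = ⊤) (hx : pcComm h x ∈ N) (hy : pcComm h y ∈ N) (g : G) :
    pcComm h g ∈ N := by
  rw [← QuotientGroup.eq_one_iff] at hx hy ⊢
  have e : ∀ g : G, ((pcComm h g : G) : G ⧸ N) = pcComm (h : G ⧸ N) g := fun g =>
    map_pcComm (QuotientGroup.mk' N) h g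
  rw [e] at hx hy ⊢
  exact (commute_of_closure_eq_top
    (closure_pair_map_eq_top hgen (QuotientGroup.mk' N) (QuotientGroup.mk'_surjective N))
    (pcComm_eq_one_iff.1 hx) (pcComm_eq_one_iff.1 hy) g).pcComm_eq

/-- Adjoining to a normal abelian subgroup an element that is central modulo this subgroup and
centralizes it. -/
theorem normal_abelian_sup_zpowers {N : Subgroup G} [hN : N.Normal] {x y h : G}
    (hgen : Subgroup.closure {x, y} = ⊤) (hx : pcComm h x ∈ N) (hy : pcComm h y ∈ N)
    (hab : ∀ a ∈ N, ∀ b ∈ N, Commute a b) (hc : ∀ a ∈ N, Commute h a) :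
    (N ⊔ Subgroup.zpowers h).Normal ∧
      ∀ a ∈ N ⊔ Subgroup.zpowers h, ∀ b ∈ N ⊔ Subgroup.zpowers h, Commute a b := by
  have hm := mem_of_pcComm_mem hgen hx hy
  constructor
  · have e : N ⊔ Subgroup.zpowers h =
        (Subgroup.zpowers (h : G ⧸ N)).comap (QuotientGroup.mk' N) := by
      have : Subgroup.zpowers (h : G ⧸ N) = (Subgroup.zpowers h).map (QuotientGroup.mk' N) := by
        rw [MonoidHom.map_zpowers]; rfl
      rw [this, Subgroup.comap_map_eq, QuotientGroup.ker_mk', sup_comm]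
    rw [e]
    have : (Subgroup.zpowers (h : G ⧸ N)).Normal := by
      refine normal_of_central _ (zpowers_central fun g => ?_)
      induction g using QuotientGroup.induction_on with
      | H g =>
        rw [← pcComm_eq_one_iff]
        have := (QuotientGroup.eq_one_iff (N := N) _).2 (hm g)
        rwa [show ((pcComm h g : G) : G ⧸ N) = pcComm (h : G ⧸ N) g from
          map_pcComm (QuotientGroup.mk' N) h g] at this
    infer_instance
  · have h1 : ∀ b ∈ N ⊔ Subgroup.zpowers h, Commute h b := by
      have : N ⊔ Subgroup.zpowers h ≤ Subgroup.centralizer {h} := by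
        refine sup_le (fun a ha => Subgroup.mem_centralizer_singleton_iff.2 (hc a ha).symm) ?_
        rw [Subgroup.zpowers_le]
        exact Subgroup.mem_centralizer_singleton_iff.2 rfl
      exact fun b hb => (Subgroup.mem_centralizer_singleton_iff.1 (this hb)).symm
    have h2 : ∀ a ∈ N, ∀ b ∈ N ⊔ Subgroup.zpowers h, Commute a b := by
      intro a ha
      have : N ⊔ Subgroup.zpowers h ≤ Subgroup.centralizer {a} := by
        refine sup_le (fun b hb => Subgroup.mem_centralizer_singleton_iff.2 (hab b hb a ha)) ?_
        rw [Subgroup.zpowers_le]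
        exact Subgroup.mem_centralizer_singleton_iff.2 (hc a ha)
      exact fun b hb => (Subgroup.mem_centralizer_singleton_iff.1 (this hb)).symm
    intro a ha b hb
    have : N ⊔ Subgroup.zpowers h ≤ Subgroup.centralizer {b} := by
      refine sup_le (fun a ha => Subgroup.mem_centralizer_singleton_iff.2 (h2 a ha b hb)) ?_
      rw [Subgroup.zpowers_le]
      exact Subgroup.mem_centralizer_singleton_iff.2 (h1 b hb)
    exact Subgroup.mem_centralizer_singleton_iff.1 (this ha)

/-- Without u all the words commute with one another. Adjoining r, s₄, s₃, s₂ successively to ⟨s₅⟩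
keeps the subgroup normal and abelian, and the result contains the commutator subgroup. -/
theorem CoveringRel.derivedSeries_eq_bot {x y : G} (hgen : Subgroup.closure {x, y} = ⊤)
    (hG : CoveringRel x y) (hu : U5 x y = 1) : derivedSeries G 2 = ⊥ := by
  have c5 := commute_of_closure_eq_top hgen hG.s5_x hG.s5_y
  have cr := commute_of_closure_eq_top hgen hG.r_x hG.r_y
  have c32 : Commute (S3 x y) (S2 x y) := pcComm_eq_one_iff.1 (by simpa [hu] using hG.s3_s2)
  have mem_sup : ∀ {N : Subgroup G} {h : G}, h ∈ N ⊔ Subgroup.zpowers h := fun {N h} =>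
    Subgroup.mem_sup_right (Subgroup.mem_zpowers h)
  -- the abelian normal subgroup generated by the words
  have n0 := normal_of_central _ (zpowers_central c5)
  have a0 : ∀ a ∈ Subgroup.zpowers (S5 x y), ∀ b ∈ Subgroup.zpowers (S5 x y), Commute a b :=
    fun a ha b _ => zpowers_central c5 a ha b
  obtain ⟨n1, a1⟩ := normal_abelian_sup_zpowers (N := Subgroup.zpowers (S5 x y)) (h := R2 x y) hgen
    (by rw [hG.r_x.pcComm_eq]; exact one_mem _) (by rw [hG.r_y.pcComm_eq]; exact one_mem _) a0
    (fun a _ => cr a)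
  set N1 := Subgroup.zpowers (S5 x y) ⊔ Subgroup.zpowers (R2 x y) with hN1
  have z1 : ∀ h, ∀ a ∈ N1, Commute h a := by
    intro h
    have : N1 ≤ Subgroup.centralizer {h} := by
      refine sup_le ?_ ?_ <;> rw [Subgroup.zpowers_le] <;>
        refine Subgroup.mem_centralizer_singleton_iff.2 ?_
      · exact c5 h
      · exact cr h
    exact fun a ha => (Subgroup.mem_centralizer_singleton_iff.1 (this ha)).symm
  have hs5 : S5 x y ∈ N1 := Subgroup.mem_sup_left (Subgroup.mem_zpowers _)
  obtain ⟨n2, a2⟩ := normal_abelian_sup_zpowers (N := N1) (h := S4 x y) hgen hs5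
    (by rw [hG.s4_y, hu]; exact one_mem _) a1 (z1 _)
  set N2 := N1 ⊔ Subgroup.zpowers (S4 x y) with hN2
  have cent : ∀ {N : Subgroup G} {h k : G}, (∀ a ∈ N, Commute h a) → Commute h k →
      ∀ a ∈ N ⊔ Subgroup.zpowers k, Commute h a := by
    intro N h k hN hk
    have : N ⊔ Subgroup.zpowers k ≤ Subgroup.centralizer {h} := by
      refine sup_le (fun a ha => Subgroup.mem_centralizer_singleton_iff.2 (hN a ha).symm) ?_
      rw [Subgroup.zpowers_le]
      exact Subgroup.mem_centralizer_singleton_iff.2 hk.symm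
    exact fun a ha => (Subgroup.mem_centralizer_singleton_iff.1 (this ha)).symm
  obtain ⟨n3, a3⟩ := normal_abelian_sup_zpowers (N := N2) (h := S3 x y) hgen mem_sup
    (by rw [show pcComm (S3 x y) y = 1 from hu]; exact one_mem _) a2 (cent (z1 _) hG.s4_s3.symm)
  set N3 := N2 ⊔ Subgroup.zpowers (S3 x y) with hN3
  obtain ⟨n4, a4⟩ := normal_abelian_sup_zpowers (N := N3) (h := S2 x y) hgen mem_sup
    (Subgroup.mem_sup_left (Subgroup.mem_sup_left (Subgroup.mem_sup_right
      (Subgroup.mem_zpowers (R2 x y))))) a3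
    (cent (cent (z1 _) hG.s4_s2.symm) c32.symm)
  set N4 := N3 ⊔ Subgroup.zpowers (S2 x y) with hN4
  -- The normal subgroup contains s₂ = [y, x], so the generators commute modulo it.
  have hle : derivedSeries G 1 ≤ N4 := by
    rw [derivedSeries_one, commutator_def, Subgroup.commutator_le]
    intro g _ h _
    have hyx : ∀ k, pcComm y k ∈ N4 :=
      mem_of_pcComm_mem hgen mem_sup (by rw [(Commute.refl y).pcComm_eq]; exact one_mem _)
    have hxk : ∀ k, pcComm x k ∈ N4 :=
      mem_of_pcComm_mem hgen (by rw [(Commute.refl x).pcComm_eq]; exact one_mem _)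
        (by rw [← pcComm_inv]; exact inv_mem mem_sup)
    have hall : ∀ k l, pcComm k l ∈ N4 := fun k => mem_of_pcComm_mem hgen
      (by rw [← pcComm_inv]; exact inv_mem (hxk k)) (by rw [← pcComm_inv]; exact inv_mem (hyx k))
    have := hall g⁻¹ h⁻¹
    simpa [pcComm, commutatorElement_def] using this
  rw [derivedSeries_succ, eq_bot_iff]
  refine (Subgroup.commutator_mono hle hle).trans ?_
  rw [Subgroup.commutator_le]
  intro g hg h hh
  rw [Subgroup.mem_bot, commutatorElement_eq_one_iff_commute]
  exact a4 g hg h hh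

theorem pcComm_mem_derivedSeries {n : ℕ} {g h : G} (hg : g ∈ derivedSeries G n)
    (hh : h ∈ derivedSeries G n) : pcComm g h ∈ derivedSeries G (n + 1) := by
  have := Subgroup.commutator_mem_commutator (inv_mem hg) (inv_mem hh)
  rw [derivedSeries_succ]
  simpa [pcComm, commutatorElement_def] using this

/-- u⁻¹ = [s₃, s₂] is a commutator of two elements of G'. -/
theorem CoveringRel.u_mem_derivedSeries {x y : G} (hG : CoveringRel x y) :
    U5 x y ∈ derivedSeries G 2 := by
  have h2 : S2 x y ∈ derivedSeries G 1 :=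
    pcComm_mem_derivedSeries (n := 0) (Subgroup.mem_top _) (Subgroup.mem_top _)
  have h3 : S3 x y ∈ derivedSeries G 1 :=
    pcComm_mem_derivedSeries (n := 0) (Subgroup.mem_top _) (Subgroup.mem_top _)
  rw [← inv_mem_iff, ← eq_inv_of_mul_eq_one_left hG.s3_s2]
  exact pcComm_mem_derivedSeries h3 h2

/-- The second derived subgroup is generated by `u`. -/
theorem CoveringRel.derivedSeries_eq {x y : G} (hgen : Subgroup.closure {x, y} = ⊤)
    (hG : CoveringRel x y) : derivedSeries G 2 = Subgroup.zpowers (U5 x y) := by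
  apply le_antisymm
  · have := normal_of_central _ (zpowers_central (commute_of_closure_eq_top hgen hG.u_x hG.u_y))
    -- Dividing by the central subgroup ⟨u⟩ leaves a group with u = 1, which is metabelian.
    let f := QuotientGroup.mk' (Subgroup.zpowers (U5 x y))
    have hf : Function.Surjective f := QuotientGroup.mk'_surjective _
    have hb := (hG.map f).derivedSeries_eq_bot (closure_pair_map_eq_top hgen f hf) (by
      rw [← map_U5]
      exact (QuotientGroup.eq_one_iff _).2 (Subgroup.mem_zpowers _))
    rw [← map_derivedSeries_eq hf, Subgroup.map_eq_bot_iff, QuotientGroup.ker_mk'] at hb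
    exact hb
  · rw [Subgroup.zpowers_le]; exact hG.u_mem_derivedSeries

end Orders

/-! ### A concrete group with the relations of the covering group -/

/-- Normal forms `xⁱ exp(j y + k₂ s₂ + k₃ s₃ + k₄ s₄ + k₅ s₅ + a r + b u)`. -/
@[ext]
structure CoverModel : Type where
  i : ZMod 25
  j : ZMod 25
  k2 : ZMod 5
  k3 : ZMod 5
  k4 : ZMod 5
  k5 : ZMod 5
  a : ZMod 5
  b : ZMod 5
  deriving DecidableEq

namespace CoverModel

/-- Reduction modulo five. -/
def red : ZMod 25 →+* ZMod 5 := ZMod.castHom (by norm_num) (ZMod 5)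

/-- Binomial coefficients modulo five. -/
def ch (k : ℕ) (n : ZMod 5) : ZMod 5 := (n.val.choose k : ZMod 5)

theorem ch_two_add : ∀ m n, ch 2 (m + n) = ch 2 m + m * n + ch 2 n := by decide
theorem ch_three_add : ∀ m n, ch 3 (m + n) = ch 3 m + ch 2 m * n + m * ch 2 n + ch 3 n := by
  decide
theorem ch_four_add : ∀ m n,
    ch 4 (m + n) = ch 4 m + ch 3 m * n + ch 2 m * ch 2 n + m * ch 3 n + ch 4 n := by decide

/-- Besides the Vandermonde identities, associativity in the u-coordinate needs this: the brackets
there contribute n² as well as binomial coefficients. -/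
theorem ch_two_sq : ∀ n, n ^ 2 = n + 2 * ch 2 n := by decide

@[simp] theorem ch_two_zero : ch 2 0 = 0 := by decide
@[simp] theorem ch_three_zero : ch 3 0 = 0 := by decide
@[simp] theorem ch_four_zero : ch 4 0 = 0 := by decide

/-- The exponential factors multiply by Baker–Campbell–Hausdorff in class two, with brackets [s₂, y]
= r, [s₃, y] = [s₄, y] = u, [s₃, s₂] = -u; the constant 3 is 1/2 mod 5. Conjugation by x is
unipotent, so its powers involve binomial coefficients. The terms 2r for y and 3u for s₂ are the
half brackets in the logarithms of ys₂ and s₂s₃. The exponents of x and y live modulo 25 because x⁵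
and y⁵ have order five. -/
instance : Mul CoverModel where
  mul g h :=
    let n := red h.i
    let J := red g.j
    let J' := red h.j
    let l2 := g.k2 + n * J
    let l3 := g.k3 + n * g.k2 + ch 2 n * J
    let l4 := g.k4 + n * g.k3 + ch 2 n * g.k2 + ch 3 n * J
    let l5 := g.k5 + n * g.k4 + ch 2 n * g.k3 + ch 3 n * g.k2 + ch 4 n * J
    { i := g.i + h.i
      j := g.j + h.j
      k2 := l2 + h.k2
      k3 := l3 + h.k3
      k4 := l4 + h.k4
      k5 := l5 + h.k5
      a := g.a + 2 * n * J + h.a + 3 * (l2 * J' - J * h.k2)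
      b := g.b + 3 * (n * g.k2 + ch 2 n * J) + h.b +
        3 * (l3 * J' - J * h.k3 + (l4 * J' - J * h.k4) - (l3 * h.k2 - l2 * h.k3)) }

instance : One CoverModel := ⟨⟨0, 0, 0, 0, 0, 0, 0, 0⟩⟩

instance : Inv CoverModel where
  inv g :=
    let n := -red g.i
    let J := red g.j
    { i := -g.i
      j := -g.j
      k2 := -(g.k2 + n * J)
      k3 := -(g.k3 + n * g.k2 + ch 2 n * J)
      k4 := -(g.k4 + n * g.k3 + ch 2 n * g.k2 + ch 3 n * J)
      k5 := -(g.k5 + n * g.k4 + ch 2 n * g.k3 + ch 3 n * g.k2 + ch 4 n * J)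
      a := -(g.a + 2 * n * J)
      b := -(g.b + 3 * (n * g.k2 + ch 2 n * J)) }

section
variable (g h : CoverModel)
theorem mul_i : (g * h).i = g.i + h.i := rfl
theorem mul_j : (g * h).j = g.j + h.j := rfl
theorem mul_k2 : (g * h).k2 = g.k2 + red h.i * red g.j + h.k2 := rfl
theorem mul_k3 : (g * h).k3 = g.k3 + red h.i * g.k2 + ch 2 (red h.i) * red g.j + h.k3 := rfl
theorem mul_k4 : (g * h).k4 = g.k4 + red h.i * g.k3 + ch 2 (red h.i) * g.k2 +
    ch 3 (red h.i) * red g.j + h.k4 := rfl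
theorem mul_k5 : (g * h).k5 = g.k5 + red h.i * g.k4 + ch 2 (red h.i) * g.k3 +
    ch 3 (red h.i) * g.k2 + ch 4 (red h.i) * red g.j + h.k5 := rfl
theorem mul_a : (g * h).a = g.a + 2 * red h.i * red g.j + h.a +
    3 * ((g.k2 + red h.i * red g.j) * red h.j - red g.j * h.k2) := rfl
theorem mul_b : (g * h).b = g.b + 3 * (red h.i * g.k2 + ch 2 (red h.i) * red g.j) + h.b +
    3 * ((g.k3 + red h.i * g.k2 + ch 2 (red h.i) * red g.j) * red h.j - red g.j * h.k3 +
      ((g.k4 + red h.i * g.k3 + ch 2 (red h.i) * g.k2 + ch 3 (red h.i) * red g.j) * red h.j -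
        red g.j * h.k4) -
      ((g.k3 + red h.i * g.k2 + ch 2 (red h.i) * red g.j) * h.k2 -
        (g.k2 + red h.i * red g.j) * h.k3)) := rfl
end

theorem one_def : (1 : CoverModel) = ⟨0, 0, 0, 0, 0, 0, 0, 0⟩ := rfl

protected theorem mul_assoc (g h l : CoverModel) : g * h * l = g * (h * l) := by
  ext
  · simp only [mul_i]; ring
  · simp only [mul_j]; ring
  · simp only [mul_k2, mul_i, mul_j, map_add]; ring
  · simp only [mul_k3, mul_k2, mul_i, mul_j, map_add, ch_two_add]; ring
  · simp only [mul_k4, mul_k3, mul_k2, mul_i, mul_j, map_add, ch_two_add, ch_three_add]; ring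
  · simp only [mul_k5, mul_k4, mul_k3, mul_k2, mul_i, mul_j, map_add, ch_two_add, ch_three_add,
      ch_four_add]
    ring
  · simp only [mul_a, mul_k2, mul_i, mul_j, map_add]
    ring_nf
  · simp only [mul_b, mul_k4, mul_k3, mul_k2, mul_i, mul_j, map_add, ch_two_add, ch_three_add]
    linear_combination (-3 * red g.j * h.k2 + 3 * red h.i * red g.j * red h.j +
      3 * g.k2 * red h.j) * ch_two_sq (red l.i)

theorem ch_neg (n : ZMod 5) : ch 2 (-n) + -n * n + ch 2 n = 0 ∧
    ch 3 (-n) + ch 2 (-n) * n + -n * ch 2 n + ch 3 n = 0 ∧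
    ch 4 (-n) + ch 3 (-n) * n + ch 2 (-n) * ch 2 n + -n * ch 3 n + ch 4 n = 0 := by
  rw [← ch_two_add, ← ch_three_add, ← ch_four_add, neg_add_cancel]
  simp

protected theorem inv_mul_cancel (g : CoverModel) : g⁻¹ * g = 1 := by
  obtain ⟨h2, h3, h4⟩ := ch_neg (red g.i)
  have i2 : g⁻¹.k2 = -(g.k2 + -red g.i * red g.j) := rfl
  have i3 : g⁻¹.k3 = -(g.k3 + -red g.i * g.k2 + ch 2 (-red g.i) * red g.j) := rfl
  have i4 : g⁻¹.k4 = -(g.k4 + -red g.i * g.k3 + ch 2 (-red g.i) * g.k2 +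
    ch 3 (-red g.i) * red g.j) := rfl
  have i5 : g⁻¹.k5 = -(g.k5 + -red g.i * g.k4 + ch 2 (-red g.i) * g.k3 +
    ch 3 (-red g.i) * g.k2 + ch 4 (-red g.i) * red g.j) := rfl
  have ia : g⁻¹.a = -(g.a + 2 * -red g.i * red g.j) := rfl
  have ib : g⁻¹.b = -(g.b + 3 * (-red g.i * g.k2 + ch 2 (-red g.i) * red g.j)) := rfl
  have ij : g⁻¹.j = -g.j := rfl
  have ii : g⁻¹.i = -g.i := rfl
  rw [one_def]
  ext
  · simp [mul_i, ii]
  · simp [mul_j, ij]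
  · simp only [mul_k2, i2, ij, map_neg]; ring
  · simp only [mul_k3, i3, i2, ij, map_neg]; linear_combination (-red g.j) * h2
  · simp only [mul_k4, i4, i3, i2, ij, map_neg]
    linear_combination (-g.k2) * h2 - (red g.j) * h3
  · simp only [mul_k5, i5, i4, i3, i2, ij, map_neg]
    linear_combination (-g.k3) * h2 - g.k2 * h3 - (red g.j) * h4
  · simp only [mul_a, ia, i2, ij, map_neg]; ring
  · simp only [mul_b, ib, i4, i3, i2, ij, map_neg]
    linear_combination (-3 * red g.j - 3 * red g.j ^ 2) * h2 - 3 * red g.j ^ 2 * h3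

instance : Group CoverModel :=
  Group.ofLeftAxioms CoverModel.mul_assoc
    (fun g => by
      rw [one_def]
      ext <;> simp [mul_i, mul_j, mul_k2, mul_k3, mul_k4, mul_k5, mul_a, mul_b])
    CoverModel.inv_mul_cancel

/-- The two generators. -/
def gx : CoverModel := ⟨1, 0, 0, 0, 0, 0, 0, 0⟩
def gy : CoverModel := ⟨0, 1, 0, 0, 0, 0, 0, 0⟩

theorem S2_eq : S2 gx gy = ⟨0, 0, 1, 0, 0, 0, 0, 0⟩ := by rw [S2]; decide
theorem S3_eq : S3 gx gy = ⟨0, 0, 0, 1, 0, 0, 0, 0⟩ := by rw [S3, S2_eq]; decide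
theorem S4_eq : S4 gx gy = ⟨0, 0, 0, 0, 1, 0, 0, 0⟩ := by rw [S4, S3_eq]; decide
theorem S5_eq : S5 gx gy = ⟨0, 0, 0, 0, 0, 1, 0, 0⟩ := by rw [S5, S4_eq]; decide
theorem R2_eq : R2 gx gy = ⟨0, 0, 0, 0, 0, 0, 1, 0⟩ := by rw [R2, S2_eq]; decide
theorem U5_eq : U5 gx gy = ⟨0, 0, 0, 0, 0, 0, 0, 1⟩ := by rw [U5, S3_eq]; decide

theorem coveringRel : CoveringRel gx gy where
  s5_x := by rw [S5_eq, Commute, SemiconjBy]; decide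
  s5_y := by rw [S5_eq, Commute, SemiconjBy]; decide
  u_x := by rw [U5_eq, Commute, SemiconjBy]; decide
  u_y := by rw [U5_eq, Commute, SemiconjBy]; decide
  r_x := by rw [R2_eq, Commute, SemiconjBy]; decide
  r_y := by rw [R2_eq, Commute, SemiconjBy]; decide
  px_y := by rw [Commute, SemiconjBy]; decide
  py_x := by rw [Commute, SemiconjBy]; decide
  s2_pow := by rw [S2_eq]; decide
  s3_pow := by rw [S3_eq]; decide
  s4_pow := by rw [S4_eq]; decide
  s5_pow := by rw [S5_eq]; decide
  u_pow := by rw [U5_eq]; decide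
  r_pow := by rw [R2_eq]; decide
  px_pow := by decide
  py_pow := by decide
  s4_y := by rw [S4_eq, U5_eq]; decide
  s3_s2 := by rw [S3_eq, S2_eq, U5_eq]; decide
  s4_s2 := by rw [S4_eq, S2_eq, Commute, SemiconjBy]; decide
  s4_s3 := by rw [S4_eq, S3_eq, Commute, SemiconjBy]; decide

theorem gx_pow (n : ℕ) : gx ^ n = ⟨n, 0, 0, 0, 0, 0, 0, 0⟩ := by
  induction n with
  | zero => rfl
  | succ n ih =>
    rw [pow_succ, ih, gx]
    ext <;> simp [mul_i, mul_j, mul_k2, mul_k3, mul_k4, mul_k5, mul_a, mul_b]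

theorem gy_pow (n : ℕ) : gy ^ n = ⟨0, n, 0, 0, 0, 0, 0, 0⟩ := by
  induction n with
  | zero => rfl
  | succ n ih =>
    rw [pow_succ, ih, gy]
    ext <;> simp [mul_i, mul_j, mul_k2, mul_k3, mul_k4, mul_k5, mul_a, mul_b]

theorem closure_eq_top : Subgroup.closure {gx, gy} = ⊤ := by
  set K := Subgroup.closure {gx, gy} with hK
  have mx : gx ∈ K := Subgroup.subset_closure (by simp)
  have my : gy ∈ K := Subgroup.subset_closure (by simp)
  have mc : ∀ {g h}, g ∈ K → h ∈ K → pcComm g h ∈ K := fun hg hh =>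
    mul_mem (mul_mem (mul_mem (inv_mem hg) (inv_mem hh)) hg) hh
  have m2 : S2 gx gy ∈ K := mc my mx
  have m3 : S3 gx gy ∈ K := mc m2 mx
  have m4 : S4 gx gy ∈ K := mc m3 mx
  have m5 : S5 gx gy ∈ K := mc m4 mx
  have mr : R2 gx gy ∈ K := mc m2 my
  have mu : U5 gx gy ∈ K := mc m3 my
  have p2 : ∀ n : ℕ, S2 gx gy ^ n = ⟨0, 0, n, 0, 0, 0, 0, 0⟩ := fun n => by
    induction n with
    | zero => rfl
    | succ n ih =>
      rw [pow_succ, ih, S2_eq]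
      ext <;> simp [mul_i, mul_j, mul_k2, mul_k3, mul_k4, mul_k5, mul_a, mul_b]
  have p3 : ∀ n : ℕ, S3 gx gy ^ n = ⟨0, 0, 0, n, 0, 0, 0, 0⟩ := fun n => by
    induction n with
    | zero => rfl
    | succ n ih =>
      rw [pow_succ, ih, S3_eq]
      ext <;> simp [mul_i, mul_j, mul_k2, mul_k3, mul_k4, mul_k5, mul_a, mul_b]
  have p4 : ∀ n : ℕ, S4 gx gy ^ n = ⟨0, 0, 0, 0, n, 0, 0, 0⟩ := fun n => by
    induction n with
    | zero => rfl
    | succ n ih =>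
      rw [pow_succ, ih, S4_eq]
      ext <;> simp [mul_i, mul_j, mul_k2, mul_k3, mul_k4, mul_k5, mul_a, mul_b]
  have p5 : ∀ n : ℕ, S5 gx gy ^ n = ⟨0, 0, 0, 0, 0, n, 0, 0⟩ := fun n => by
    induction n with
    | zero => rfl
    | succ n ih =>
      rw [pow_succ, ih, S5_eq]
      ext <;> simp [mul_i, mul_j, mul_k2, mul_k3, mul_k4, mul_k5, mul_a, mul_b]
  have pr : ∀ n : ℕ, R2 gx gy ^ n = ⟨0, 0, 0, 0, 0, 0, n, 0⟩ := fun n => by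
    induction n with
    | zero => rfl
    | succ n ih =>
      rw [pow_succ, ih, R2_eq]
      ext <;> simp [mul_i, mul_j, mul_k2, mul_k3, mul_k4, mul_k5, mul_a, mul_b]
  have pu : ∀ n : ℕ, U5 gx gy ^ n = ⟨0, 0, 0, 0, 0, 0, 0, n⟩ := fun n => by
    induction n with
    | zero => rfl
    | succ n ih =>
      rw [pow_succ, ih, U5_eq]
      ext <;> simp [mul_i, mul_j, mul_k2, mul_k3, mul_k4, mul_k5, mul_a, mul_b]
  have e1 : ∀ b : ZMod 5, (⟨0, 0, 0, 0, 0, 0, 0, b⟩ : CoverModel) ∈ K := fun b => by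
    have := pow_mem mu b.val
    rwa [pu, ZMod.natCast_zmod_val] at this
  have e2 : ∀ a b : ZMod 5, (⟨0, 0, 0, 0, 0, 0, a, b⟩ : CoverModel) ∈ K := fun a b => by
    have := mul_mem (pow_mem mr a.val) (e1 b)
    rw [pr, ZMod.natCast_zmod_val] at this
    convert this using 1
    ext <;> simp [mul_i, mul_j, mul_k2, mul_k3, mul_k4, mul_k5, mul_a, mul_b]
  have e3 : ∀ k5 a b : ZMod 5, (⟨0, 0, 0, 0, 0, k5, a, b⟩ : CoverModel) ∈ K := fun k5 a b => by
    have := mul_mem (pow_mem m5 k5.val) (e2 a b)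
    rw [p5, ZMod.natCast_zmod_val] at this
    convert this using 1
    ext <;> simp [mul_i, mul_j, mul_k2, mul_k3, mul_k4, mul_k5, mul_a, mul_b]
  have e4 : ∀ k4 k5 a b : ZMod 5, (⟨0, 0, 0, 0, k4, k5, a, b⟩ : CoverModel) ∈ K :=
      fun k4 k5 a b => by
    have := mul_mem (pow_mem m4 k4.val) (e3 k5 a b)
    rw [p4, ZMod.natCast_zmod_val] at this
    convert this using 1
    ext <;> simp [mul_i, mul_j, mul_k2, mul_k3, mul_k4, mul_k5, mul_a, mul_b]
  have e5 : ∀ k3 k4 k5 a b : ZMod 5, (⟨0, 0, 0, k3, k4, k5, a, b⟩ : CoverModel) ∈ K :=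
      fun k3 k4 k5 a b => by
    have := mul_mem (pow_mem m3 k3.val) (e4 k4 k5 a b)
    rw [p3, ZMod.natCast_zmod_val] at this
    convert this using 1
    ext <;> simp [mul_i, mul_j, mul_k2, mul_k3, mul_k4, mul_k5, mul_a, mul_b]
  have e6 : ∀ k2 k3 k4 k5 a b : ZMod 5, (⟨0, 0, k2, k3, k4, k5, a, b⟩ : CoverModel) ∈ K :=
      fun k2 k3 k4 k5 a b => by
    -- The shift of the last coordinate cancels the half bracket of s₂ and s₃ created by the
    -- product; the shifts in `e7` do the same for y with s₂, s₃, s₄.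
    have := mul_mem (pow_mem m2 k2.val) (e5 k3 k4 k5 a (b - 3 * (k2 * k3)))
    rw [p2, ZMod.natCast_zmod_val] at this
    convert this using 1
    ext <;> simp [mul_i, mul_j, mul_k2, mul_k3, mul_k4, mul_k5, mul_a, mul_b]
  have e7 : ∀ (j : ZMod 25) (k2 k3 k4 k5 a b : ZMod 5),
      (⟨0, j, k2, k3, k4, k5, a, b⟩ : CoverModel) ∈ K := fun j k2 k3 k4 k5 a b => by
    have := mul_mem (pow_mem my j.val)
      (e6 k2 k3 k4 k5 (a + 3 * (red j * k2)) (b + 3 * (red j * k3 + red j * k4)))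
    rw [gy_pow, ZMod.natCast_zmod_val] at this
    convert this using 1
    ext <;> simp [mul_i, mul_j, mul_k2, mul_k3, mul_k4, mul_k5, mul_a, mul_b]
    ring
  rw [eq_top_iff]
  rintro ⟨i, j, k2, k3, k4, k5, a, b⟩ -
  have := mul_mem (pow_mem mx i.val) (e7 j k2 k3 k4 k5 a b)
  rw [gx_pow, ZMod.natCast_zmod_val] at this
  convert this using 1
  ext <;> simp [mul_i, mul_j, mul_k2, mul_k3, mul_k4, mul_k5, mul_a, mul_b]

theorem card_eq : Nat.card CoverModel = 5 ^ 10 := by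
  let e : CoverModel ≃ ZMod 25 × ZMod 25 × ZMod 5 × ZMod 5 × ZMod 5 × ZMod 5 × ZMod 5 × ZMod 5 :=
    { toFun := fun g => (g.i, g.j, g.k2, g.k3, g.k4, g.k5, g.a, g.b)
      invFun := fun g => ⟨g.1, g.2.1, g.2.2.1, g.2.2.2.1, g.2.2.2.2.1, g.2.2.2.2.2.1,
        g.2.2.2.2.2.2.1, g.2.2.2.2.2.2.2⟩
      left_inv := fun _ => rfl
      right_inv := fun _ => rfl }
  rw [Nat.card_congr e]
  simp only [Nat.card_prod, Nat.card_zmod]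
  norm_num

end CoverModel

/-! ### The covering group -/

/-- The words whose triviality expresses the relations of the covering group. -/
def coveringWords {G : Type*} [Group G] (x y : G) : List G :=
  [pcComm (S5 x y) x, pcComm (S5 x y) y, pcComm (U5 x y) x, pcComm (U5 x y) y,
    pcComm (R2 x y) x, pcComm (R2 x y) y, pcComm (x ^ 5) y, pcComm (y ^ 5) x,
    S2 x y ^ 5, S3 x y ^ 5, S4 x y ^ 5, S5 x y ^ 5, U5 x y ^ 5, R2 x y ^ 5,
    (x ^ 5) ^ 5, (y ^ 5) ^ 5, pcComm (S4 x y) y * (U5 x y)⁻¹,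
    pcComm (S3 x y) (S2 x y) * U5 x y, pcComm (S4 x y) (S2 x y), pcComm (S4 x y) (S3 x y)]

theorem coveringRel_iff {G : Type*} [Group G] (x y : G) :
    CoveringRel x y ↔ ∀ w ∈ coveringWords x y, w = 1 := by
  constructor
  · rintro ⟨⟩
    simp only [coveringWords, List.forall_mem_cons, pcComm_eq_one_iff, mul_inv_eq_one]
    simp_all
  · intro h
    simp only [coveringWords, List.forall_mem_cons, pcComm_eq_one_iff, mul_inv_eq_one] at h
    obtain ⟨h1, h2, h3, h4, h5, h6, h7, h8, h9, h10, h11, h12, h13, h14, h15, h16, h17, h18, h19,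
      h20, -⟩ := h
    exact ⟨h1, h2, h3, h4, h5, h6, h7, h8, h9, h10, h11, h12, h13, h14, h15, h16, h17, h18, h19,
      h20⟩

theorem map_coveringWords {G H : Type*} [Group G] [Group H] (f : G →* H) (x y : G) :
    (coveringWords x y).map f = coveringWords (f x) (f y) := by
  simp only [coveringWords, List.map_cons, List.map_nil, map_pcComm, map_mul, map_inv, map_pow,
    map_S2, map_S3, map_S4, map_S5, map_U5, map_R2]

/-- The common covering group of the groups `⟨15625, 635⟩` and `⟨78125, n⟩`. -/
abbrev CoveringGroup : Type :=
  PresentedGroup {w : FreeGroup Bool | w ∈ coveringWords (FreeGroup.of true) (FreeGroup.of false)}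

namespace CoveringGroup

def x : CoveringGroup := PresentedGroup.of true
def y : CoveringGroup := PresentedGroup.of false

theorem coveringRel : CoveringRel x y := by
  rw [coveringRel_iff]
  intro w hw
  have h : coveringWords x y =
      (coveringWords (FreeGroup.of true) (FreeGroup.of false)).map (PresentedGroup.mk _) :=
    (map_coveringWords _ _ _).symm
  rw [h, List.mem_map] at hw
  obtain ⟨v, hv, rfl⟩ := hw
  exact PresentedGroup.one_of_mem hv

theorem closure_eq_top : Subgroup.closure {x, y} = ⊤ := by
  rw [eq_top_iff, ← PresentedGroup.closure_range_of, Subgroup.closure_le]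
  rintro _ ⟨c, rfl⟩
  cases c
  · exact Subgroup.subset_closure (by right; rfl)
  · exact Subgroup.subset_closure (by left; rfl)

/-- The universal property of the covering group. -/
theorem exists_lift {G : Type*} [Group G] {g h : G} (hG : CoveringRel g h) :
    ∃ f : CoveringGroup →* G, f x = g ∧ f y = h := by
  let F : Bool → G := fun c => if c then g else h
  have hF : ∀ w ∈ {w : FreeGroup Bool |
      w ∈ coveringWords (FreeGroup.of true) (FreeGroup.of false)}, FreeGroup.lift F w = 1 := by
    intro w hw
    refine (coveringRel_iff g h).1 hG _ ?_
    have := List.mem_map_of_mem (f := FreeGroup.lift F) hw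
    rw [map_coveringWords] at this
    simpa [F] using this
  exact ⟨PresentedGroup.toGroup hF, by simp [x, F], by simp [y, F]⟩

theorem hom_ext {G : Type*} [Group G] {f g : CoveringGroup →* G} (hx : f x = g x)
    (hy : f y = g y) : f = g := by
  apply PresentedGroup.ext
  rintro (_ | _)
  · exact hy
  · exact hx

instance : Finite CoveringGroup := (coveringRel.card_le closure_eq_top).1

theorem card_eq : Nat.card CoveringGroup = 5 ^ 10 := by
  refine le_antisymm (coveringRel.card_le closure_eq_top).2 ?_
  obtain ⟨f, hx, hy⟩ := exists_lift CoverModel.coveringRel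
  rw [← CoverModel.card_eq]
  exact Nat.card_le_card_of_surjective f
    (surjective_of_closure_eq_top CoverModel.closure_eq_top f ⟨x, hx⟩ ⟨y, hy⟩)

end CoveringGroup

/-! ### Quotients of the covering group -/

namespace CoveringGroup

/-- A central elementary abelian subgroup of the covering group, contained in the Frattini
subgroup. -/
def centralPart : Subgroup CoveringGroup :=
  Subgroup.closure {S5 x y, U5 x y, R2 x y, x ^ 5, y ^ 5}

theorem commute_of_mem_centralPart {z : CoveringGroup} (hz : z ∈ centralPart) (g : CoveringGroup) :
    Commute z g := by
  have h : centralPart ≤ Subgroup.center CoveringGroup := by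
    rw [centralPart, Subgroup.closure_le]
    have hG := coveringRel
    have c : ∀ {w}, Commute w x → Commute w y → w ∈ Subgroup.center CoveringGroup :=
      fun h1 h2 => Subgroup.mem_center_iff.2
        fun g => (commute_of_closure_eq_top closure_eq_top h1 h2 g).symm
    rintro w (rfl | rfl | rfl | rfl | rfl)
    · exact c hG.s5_x hG.s5_y
    · exact c hG.u_x hG.u_y
    · exact c hG.r_x hG.r_y
    · exact c ((Commute.refl x).pow_left 5) hG.px_y
    · exact c hG.py_x ((Commute.refl y).pow_left 5)
  exact (Subgroup.mem_center_iff.1 (h hz) g).symm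

theorem pow_of_mem_centralPart {z : CoveringGroup} (hz : z ∈ centralPart) : z ^ 5 = 1 := by
  have hG := coveringRel
  induction hz using Subgroup.closure_induction with
  | mem w hw =>
    rcases hw with rfl | rfl | rfl | rfl | rfl
    exacts [hG.s5_pow, hG.u_pow, hG.r_pow, hG.px_pow, hG.py_pow]
  | one => exact one_pow 5
  | mul a b ha _ h1 h2 => rw [(commute_of_mem_centralPart ha b).mul_pow, h1, h2, one_mul]
  | inv a _ h1 => rw [inv_pow, h1, inv_one]

/-- The generators of this subgroup are commutators and fifth powers. This is the Frattini condition
in `pow_relationRank_eq_card_ker`. -/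
theorem hom_eq_one_of_mem_centralPart (ψ : CoveringGroup →* Multiplicative (ZMod 5))
    {z : CoveringGroup} (hz : z ∈ centralPart) : ψ z = 1 := by
  have c : ∀ g h : Multiplicative (ZMod 5), pcComm g h = 1 := fun g h =>
    (Commute.all g h).pcComm_eq
  have p : ∀ g : Multiplicative (ZMod 5), g ^ 5 = 1 := by decide
  have h : centralPart ≤ ψ.ker := by
    rw [centralPart, Subgroup.closure_le]
    rintro w (rfl | rfl | rfl | rfl | rfl)
    · exact (map_S5 ψ x y).trans (c _ _)
    · exact (map_U5 ψ x y).trans (c _ _)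
    · exact (map_R2 ψ x y).trans (c _ _)
    · exact (map_pow ψ x 5).trans (p _)
    · exact (map_pow ψ y 5).trans (p _)
  exact h hz

/-- The subgroup generated by the relators of a cover. -/
def coverKernel (b d e : ℕ) : Subgroup CoveringGroup :=
  Subgroup.zpowers (x ^ 5 * (S5 x y * U5 x y ^ b)⁻¹) ⊔
    Subgroup.zpowers (y ^ 5 * (S5 x y ^ 4 * U5 x y ^ d)⁻¹) ⊔
    Subgroup.zpowers (R2 x y * (U5 x y ^ e)⁻¹)

/-- The subgroup generated by the relators of the metabelian group. -/
def baseKernel : Subgroup CoveringGroup := coverKernel 0 0 0 ⊔ Subgroup.zpowers (U5 x y)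

theorem s5_mem : S5 x y ∈ centralPart := Subgroup.subset_closure (by simp)
theorem u5_mem : U5 x y ∈ centralPart := Subgroup.subset_closure (by simp)

theorem px_mem (b : ℕ) : x ^ 5 * (S5 x y * U5 x y ^ b)⁻¹ ∈ centralPart :=
  mul_mem (Subgroup.subset_closure (by simp)) (inv_mem (mul_mem s5_mem (pow_mem u5_mem b)))
theorem py_mem (d : ℕ) : y ^ 5 * (S5 x y ^ 4 * U5 x y ^ d)⁻¹ ∈ centralPart :=
  mul_mem (Subgroup.subset_closure (by simp))
    (inv_mem (mul_mem (pow_mem s5_mem 4) (pow_mem u5_mem d)))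
theorem r_mem (e : ℕ) : R2 x y * (U5 x y ^ e)⁻¹ ∈ centralPart :=
  mul_mem (Subgroup.subset_closure (by simp)) (inv_mem (pow_mem u5_mem e))

theorem coverKernel_le (b d e : ℕ) : coverKernel b d e ≤ centralPart := by
  refine sup_le (sup_le ?_ ?_) ?_ <;> rw [Subgroup.zpowers_le]
  exacts [px_mem b, py_mem d, r_mem e]

theorem baseKernel_le : baseKernel ≤ centralPart :=
  sup_le (coverKernel_le 0 0 0) ((Subgroup.zpowers_le).2 u5_mem)

theorem normal_of_le_centralPart {V : Subgroup CoveringGroup} (h : V ≤ centralPart) : V.Normal :=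
  normal_of_central V fun _ hz => commute_of_mem_centralPart (h hz)

open scoped Pointwise in
theorem card_sup_zpowers_le {V : Subgroup CoveringGroup} {z : CoveringGroup}
    (hz : z ∈ centralPart) {n : ℕ} (hV : Nat.card V ≤ n) :
    Nat.card ↥(V ⊔ Subgroup.zpowers z) ≤ n * 5 := by
  have := normal_of_le_centralPart ((Subgroup.zpowers_le (H := centralPart)).2 hz)
  have h1 : Nat.card ↥(V ⊔ Subgroup.zpowers z) =
      Nat.card ((V : Set CoveringGroup) * (Subgroup.zpowers z : Set CoveringGroup) : Set _) := by
    rw [← Subgroup.mul_normal]; rfl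
  rw [h1]
  exact Set.natCard_mul_le.trans (Nat.mul_le_mul hV
    (finite_and_card_zpowers_le (pow_of_mem_centralPart hz)).2)

/-- An upper bound is enough: with |Γ| = 5¹⁰ it bounds the quotient from below, matching
`CoverRel.card_le`. -/
theorem card_coverKernel_le (b d e : ℕ) : Nat.card (coverKernel b d e) ≤ 5 ^ 3 :=
  card_sup_zpowers_le (r_mem e) (card_sup_zpowers_le (py_mem d)
    (finite_and_card_zpowers_le (pow_of_mem_centralPart (px_mem b))).2)

theorem card_baseKernel_le : Nat.card baseKernel ≤ 5 ^ 4 :=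
  card_sup_zpowers_le u5_mem (card_coverKernel_le 0 0 0)

theorem coverRel_of_coverKernel_le {G : Type*} [Group G] {b d e : ℕ} {f : CoveringGroup →* G}
    (h : coverKernel b d e ≤ f.ker) : CoverRel b d e (f x) (f y) := by
  have k : ∀ {g g' : CoveringGroup}, g * g'⁻¹ ∈ coverKernel b d e → f g = f g' := by
    intro g g' hg
    have := h hg
    rwa [MonoidHom.mem_ker, map_mul, map_inv, mul_inv_eq_one] at this
  refine ⟨coveringRel.map f, ?_, ?_, ?_⟩
  · rw [← map_S5, ← map_U5, ← map_pow, ← map_pow, ← map_mul]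
    exact k (Subgroup.mem_sup_left (Subgroup.mem_sup_left (Subgroup.mem_zpowers _)))
  · rw [← map_S5, ← map_U5, ← map_pow, ← map_pow, ← map_pow, ← map_mul]
    exact k (Subgroup.mem_sup_left (Subgroup.mem_sup_right (Subgroup.mem_zpowers _)))
  · rw [← map_R2, ← map_U5, ← map_pow]
    exact k (Subgroup.mem_sup_right (Subgroup.mem_zpowers _))

theorem coverKernel_le_ker {G : Type*} [Group G] {b d e : ℕ} {f : CoveringGroup →* G}
    (hG : CoverRel b d e (f x) (f y)) : coverKernel b d e ≤ f.ker := by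
  refine sup_le (sup_le ?_ ?_) ?_ <;>
    rw [Subgroup.zpowers_le, MonoidHom.mem_ker, map_mul, map_inv, mul_inv_eq_one]
  · simpa [map_S5, map_U5] using hG.px
  · simpa [map_S5, map_U5] using hG.py
  · simpa [map_R2, map_U5] using hG.r

theorem card_quotient_mul (V : Subgroup CoveringGroup) :
    Nat.card (CoveringGroup ⧸ V) * Nat.card V = 5 ^ 10 := by
  rw [← card_eq, Subgroup.card_eq_card_quotient_mul_card_subgroup V]

end CoveringGroup

open CoveringGroup in
/-- A cover of order `5⁷` exists for every choice of the parameters. -/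
theorem exists_coverRel (b d e : ℕ) : ∃ (E : Type) (_ : Group E) (x y : E),
    Subgroup.closure {x, y} = ⊤ ∧ CoverRel b d e x y ∧ Nat.card E = 5 ^ 7 := by
  have hn := normal_of_le_centralPart (coverKernel_le b d e)
  let f := QuotientGroup.mk' (coverKernel b d e)
  have hgen : Subgroup.closure {f x, f y} = ⊤ :=
    closure_pair_map_eq_top closure_eq_top f (QuotientGroup.mk'_surjective _)
  have hG : CoverRel b d e (f x) (f y) :=
    coverRel_of_coverKernel_le (by rw [QuotientGroup.ker_mk'])
  refine ⟨CoveringGroup ⧸ coverKernel b d e, inferInstance, f x, f y, hgen, hG, ?_⟩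
  refine le_antisymm (hG.card_le hgen).2 ?_
  have h1 := card_quotient_mul (coverKernel b d e)
  have h2 := card_coverKernel_le b d e
  by_contra h
  have h3 : Nat.card (CoveringGroup ⧸ coverKernel b d e) * Nat.card (coverKernel b d e) <
      5 ^ 7 * 5 ^ 3 :=
    (Nat.mul_le_mul_left _ h2).trans_lt (Nat.mul_lt_mul_of_pos_right (not_le.1 h) (by norm_num))
  rw [h1] at h3
  norm_num at h3

open CoveringGroup in
theorem exists_coverRel_of_u_eq_one : ∃ (E : Type) (_ : Group E) (x y : E),
    Subgroup.closure {x, y} = ⊤ ∧ CoverRel 0 0 0 x y ∧ U5 x y = 1 ∧ Nat.card E = 5 ^ 6 := by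
  have hn := normal_of_le_centralPart baseKernel_le
  let f := QuotientGroup.mk' baseKernel
  have hgen : Subgroup.closure {f x, f y} = ⊤ :=
    closure_pair_map_eq_top closure_eq_top f (QuotientGroup.mk'_surjective _)
  have hG : CoverRel 0 0 0 (f x) (f y) :=
    coverRel_of_coverKernel_le (by rw [QuotientGroup.ker_mk']; exact le_sup_left)
  have hu : U5 (f x) (f y) = 1 := by
    rw [← map_U5]
    exact (QuotientGroup.eq_one_iff _).2 (Subgroup.mem_sup_right (Subgroup.mem_zpowers _))
  refine ⟨CoveringGroup ⧸ baseKernel, inferInstance, f x, f y, hgen, hG, hu, ?_⟩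
  refine le_antisymm (hG.card_le_of_u_eq_one hgen hu).2 ?_
  have h1 := card_quotient_mul baseKernel
  have h2 := card_baseKernel_le
  by_contra h
  have h3 : Nat.card (CoveringGroup ⧸ baseKernel) * Nat.card baseKernel < 5 ^ 6 * 5 ^ 4 :=
    (Nat.mul_le_mul_left _ h2).trans_lt (Nat.mul_lt_mul_of_pos_right (not_le.1 h) (by norm_num))
  rw [h1] at h3
  norm_num at h3

/-! ### Relation ranks of the quotients of the covering group -/

section RelationRank

variable {G : Type} [Group G]

-- Counting identifies the kernel of f with V, so Γ → G has a central elementary abelian kernel of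
-- Frattini type, and 5^d₂ is the order of that kernel.
open CoveringGroup in
theorem pow_relationRank_mul_card {b d e : ℕ} {f : CoveringGroup →* G}
    (hf : Function.Surjective f) (hG : CoverRel b d e (f x) (f y)) {V : Subgroup CoveringGroup}
    (hV : V ≤ centralPart) (hker : V ≤ f.ker)
    (hcard : Nat.card (CoveringGroup ⧸ V) ≤ Nat.card G) :
    5 ^ relationRank 5 G * Nat.card G = 5 ^ 10 := by
  have hkV : f.ker = V := by
    symm
    apply Subgroup.eq_of_le_of_card_ge hker
    have h1 := card_quotient_mul V
    have h2 := card_quotient_mul f.ker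
    have h3 : Nat.card (CoveringGroup ⧸ f.ker) = Nat.card G :=
      Nat.card_congr (QuotientGroup.quotientKerEquivOfSurjective f hf).toEquiv
    rw [h3, ← h1] at h2
    have : Finite G := Finite.of_surjective f hf
    have hpos : 0 < Nat.card G := Nat.card_pos
    exact Nat.le_of_mul_le_mul_left (h2.trans_le (Nat.mul_le_mul_right _ hcard)) hpos
  rw [pow_relationRank_eq_card_ker 5 f hf
    (fun a ha => commute_of_mem_centralPart (hV (hkV ▸ ha)))
    (fun a ha => pow_of_mem_centralPart (hV (hkV ▸ ha))) inferInstance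
    (fun ψ a ha => hom_eq_one_of_mem_centralPart ψ (hV (hkV ▸ ha))) ?_, mul_comm]
  · rw [← card_quotient_mul f.ker,
      Nat.card_congr (QuotientGroup.quotientKerEquivOfSurjective f hf).toEquiv]
  -- Arbitrary lifts to H of the two generators satisfy the covering relations by `CoverRel.lift`,
  -- and so define the required map from Γ.
  · intro H _ q hq hc hp
    obtain ⟨g, hg⟩ := hq (f x)
    obtain ⟨h, hh⟩ := hq (f y)
    obtain ⟨l, hl1, hl2⟩ := exists_lift
      (CoverRel.lift (x := g) (y := h) (b := b) (d := d) (e := e) q hc hp (by rwa [hg, hh]))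
    exact ⟨l, hom_ext (by simp [hl1, hg]) (by simp [hl2, hh])⟩

open CoveringGroup in
theorem CoverRel.relationRank_eq {x y : G} {b d e : ℕ} (hgen : Subgroup.closure {x, y} = ⊤)
    (hG : CoverRel b d e x y) (hcard : Nat.card G = 5 ^ 7) : relationRank 5 G = 3 := by
  obtain ⟨f, rfl, rfl⟩ := exists_lift hG.toCoveringRel
  have hn := normal_of_le_centralPart (coverKernel_le b d e)
  have h := pow_relationRank_mul_card
    (surjective_of_closure_eq_top hgen f ⟨_, rfl⟩ ⟨_, rfl⟩) hG (coverKernel_le b d e)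
    (coverKernel_le_ker hG) (by
      rw [hcard]
      exact (CoverRel.card_le (closure_pair_map_eq_top closure_eq_top _
        (QuotientGroup.mk'_surjective (coverKernel b d e)))
        (coverRel_of_coverKernel_le (b := b) (d := d) (e := e) (by rw [QuotientGroup.ker_mk']))).2)
  rw [hcard, show (5 : ℕ) ^ 10 = 5 ^ 3 * 5 ^ 7 by norm_num] at h
  exact Nat.pow_right_injective (show 2 ≤ 5 by norm_num)
    (Nat.eq_of_mul_eq_mul_right (show 0 < 5 ^ 7 by norm_num) h)

open CoveringGroup in
theorem CoverRel.relationRank_eq_of_u_eq_one {x y : G} (hgen : Subgroup.closure {x, y} = ⊤)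
    (hG : CoverRel 0 0 0 x y) (hu : U5 x y = 1) (hcard : Nat.card G = 5 ^ 6) :
    relationRank 5 G = 4 := by
  obtain ⟨f, rfl, rfl⟩ := exists_lift hG.toCoveringRel
  have hn := normal_of_le_centralPart baseKernel_le
  have h := pow_relationRank_mul_card
    (surjective_of_closure_eq_top hgen f ⟨_, rfl⟩ ⟨_, rfl⟩) hG baseKernel_le
    (sup_le (coverKernel_le_ker hG) ((Subgroup.zpowers_le).2 (by
      rw [MonoidHom.mem_ker, map_U5, hu]))) (by
      rw [hcard]
      exact (CoverRel.card_le_of_u_eq_one (closure_pair_map_eq_top closure_eq_top _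
        (QuotientGroup.mk'_surjective baseKernel))
        (coverRel_of_coverKernel_le (b := 0) (d := 0) (e := 0)
          (by rw [QuotientGroup.ker_mk']; exact le_sup_left))
        (by
          rw [← map_U5]
          exact (QuotientGroup.eq_one_iff _).2
            (Subgroup.mem_sup_right (Subgroup.mem_zpowers _)))).2)
  rw [hcard, show (5 : ℕ) ^ 10 = 5 ^ 4 * 5 ^ 6 by norm_num] at h
  exact Nat.pow_right_injective (show 2 ≤ 5 by norm_num)
    (Nat.eq_of_mul_eq_mul_right (show 0 < 5 ^ 6 by norm_num) h)

end RelationRank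

/-! ### The structure of an arbitrary member of the cover -/

section Structure

/-- Conjugation is an action of a p-group on N, and p divides |N|; so the fixed point 1 is not the
only one. A suitable power of another fixed point has order p. -/
theorem exists_central_of_normal {p : ℕ} [Fact p.Prime] {G : Type*} [Group G] [Finite G]
    (hG : IsPGroup p G) (N : Subgroup G) [hN : N.Normal] (h : N ≠ ⊥) :
    ∃ z ∈ N, z ≠ 1 ∧ (∀ g, Commute z g) ∧ z ^ p = 1 := by
  have hp : p ∣ Nat.card N := by
    obtain ⟨n, hn⟩ := IsPGroup.iff_card.1 (hG.to_subgroup N)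
    rw [hn]
    refine dvd_pow_self p ?_
    rintro rfl
    exact h (Subgroup.card_eq_one.1 (by simpa using hn))
  have hC : IsPGroup p (ConjAct G) := hG.of_equiv ConjAct.toConjAct
  obtain ⟨⟨b, hbN⟩, hb, hb1⟩ := hC.exists_fixed_point_of_prime_dvd_card_of_fixed_point N hp
    (a := 1) (fun g => smul_one g)
  have hbc : ∀ g, Commute b g := by
    intro g
    have h1 := congrArg Subtype.val (hb (ConjAct.toConjAct g))
    have h2 : g * b * g⁻¹ = b := h1
    exact (mul_inv_eq_iff_eq_mul.1 h2).symm
  have hb1' : b ≠ 1 := fun h => hb1 (Subtype.ext h.symm)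
  obtain ⟨n, hn⟩ := hG b
  obtain ⟨k, hk, hk1⟩ := (Nat.dvd_prime_pow Fact.out).1 (orderOf_dvd_of_pow_eq_one hn)
  have hk0 : k ≠ 0 := by
    rintro rfl
    exact hb1' (orderOf_eq_one_iff.1 (by simpa using hk1))
  obtain ⟨m, rfl⟩ := Nat.exists_eq_succ_of_ne_zero hk0
  refine ⟨b ^ p ^ m, pow_mem hbN _, ?_, fun g => (hbc g).pow_left _, ?_⟩
  · intro h1
    have := orderOf_dvd_of_pow_eq_one h1
    rw [hk1, Nat.pow_dvd_pow_iff_le_right (Fact.out : p.Prime).one_lt] at this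
    omega
  · rw [← pow_mul, ← pow_succ, ← Nat.succ_eq_add_one, ← hk1, pow_orderOf_eq_one]

-- Let K be the subgroup generated by the lifts. Then G is the product of K and a central subgroup,
-- so G' is generated by commutators of elements of K. Hence K contains G', and with it the kernel.
open scoped commutatorElement in
theorem closure_eq_top_of_quotient {G Q : Type*} [Group G] [Group Q] (q : G →* Q) {x y : G}
    (hc : ∀ z ∈ q.ker, ∀ g, Commute z g) (hD : q.ker ≤ derivedSeries G 1)
    (hgen : Subgroup.closure {q x, q y} = ⊤) : Subgroup.closure {x, y} = ⊤ := by
  set K := Subgroup.closure {x, y} with hK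
  have hmap : K.map q = ⊤ := by
    rw [hK, MonoidHom.map_closure, Set.image_pair, hgen]
  have hdec : ∀ g, ∃ w ∈ K, ∃ z ∈ q.ker, g = w * z := by
    intro g
    have : q g ∈ K.map q := by rw [hmap]; exact Subgroup.mem_top _
    obtain ⟨w, hw, hwg⟩ := this
    exact ⟨w, hw, w⁻¹ * g, by rw [MonoidHom.mem_ker, map_mul, map_inv, hwg, inv_mul_cancel],
      by group⟩
  have hle : derivedSeries G 1 ≤ K := by
    rw [derivedSeries_one, commutator_def, Subgroup.commutator_le]
    intro g _ h _
    obtain ⟨w, hw, z, hz, rfl⟩ := hdec g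
    obtain ⟨w', hw', z', hz', rfl⟩ := hdec h
    have e : ⁅w * z, w' * z'⁆ = ⁅w, w'⁆ := by
      have c1 := hc z hz
      have c2 := hc z' hz'
      calc ⁅w * z, w' * z'⁆ = w * (z * (w' * z')) * z⁻¹ * w⁻¹ * (w' * z')⁻¹ := by
            rw [commutatorElement_def]; group
        _ = w * (w' * z') * w⁻¹ * (w' * z')⁻¹ := by rw [(c1 (w' * z')).eq]; group
        _ = w * w' * (z' * w⁻¹) * (w' * z')⁻¹ := by group
        _ = ⁅w, w'⁆ := by rw [(c2 w⁻¹).eq, commutatorElement_def]; group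
    rw [e, commutatorElement_def]
    exact mul_mem (mul_mem (mul_mem hw hw') (inv_mem hw)) (inv_mem hw')
  rw [eq_top_iff]
  intro g _
  obtain ⟨w, hw, z, hz, rfl⟩ := hdec g
  exact mul_mem hw (hle (hD hz))

/-- The kernel of f lies in G'' = ⟨u⟩, so each relation among the images, where u = 1, lifts up to a
power of u. -/
theorem CoveringRel.exists_coverRel {G M : Type*} [Group G] [Group M] {x y : G}
    (hgen : Subgroup.closure {x, y} = ⊤) (hG : CoveringRel x y) (f : G →* M)
    (hf : f.ker ≤ derivedSeries G 2) {b d e : ℕ} (hM : CoverRel b d e (f x) (f y))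
    (hu : U5 (f x) (f y) = 1) : ∃ b d e, CoverRel b d e x y := by
  have key : ∀ {g h : G}, f g = f h → ∃ n : ℕ, g = h * U5 x y ^ n := by
    intro g h hgh
    have h1 : h⁻¹ * g ∈ Subgroup.zpowers (U5 x y) := by
      rw [← hG.derivedSeries_eq hgen]
      apply hf
      rw [MonoidHom.mem_ker, map_mul, map_inv, hgh, inv_mul_cancel]
    obtain ⟨n, hn⟩ := (IsOfFinOrder.mem_powers_iff_mem_zpowers
      (isOfFinOrder_iff_pow_eq_one.2 ⟨5, by norm_num, hG.u_pow⟩)).2 h1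
    exact ⟨n, by simp only at hn; rw [hn]; group⟩
  obtain ⟨b, hb⟩ := key (g := x ^ 5) (h := S5 x y) (by
    rw [map_pow, map_S5, hM.px, hu, one_pow, mul_one])
  obtain ⟨d, hd⟩ := key (g := y ^ 5) (h := S5 x y ^ 4) (by
    rw [map_pow, map_pow, map_S5, hM.py, hu, one_pow, mul_one])
  obtain ⟨e, he⟩ := key (g := R2 x y) (h := 1) (by
    rw [map_one, map_R2, hM.r, hu, one_pow])
  exact ⟨b, d, e, hG, hb, hd, by rw [he, one_mul]⟩

/-- Lifts of the generators of the metabelian quotient generate a group in the cover, and they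
satisfy the relations of a cover. -/
theorem exists_coverRel_of_ker_eq {M : Type} [Group M] (n : ℕ) :
    ∀ (G : Type) [Group G] [Finite G] (_ : IsPGroup 5 G) (_ : Nat.card G ≤ n) (x y : G)
      (f : G →* M) (_ : f.ker = derivedSeries G 2) (_ : Subgroup.closure {f x, f y} = ⊤)
      {b d e : ℕ} (_ : CoverRel b d e (f x) (f y)) (_ : U5 (f x) (f y) = 1),
      Subgroup.closure {x, y} = ⊤ ∧ ∃ b d e, CoverRel b d e x y := by
  induction n with
  | zero =>
    intro G _ _ _ hn
    exact absurd hn (not_le.2 Nat.card_pos)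
  | succ n ih =>
    intro G _ _ hp hn x y f hker hgen b d e hM hu
    by_cases hbot : derivedSeries G 2 = ⊥
    -- Here f is injective, and `CoverRel.lift` applies with trivial kernel.
    · rw [hbot] at hker
      have h1 : Subgroup.closure {x, y} = ⊤ := closure_eq_top_of_quotient f
        (fun z hz g => by
          rw [hker, Subgroup.mem_bot] at hz; rw [hz]; exact Commute.one_left g)
        (by rw [hker]; exact bot_le) hgen
      refine ⟨h1, CoveringRel.exists_coverRel h1 (hM.lift f ?_ ?_) f (hker.le.trans bot_le) hM hu⟩
      · intro z hz g
        rw [hker, Subgroup.mem_bot] at hz; rw [hz]; exact Commute.one_left g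
      · intro z hz
        rw [hker, Subgroup.mem_bot] at hz; rw [hz, one_pow]
    -- Dividing by a central subgroup of order five inside G'' = ker f preserves the hypotheses, so
    -- the smaller quotient satisfies the relations of a cover; `CoverRel.lift` carries them back to
    -- the covering relations in G.
    · obtain ⟨z, hz, hz1, hzc, hz5⟩ := exists_central_of_normal hp (derivedSeries G 2) hbot
      have hN := normal_of_central _ (zpowers_central hzc)
      set q := QuotientGroup.mk' (Subgroup.zpowers z) with hq
      have hqs : Function.Surjective q := QuotientGroup.mk'_surjective _
      have hqk : q.ker = Subgroup.zpowers z := QuotientGroup.ker_mk' _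
      have hle : Subgroup.zpowers z ≤ f.ker := by rw [hker, Subgroup.zpowers_le]; exact hz
      let f' : G ⧸ Subgroup.zpowers z →* M := QuotientGroup.lift _ f hle
      have hf' : ∀ g, f' (q g) = f g := fun g => rfl
      have hcard : Nat.card (G ⧸ Subgroup.zpowers z) < Nat.card G := by
        rw [Subgroup.card_eq_card_quotient_mul_card_subgroup (Subgroup.zpowers z)]
        refine lt_mul_of_one_lt_right Nat.card_pos ?_
        rw [Nat.card_zpowers]
        have h1 : orderOf z ≠ 1 := fun h => hz1 (orderOf_eq_one_iff.1 h)
        have h2 : 0 < orderOf z := orderOf_pos z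
        omega
      have hker' : f'.ker = derivedSeries (G ⧸ Subgroup.zpowers z) 2 := by
        rw [← map_derivedSeries_eq hqs, ← hker]
        ext w
        obtain ⟨g, rfl⟩ := hqs w
        rw [MonoidHom.mem_ker, hf', Subgroup.mem_map]
        constructor
        · exact fun h => ⟨g, h, rfl⟩
        · rintro ⟨h, hh, hhg⟩
          rw [← hf', ← hhg, hf']; exact hh
      obtain ⟨h1, b', d', e', h2⟩ := ih (G ⧸ Subgroup.zpowers z) (hp.to_quotient _) (by omega)
        (q x) (q y) f' hker' hgen hM hu
      have hqc : ∀ w ∈ q.ker, ∀ g, Commute w g := by rw [hqk]; exact zpowers_central hzc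
      have hx : Subgroup.closure {x, y} = ⊤ := closure_eq_top_of_quotient q hqc
        (by
          rw [hqk, Subgroup.zpowers_le]
          exact derivedSeries_antitone G (by norm_num) hz) h1
      refine ⟨hx, CoveringRel.exists_coverRel hx (h2.lift q hqc ?_) f hker.le hM hu⟩
      rw [hqk]
      rintro _ ⟨m, rfl⟩
      show (z ^ m) ^ 5 = 1
      rw [← zpow_natCast, ← zpow_mul, mul_comm, zpow_mul, zpow_natCast, hz5, one_zpow]

end Structure

/-! ### Changing the generators -/

section Reparametrization

variable {G : Type*} [Group G]

theorem pcComm_mul_right_eq (a b c : G) :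
    pcComm a (b * c) = pcComm a c * (pcComm a b * pcComm (pcComm a b) c) := by
  simp only [pcComm]; group

theorem pcComm_mul_left_eq (a b c : G) :
    pcComm (a * b) c = pcComm a c * pcComm (pcComm a c) b * pcComm b c := by
  simp only [pcComm]; group

theorem pcComm_mul_central {z : G} (hz : ∀ g, Commute z g) (a c : G) :
    pcComm (a * z) c = pcComm a c := by
  rw [pcComm_mul_left (hz _).symm, (hz c).pcComm_eq, mul_one]

theorem closure_mul_pow_eq_top {x y : G} (hgen : Subgroup.closure {x, y} = ⊤) (k : ℕ) :
    Subgroup.closure {x * y ^ k, y} = ⊤ := by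
  rw [eq_top_iff, ← hgen, Subgroup.closure_le]
  have hy : y ∈ Subgroup.closure {x * y ^ k, y} := Subgroup.subset_closure (by simp)
  rintro w (rfl | rfl)
  · have := mul_mem (Subgroup.subset_closure (by simp) :
      w * y ^ k ∈ Subgroup.closure {w * y ^ k, y}) (inv_mem (pow_mem hy k))
    rwa [mul_inv_cancel_right] at this
  · exact hy

/-- The fifth power of a product in case the commutators of the second factor commute. -/
theorem mul_pow_five_of_commute {w k k1 k2 k3 k4 : G} (h1 : k * w = w * k * k1)
    (h2 : k1 * w = w * k1 * k2) (h3 : k2 * w = w * k2 * k3) (h4 : k3 * w = w * k3 * k4)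
    (c01 : Commute k1 k) (c02 : Commute k2 k) (c03 : Commute k3 k) (c04 : Commute k4 k)
    (c12 : Commute k2 k1) (c23 : Commute k3 k2) (c34 : Commute k4 k3)
    (p1 : k1 ^ 5 = 1) (p2 : k2 ^ 5 = 1) (p3 : k3 ^ 5 = 1) :
    (w * k) ^ 5 = w ^ 5 * k ^ 5 * k4 := by
  -- Moving k, k₁, k₂, k₃ past w updates the exponents by Pascal's rule. After five factors they are
  -- 5, 10, 10, 5, 1, and only the powers of k and k₄ survive.
  have step : ∀ n a b c d : ℕ, w ^ n * (k ^ a * k1 ^ b * k2 ^ c * k3 ^ d) * (w * k) =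
      w ^ (n + 1) * (k ^ (a + 1) * k1 ^ (a + b) * k2 ^ (b + c) * k3 ^ (c + d)) * k4 ^ d := by
    intro n a b c d
    have s0 : SemiconjBy w (k * k1) k := by rw [SemiconjBy, h1, mul_assoc]
    have s1 : SemiconjBy w (k1 * k2) k1 := by rw [SemiconjBy, h2, mul_assoc]
    have s2 : SemiconjBy w (k2 * k3) k2 := by rw [SemiconjBy, h3, mul_assoc]
    have s3 : SemiconjBy w (k3 * k4) k3 := by rw [SemiconjBy, h4, mul_assoc]
    have h := (((s0.pow_right a).mul_right (s1.pow_right b)).mul_right (s2.pow_right c)).mul_right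
      (s3.pow_right d)
    have ck : Commute (k1 ^ (a + b) * k2 ^ (b + c) * k3 ^ (c + d) * k4 ^ d) k :=
      (((c01.pow_left _).mul_left (c02.pow_left _)).mul_left (c03.pow_left _)).mul_left
        (c04.pow_left _)
    rw [c01.symm.mul_pow, c12.symm.mul_pow, c23.symm.mul_pow, c34.symm.mul_pow] at h
    calc w ^ n * (k ^ a * k1 ^ b * k2 ^ c * k3 ^ d) * (w * k)
        = w ^ n * ((k ^ a * k1 ^ b * k2 ^ c * k3 ^ d) * w) * k := by simp only [mul_assoc]
      _ = w ^ n * w * k ^ a * ((k1 ^ (a + b) * k2 ^ (b + c) * k3 ^ (c + d) * k4 ^ d) * k) := by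
          rw [← h.eq, pow_add k1, pow_add k2, pow_add k3]; simp only [mul_assoc]
      _ = _ := by rw [ck.eq, ← pow_succ, pow_succ k]; simp only [mul_assoc]
  have h0 : (w * k) ^ 5 = w ^ 0 * (k ^ 0 * k1 ^ 0 * k2 ^ 0 * k3 ^ 0) * (w * k) * (w * k) *
      (w * k) * (w * k) * (w * k) := by
    simp [pow_succ, mul_assoc]
  rw [h0, step, pow_zero k4, mul_one, step, pow_zero k4, mul_one, step, add_zero, add_zero,
    pow_zero k4, mul_one, step, add_zero, pow_zero k4, mul_one, step]
  norm_num only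
  rw [show k1 ^ 10 = (k1 ^ 5) ^ 2 by rw [← pow_mul], show k2 ^ 10 = (k2 ^ 5) ^ 2 by rw [← pow_mul],
    p1, p2, p3]
  simp

theorem CoveringRel.s5_central {x y : G} (hgen : Subgroup.closure {x, y} = ⊤)
    (hG : CoveringRel x y) :
    ∀ g, Commute (S5 x y) g :=
  commute_of_closure_eq_top hgen hG.s5_x hG.s5_y

theorem CoveringRel.u_central {x y : G} (hgen : Subgroup.closure {x, y} = ⊤)
    (hG : CoveringRel x y) :
    ∀ g, Commute (U5 x y) g :=
  commute_of_closure_eq_top hgen hG.u_x hG.u_y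

theorem CoveringRel.r_central {x y : G} (hgen : Subgroup.closure {x, y} = ⊤)
    (hG : CoveringRel x y) :
    ∀ g, Commute (R2 x y) g :=
  commute_of_closure_eq_top hgen hG.r_x hG.r_y

/-- The point is that s₅ gains uᵏ while u and y stay fixed, so a suitable k removes the power of u
from the relation for y⁵. -/
theorem CoveringRel.words_mul_pow {x y : G} (hgen : Subgroup.closure {x, y} = ⊤)
    (hG : CoveringRel x y)
    (k : ℕ) :
    S2 (x * y ^ k) y = S2 x y * R2 x y ^ k ∧
    S3 (x * y ^ k) y = S3 x y * (R2 x y ^ k * U5 x y ^ k) ∧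
    S4 (x * y ^ k) y = S4 x y * (U5 x y ^ k * U5 x y ^ k) ∧
    S5 (x * y ^ k) y = S5 x y * U5 x y ^ k ∧
    U5 (x * y ^ k) y = U5 x y ∧ R2 (x * y ^ k) y = R2 x y := by
  have c5 := hG.s5_central hgen
  have cu := hG.u_central hgen
  have cr := hG.r_central hgen
  have cuk : ∀ g, Commute (U5 x y ^ k) g := fun g => (cu g).pow_left k
  have crk : ∀ g, Commute (R2 x y ^ k) g := fun g => (cr g).pow_left k
  have e2 : S2 (x * y ^ k) y = S2 x y * R2 x y ^ k := by
    rw [S2, pcComm_mul_right_eq, ((Commute.refl y).pow_right k).pcComm_eq, one_mul,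
      show pcComm y x = S2 x y from rfl, pcComm_pow_right (show Commute (R2 x y) y from cr y)]
    rfl
  have e3 : S3 (x * y ^ k) y = S3 x y * (R2 x y ^ k * U5 x y ^ k) := by
    rw [S3, e2, pcComm_mul_central crk, pcComm_mul_right_eq,
      pcComm_pow_right (show Commute (R2 x y) y from cr y),
      show pcComm (S2 x y) x = S3 x y from rfl,
      pcComm_pow_right (show Commute (U5 x y) y from cu y)]
    show R2 x y ^ k * (S3 x y * U5 x y ^ k) = _
    rw [← mul_assoc, (crk _).eq, mul_assoc]
  have cru : ∀ g, Commute (R2 x y ^ k * U5 x y ^ k) g := fun g => (crk g).mul_left (cuk g)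
  have cuu : ∀ g, Commute (U5 x y ^ k * U5 x y ^ k) g := fun g => (cuk g).mul_left (cuk g)
  have s4y : pcComm (S4 x y) (y ^ k) = U5 x y ^ k := by
    rw [pcComm_pow_right (by rw [hG.s4_y]; exact cu y), hG.s4_y]
  have e4 : S4 (x * y ^ k) y = S4 x y * (U5 x y ^ k * U5 x y ^ k) := by
    rw [S4, e3, pcComm_mul_central cru, pcComm_mul_right_eq,
      pcComm_pow_right (show Commute (U5 x y) y from cu y),
      show pcComm (S3 x y) x = S4 x y from rfl, s4y]
    show U5 x y ^ k * (S4 x y * U5 x y ^ k) = _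
    rw [← mul_assoc, (cuk _).eq, mul_assoc]
  refine ⟨e2, e3, e4, ?_, ?_, ?_⟩
  · rw [S5, e4, pcComm_mul_central cuu, pcComm_mul_right_eq, s4y,
      show pcComm (S4 x y) x = S5 x y from rfl, (c5 _).pcComm_eq, mul_one, (cuk _).eq]
  · rw [U5, e3, pcComm_mul_central cru]; rfl
  · rw [R2, e2, pcComm_mul_central crk]; rfl

/-- The commutator r gains u²ᵐ, one uᵐ from [s₄ᵐ, y] and one from [s₂, s₃ᵐ], while s₅, u and y⁵ do
not change. So r can be made trivial without disturbing the relation for y⁵. -/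
theorem CoveringRel.words_mul_s3_pow {x y : G} (hgen : Subgroup.closure {x, y} = ⊤)
    (hG : CoveringRel x y)
    (m : ℕ) :
    S3 x (y * S3 x y ^ m) = S3 x y * S5 x y ^ m ∧
    S2 x (y * S3 x y ^ m) = S2 x y * S4 x y ^ m * U5 x y ^ m ∧
    S4 x (y * S3 x y ^ m) = S4 x y ∧ S5 x (y * S3 x y ^ m) = S5 x y ∧
    U5 x (y * S3 x y ^ m) = U5 x y ∧
    R2 x (y * S3 x y ^ m) = U5 x y ^ (2 * m) * R2 x y ∧
    (y * S3 x y ^ m) ^ 5 = y ^ 5 := by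
  have c5 := hG.s5_central hgen
  have cu := hG.u_central hgen
  have cr := hG.r_central hgen
  have cum : ∀ g, Commute (U5 x y ^ m) g := fun g => (cu g).pow_left m
  have c5m : ∀ g, Commute (S5 x y ^ m) g := fun g => (c5 g).pow_left m
  have s23 : pcComm (S2 x y) (S3 x y) = U5 x y := by
    rw [← pcComm_inv, eq_inv_of_mul_eq_one_left hG.s3_s2, inv_inv]
  have s23m : pcComm (S2 x y) (S3 x y ^ m) = U5 x y ^ m := by
    rw [pcComm_pow_right (by rw [s23]; exact cu _), s23]
  have s3mx : pcComm (S3 x y ^ m) x = S4 x y ^ m := pcComm_pow_left hG.s4_s3 m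
  have s3my : pcComm (S3 x y ^ m) y = U5 x y ^ m := pcComm_pow_left (cu _) m
  have s4mx : pcComm (S4 x y ^ m) x = S5 x y ^ m := pcComm_pow_left (c5 _) m
  have s4my : pcComm (S4 x y ^ m) y = U5 x y ^ m := by
    rw [pcComm_pow_left (by rw [hG.s4_y]; exact cu _), hG.s4_y]
  have e2 : S2 x (y * S3 x y ^ m) = S2 x y * S4 x y ^ m * U5 x y ^ m := by
    rw [S2, pcComm_mul_left_eq, show pcComm y x = S2 x y from rfl, s23m, s3mx, mul_assoc,
      (cum _).eq, mul_assoc]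
  have e3 : S3 x (y * S3 x y ^ m) = S3 x y * S5 x y ^ m := by
    rw [S3, e2, pcComm_mul_central cum, pcComm_mul_left_eq,
      show pcComm (S2 x y) x = S3 x y from rfl, (hG.s4_s3.symm.pow_right m).pcComm_eq, mul_one,
      s4mx]
  have e4 : S4 x (y * S3 x y ^ m) = S4 x y := by
    rw [S4, e3, pcComm_mul_central c5m]; rfl
  refine ⟨e3, e2, e4, ?_, ?_, ?_, ?_⟩
  · rw [S5, e4]; rfl
  · rw [U5, e3, pcComm_mul_central c5m, pcComm_mul_right_eq,
      ((Commute.refl (S3 x y)).pow_right m).pcComm_eq, one_mul,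
      show pcComm (S3 x y) y = U5 x y from rfl, (cu _).pcComm_eq, mul_one]
  · have h1 : pcComm (S2 x y * S4 x y ^ m) y = R2 x y * U5 x y ^ m := by
      rw [pcComm_mul_left (cr _), s4my]; rfl
    have h2 : pcComm (S2 x y * S4 x y ^ m) (S3 x y ^ m) = U5 x y ^ m := by
      rw [pcComm_mul_left (by rw [s23m]; exact cum _), s23m,
        ((hG.s4_s3.pow_left m).pow_right m).pcComm_eq, mul_one]
    rw [R2, e2, pcComm_mul_central cum, pcComm_mul_right_eq, h1, h2,
      ((cr _).mul_left (cum _)).pcComm_eq, mul_one, (cr _).eq, ← mul_assoc, ← pow_add, two_mul]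
  · rw [mul_pow_five (by rw [s3my]; exact cum _) (by rw [s3my]; exact cum _), s3my, ← pow_mul,
      ← pow_mul, mul_comm m 5, show m * 10 = 5 * (2 * m) by ring, pow_mul, pow_mul, hG.s3_pow,
      hG.u_pow, one_pow, one_pow, mul_one, mul_one]

/-- The word s₅ contains y once and u contains it twice, hence the exponents j and j². The power of
u that appears in s₃ comes from [s₃, s₂] and is central. -/
theorem CoveringRel.words_pow {x y : G} (hgen : Subgroup.closure {x, y} = ⊤) (hG : CoveringRel x y)
    (hr : R2 x y = 1) (j : ℕ) :
    S2 x (y ^ j) = S2 x y ^ j ∧ (∃ t : ℕ, S3 x (y ^ j) = S3 x y ^ j * U5 x y ^ t) ∧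
    S4 x (y ^ j) = S4 x y ^ j ∧ S5 x (y ^ j) = S5 x y ^ j ∧
    U5 x (y ^ j) = U5 x y ^ (j * j) ∧ R2 x (y ^ j) = 1 := by
  have c5 := hG.s5_central hgen
  have cu := hG.u_central hgen
  have s32 : pcComm (S3 x y) (S2 x y) = U5 x y ^ 4 := by
    rw [eq_inv_of_mul_eq_one_left hG.s3_s2, inv_eq_iff_mul_eq_one, ← pow_succ', hG.u_pow]
  have cy2 : Commute (S2 x y) y := pcComm_eq_one_iff.1 hr
  have e2 : S2 x (y ^ j) = S2 x y ^ j := pcComm_pow_left cy2 j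
  have e3 : ∀ n : ℕ, ∃ t : ℕ, pcComm (S2 x y ^ n) x = S3 x y ^ n * U5 x y ^ t := by
    intro n
    induction n with
    | zero => exact ⟨0, by simp [pcComm]⟩
    | succ n ih =>
      obtain ⟨t, ht⟩ := ih
      have h1 : pcComm (S3 x y ^ n) (S2 x y) = U5 x y ^ (4 * n) := by
        rw [pcComm_pow_left (by rw [s32]; exact (cu _).pow_left 4), s32, pow_mul]
      refine ⟨t + 4 * n, ?_⟩
      rw [pow_succ (S2 x y), pcComm_mul_left_eq, ht,
        pcComm_mul_central (fun g => (cu g).pow_left t), h1,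
        show pcComm (S2 x y) x = S3 x y from rfl, mul_assoc _ (U5 x y ^ t), ← pow_add, mul_assoc,
        ((cu _).pow_left (t + 4 * n)).eq, ← mul_assoc, ← pow_succ]
  obtain ⟨t, ht⟩ := e3 j
  have e3' : S3 x (y ^ j) = S3 x y ^ j * U5 x y ^ t := by rw [S3, e2, ht]
  have cut : ∀ g, Commute (U5 x y ^ t) g := fun g => (cu g).pow_left t
  have e4 : S4 x (y ^ j) = S4 x y ^ j := by
    rw [S4, e3', pcComm_mul_central cut]; exact pcComm_pow_left hG.s4_s3 j
  refine ⟨e2, ⟨t, e3'⟩, e4, ?_, ?_, ?_⟩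
  · rw [S5, e4]; exact pcComm_pow_left (c5 _) j
  · have h1 : pcComm (S3 x y ^ j) y = U5 x y ^ j := pcComm_pow_left (cu _) j
    rw [U5, e3', pcComm_mul_central cut, pcComm_pow_right (by rw [h1]; exact (cu _).pow_left j),
      h1, pow_mul]
  · rw [R2, e2, ((cy2.pow_left j).pow_right j).pcComm_eq]

/-- Replacing `y` by a power. -/
theorem CoveringRel.pow_right {x y : G} (hgen : Subgroup.closure {x, y} = ⊤) (hG : CoveringRel x y)
    (hr : R2 x y = 1) (j : ℕ) : CoveringRel x (y ^ j) := by
  have c5 := hG.s5_central hgen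
  have cu := hG.u_central hgen
  obtain ⟨e2, ⟨t, e3⟩, e4, e5, eu, er⟩ := hG.words_pow hgen hr j
  have cut : ∀ g, Commute (U5 x y ^ t) g := fun g => (cu g).pow_left t
  have pw : ∀ {g : G} (n : ℕ), g ^ 5 = 1 → (g ^ n) ^ 5 = 1 := fun n h => by
    rw [← pow_mul, mul_comm, pow_mul, h, one_pow]
  have s32 : pcComm (S3 x y) (S2 x y) = U5 x y ^ 4 := by
    rw [eq_inv_of_mul_eq_one_left hG.s3_s2, inv_eq_iff_mul_eq_one, ← pow_succ', hG.u_pow]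
  exact
    { s5_x := by rw [e5]; exact (c5 _).pow_left j
      s5_y := by rw [e5]; exact (c5 _).pow_left j
      u_x := by rw [eu]; exact (cu _).pow_left _
      u_y := by rw [eu]; exact (cu _).pow_left _
      r_x := by rw [er]; exact Commute.one_left _
      r_y := by rw [er]; exact Commute.one_left _
      px_y := hG.px_y.pow_right j
      py_x := by rw [← pow_mul, mul_comm, pow_mul]; exact hG.py_x.pow_left j
      s2_pow := by rw [e2]; exact pw j hG.s2_pow
      s3_pow := by rw [e3, (cut _).symm.mul_pow, pw j hG.s3_pow, pw t hG.u_pow, mul_one]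
      s4_pow := by rw [e4]; exact pw j hG.s4_pow
      s5_pow := by rw [e5]; exact pw j hG.s5_pow
      u_pow := by rw [eu]; exact pw _ hG.u_pow
      r_pow := by rw [er, one_pow]
      px_pow := hG.px_pow
      py_pow := by
        rw [← pow_mul, ← pow_mul, mul_comm j, mul_right_comm, mul_comm 5 j, mul_assoc, mul_comm j,
          pow_mul, pow_mul, hG.py_pow, one_pow]
      s4_y := by
        have h1 : pcComm (S4 x y ^ j) y = U5 x y ^ j := by
          rw [pcComm_pow_left (by rw [hG.s4_y]; exact cu _), hG.s4_y]
        rw [e4, eu, pcComm_pow_right (by rw [h1]; exact (cu _).pow_left j), h1, pow_mul]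
      s3_s2 := by
        have h1 : pcComm (S3 x y ^ j) (S2 x y) = U5 x y ^ (4 * j) := by
          rw [pcComm_pow_left (by rw [s32]; exact (cu _).pow_left 4), s32, pow_mul]
        rw [e3, e2, eu, pcComm_mul_central cut,
          pcComm_pow_right (by rw [h1]; exact (cu _).pow_left _), h1, ← pow_mul, ← pow_add,
          show 4 * j * j + j * j = 5 * (j * j) by ring, pow_mul, hG.u_pow, one_pow]
      s4_s2 := by rw [e4, e2]; exact (hG.s4_s2.pow_left j).pow_right j
      s4_s3 := by
        rw [e4, e3]
        exact ((hG.s4_s3.pow_left j).pow_right j).mul_right (cut _).symm }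

/-- The relations of the metabelian group for the generators `x yᵏ` and `y`. -/
theorem CoverRel.mul_pow_base {x y : G} (hgen : Subgroup.closure {x, y} = ⊤)
    (hG : CoverRel 0 0 0 x y) (hu : U5 x y = 1) (k : ℕ) :
    CoverRel 0 0 0 (x * y ^ k) y ∧ U5 (x * y ^ k) y = 1 := by
  have hr : R2 x y = 1 := by rw [hG.r, pow_zero]
  obtain ⟨e2, e3, e4, e5, eu, er⟩ := hG.words_mul_pow hgen k
  have c5 := hG.s5_central hgen
  simp only [hr, hu, one_pow, mul_one] at e2 e3 e4 e5 eu er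
  have cy2 : Commute (S2 x y) y := pcComm_eq_one_iff.1 hr
  have cy3 : Commute (S3 x y) y := pcComm_eq_one_iff.1 hu
  have cy4 : Commute (S4 x y) y := pcComm_eq_one_iff.1 (hG.s4_y.trans hu)
  have c23 : Commute (S3 x y) (S2 x y) := pcComm_eq_one_iff.1 (by simpa [hu] using hG.s3_s2)
  have px : x ^ 5 = S5 x y := by rw [hG.px, pow_zero, mul_one]
  have py : y ^ 5 = S5 x y ^ 4 := by rw [hG.py, pow_zero, mul_one]
  -- The power is x⁵ · y⁵ᵏ · s₅ᵏ = s₅ · s₅⁴ᵏ · s₅ᵏ = s₅; the exponent 4 in y⁵ = s₅⁴ is exactly what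
  -- makes the relations independent of k.
  have hx5 : (x * y ^ k) ^ 5 = S5 x y := by
    have cp : ∀ {g g' : G}, pcComm g x = g' → Commute g' g → g ^ k * x = x * g ^ k * g' ^ k := by
      intro g g' h1 h2
      rw [mul_eq_mul_pcComm, pcComm_pow_left (by rw [h1]; exact h2), h1]
    have cc : ∀ {g h : G}, Commute g h → Commute (g ^ k) (h ^ k) := fun h =>
      (h.pow_left k).pow_right k
    have pw : ∀ {g : G}, g ^ 5 = 1 → (g ^ k) ^ 5 = 1 := fun h => by
      rw [← pow_mul, mul_comm, pow_mul, h, one_pow]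
    rw [mul_pow_five_of_commute (cp (g' := S2 x y) rfl cy2) (cp (g' := S3 x y) rfl c23)
      (cp (g' := S4 x y) rfl hG.s4_s3) (cp (g' := S5 x y) rfl (c5 _)) (cc cy2) (cc cy3) (cc cy4)
      (cc (c5 _)) (cc c23) (cc hG.s4_s3) (cc (c5 _)) (pw hG.s2_pow) (pw hG.s3_pow)
      (pw hG.s4_pow), px, ← pow_mul, mul_comm k, pow_mul, py, mul_assoc, ← pow_mul, ← pow_add,
      show 4 * k + k = 5 * k by ring, pow_mul, hG.s5_pow, one_pow, mul_one]
  refine ⟨{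
      s5_x := by rw [e5]; exact c5 _
      s5_y := by rw [e5]; exact c5 _
      u_x := by rw [eu]; exact Commute.one_left _
      u_y := by rw [eu]; exact Commute.one_left _
      r_x := by rw [er]; exact Commute.one_left _
      r_y := by rw [er]; exact Commute.one_left _
      px_y := by rw [hx5]; exact c5 _
      py_x := by rw [py]; exact (c5 _).pow_left 4
      s2_pow := by rw [e2]; exact hG.s2_pow
      s3_pow := by rw [e3]; exact hG.s3_pow
      s4_pow := by rw [e4]; exact hG.s4_pow
      s5_pow := by rw [e5]; exact hG.s5_pow
      u_pow := by rw [eu, one_pow]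
      r_pow := by rw [er, one_pow]
      px_pow := by rw [hx5]; exact hG.s5_pow
      py_pow := hG.py_pow
      s4_y := by rw [e4, eu]; exact cy4.pcComm_eq
      s3_s2 := by rw [e3, e2, eu, mul_one]; exact c23.pcComm_eq
      s4_s2 := by rw [e4, e2]; exact hG.s4_s2
      s4_s3 := by rw [e4, e3]; exact hG.s4_s3
      px := by rw [hx5, e5, pow_zero, mul_one]
      py := by rw [py, e5, pow_zero, mul_one]
      r := by rw [er, pow_zero] }, eu⟩

/-- The relations of the metabelian group for the generators `x` and `y s₃ᵐ`. -/
theorem CoverRel.mul_s3_pow_base {x y : G} (hgen : Subgroup.closure {x, y} = ⊤)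
    (hG : CoverRel 0 0 0 x y) (hu : U5 x y = 1) (m : ℕ) :
    CoverRel 0 0 0 x (y * S3 x y ^ m) ∧ U5 x (y * S3 x y ^ m) = 1 ∧
      Subgroup.closure {x, y * S3 x y ^ m} = ⊤ := by
  have hr : R2 x y = 1 := by rw [hG.r, pow_zero]
  obtain ⟨e3, e2, e4, e5, eu, er, ep⟩ := hG.words_mul_s3_pow hgen m
  have c5 := hG.s5_central hgen
  simp only [hr, hu, one_pow, mul_one] at e2 eu er
  have cy3 : Commute (S3 x y) y := pcComm_eq_one_iff.1 hu
  have cy4 : Commute (S4 x y) y := pcComm_eq_one_iff.1 (hG.s4_y.trans hu)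
  have c23 : Commute (S3 x y) (S2 x y) := pcComm_eq_one_iff.1 (by simpa [hu] using hG.s3_s2)
  have px : x ^ 5 = S5 x y := by rw [hG.px, pow_zero, mul_one]
  have py : y ^ 5 = S5 x y ^ 4 := by rw [hG.py, pow_zero, mul_one]
  have pw : ∀ {g : G}, g ^ 5 = 1 → (g ^ m) ^ 5 = 1 := fun h => by
    rw [← pow_mul, mul_comm, pow_mul, h, one_pow]
  have c5m : ∀ g, Commute (S5 x y ^ m) g := fun g => (c5 g).pow_left m
  refine ⟨{
      s5_x := by rw [e5]; exact c5 _
      s5_y := by rw [e5]; exact c5 _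
      u_x := by rw [eu]; exact Commute.one_left _
      u_y := by rw [eu]; exact Commute.one_left _
      r_x := by rw [er]; exact Commute.one_left _
      r_y := by rw [er]; exact Commute.one_left _
      px_y := by rw [px]; exact c5 _
      py_x := by rw [ep]; exact hG.py_x
      s2_pow := by
        rw [e2, (hG.s4_s2.symm.pow_right m).mul_pow, hG.s2_pow, pw hG.s4_pow, mul_one]
      s3_pow := by rw [e3, ((c5m _).symm).mul_pow, hG.s3_pow, pw hG.s5_pow, mul_one]
      s4_pow := by rw [e4]; exact hG.s4_pow
      s5_pow := by rw [e5]; exact hG.s5_pow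
      u_pow := by rw [eu, one_pow]
      r_pow := by rw [er, one_pow]
      px_pow := hG.px_pow
      py_pow := by rw [ep]; exact hG.py_pow
      s4_y := by
        rw [e4, eu]; exact (cy4.mul_right (hG.s4_s3.pow_right m)).pcComm_eq
      s3_s2 := by
        rw [e3, e2, eu, mul_one]
        exact ((c23.mul_right (hG.s4_s3.symm.pow_right m)).mul_left (c5m _)).pcComm_eq
      s4_s2 := by
        rw [e4, e2]; exact hG.s4_s2.mul_right ((Commute.refl (S4 x y)).pow_right m)
      s4_s3 := by rw [e4, e3]; exact hG.s4_s3.mul_right (c5m _).symm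
      px := by rw [px, e5, pow_zero, mul_one]
      py := by rw [ep, py, e5, pow_zero, mul_one]
      r := by rw [er, pow_zero] }, eu, ?_⟩
  set K := Subgroup.closure {x, y * S3 x y ^ m} with hK
  have mx : x ∈ K := Subgroup.subset_closure (by simp)
  have my : y * S3 x y ^ m ∈ K := Subgroup.subset_closure (by simp)
  have mc : ∀ {g h}, g ∈ K → h ∈ K → pcComm g h ∈ K := fun hg hh =>
    mul_mem (mul_mem (mul_mem (inv_mem hg) (inv_mem hh)) hg) hh
  have m3 : S3 x y * S5 x y ^ m ∈ K := e3 ▸ mc (mc my mx) mx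
  have m5 : S5 x y ∈ K := e5 ▸ mc (mc (mc (mc my mx) mx) mx) mx
  have m3' : S3 x y ∈ K := by
    have := mul_mem m3 (inv_mem (pow_mem m5 m))
    rwa [mul_inv_cancel_right] at this
  have my' : y ∈ K := by
    have := mul_mem my (inv_mem (pow_mem m3' m))
    rwa [mul_inv_cancel_right] at this
  rw [eq_top_iff, ← hgen, Subgroup.closure_le]
  rintro w (rfl | rfl)
  · exact mx
  · exact my'

end Reparametrization

/-- Every group in the cover is generated by two elements with the relations of a cover, where two
of the three parameters vanish. -/
theorem exists_coverRel_zero_zero {G M : Type} [Group G] [Group M] [Finite G] (hp : IsPGroup 5 G)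
    (f : G →* M) (hf : Function.Surjective f) (hker : f.ker = derivedSeries G 2) {g h : M}
    (hgen : Subgroup.closure {g, h} = ⊤) (hM : CoverRel 0 0 0 g h) (hu : U5 g h = 1) :
    ∃ x y : G, ∃ b, Subgroup.closure {x, y} = ⊤ ∧ CoverRel b 0 0 x y := by
  obtain ⟨x, rfl⟩ := hf g
  obtain ⟨y, rfl⟩ := hf h
  obtain ⟨hG, b, d, e, h1⟩ := exists_coverRel_of_ker_eq (Nat.card G) G hp le_rfl x y f hker hgen
    hM hu
  -- the fifth power of `y`
  obtain ⟨hM', hu'⟩ := hM.mul_pow_base hgen hu (4 * d)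
  have hgen' := closure_mul_pow_eq_top hgen (4 * d)
  -- The new images satisfy the relations of the metabelian group, so the new pair in G satisfies
  -- the relations of a cover with some parameters. Only those that must vanish are computed.
  obtain ⟨hG', b', d', e', h2⟩ := exists_coverRel_of_ker_eq (Nat.card G) G hp le_rfl
    (x * y ^ (4 * d)) y f hker (by rwa [map_mul, map_pow]) (by rwa [map_mul, map_pow])
    (by rwa [map_mul, map_pow])
  rw [← map_pow, ← map_mul] at hM' hu' hgen'
  obtain ⟨-, -, -, e5, eu, -⟩ := h1.words_mul_pow hG (4 * d)
  -- The new s₅⁴ has gained u^(16d) = uᵈ.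
  have hy : y ^ 5 = S5 (x * y ^ (4 * d)) y ^ 4 := by
    rw [h1.py, e5, ((h1.s5_central hG _)).mul_pow, ← pow_mul,
      show 4 * d * 4 = d + 5 * (3 * d) by ring, pow_add, pow_mul _ 5, h1.u_pow, one_pow, mul_one]
  generalize x * y ^ (4 * d) = x at *
  -- the commutator `[s₂, y]`
  obtain ⟨hM'', hu'', hgen''⟩ := hM'.mul_s3_pow_base hgen' hu' (2 * e')
  rw [← map_S3, ← map_pow, ← map_mul] at hM'' hu'' hgen''
  obtain ⟨hG'', b'', d'', e'', h3⟩ := exists_coverRel_of_ker_eq (Nat.card G) G hp le_rfl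
    x (y * S3 x y ^ (2 * e')) f hker hgen'' hM'' hu''
  obtain ⟨-, -, -, e5', -, er, ep⟩ := h2.words_mul_s3_pow hG' (2 * e')
  refine ⟨x, y * S3 x y ^ (2 * e'), b'', hG'', h3.toCoveringRel, h3.px, ?_, ?_⟩
  · rw [ep, hy, e5', pow_zero, mul_one]
  -- The old r is u^e', and the shift by s₃^(2e') multiplies it by u^(4e').
  · rw [er, h2.r, ← pow_add, show 2 * (2 * e') + e' = 5 * e' by ring, pow_mul, h2.u_pow, one_pow,
      pow_zero]

/-! ### The parameter is an invariant -/

namespace CoverModel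

variable {s g h : CoverModel}

/-- Comparing coordinates in hg = ght determines t without expanding inverses; the next lemmas go
down the lower central series in the same way. -/
theorem pcComm_coord (h g : CoverModel) : (pcComm h g).i = 0 ∧ (pcComm h g).j = 0 ∧
    (pcComm h g).k2 = red g.i * red h.j - red h.i * red g.j := by
  have e := mul_eq_mul_pcComm h g
  generalize pcComm h g = t at e ⊢
  have e1 := congrArg CoverModel.i e
  have e2 := congrArg CoverModel.j e
  have e3 := congrArg CoverModel.k2 e
  simp only [mul_i, mul_j, mul_k2] at e1 e2 e3
  have ti : t.i = 0 := by linear_combination -e1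
  have tj : t.j = 0 := by linear_combination -e2
  rw [ti, map_zero] at e3
  exact ⟨ti, tj, by linear_combination -e3⟩

theorem pcComm_coord_of_derived (hi : s.i = 0) (hj : s.j = 0) (g : CoverModel) :
    (pcComm s g).i = 0 ∧ (pcComm s g).j = 0 ∧ (pcComm s g).k2 = 0 ∧
      (pcComm s g).k3 = red g.i * s.k2 := by
  obtain ⟨ti, tj, t2⟩ := pcComm_coord s g
  rw [hi, hj, map_zero, mul_zero, zero_mul, sub_zero] at t2
  have e := congrArg CoverModel.k3 (mul_eq_mul_pcComm s g)
  simp only [mul_k3, ti, hi, hj, map_zero, ch_two_zero] at e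
  exact ⟨ti, tj, t2, by linear_combination -e⟩

theorem pcComm_coord_of_third (hi : s.i = 0) (hj : s.j = 0) (h2 : s.k2 = 0) (g : CoverModel) :
    (pcComm s g).i = 0 ∧ (pcComm s g).j = 0 ∧ (pcComm s g).k2 = 0 ∧ (pcComm s g).k3 = 0 ∧
      (pcComm s g).k4 = red g.i * s.k3 := by
  obtain ⟨ti, tj, t2, t3⟩ := pcComm_coord_of_derived hi hj g
  rw [h2, mul_zero] at t3
  have e := congrArg CoverModel.k4 (mul_eq_mul_pcComm s g)
  simp only [mul_k4, ti, hi, hj, h2, map_zero, ch_two_zero, ch_three_zero] at e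
  exact ⟨ti, tj, t2, t3, by linear_combination -e⟩

/-- At this depth the commutator is central and bilinear, and sees only the exponents of x and y in
g modulo 5. -/
theorem pcComm_eq_of_fourth (hi : s.i = 0) (hj : s.j = 0) (h2 : s.k2 = 0) (h3 : s.k3 = 0)
    (g : CoverModel) : pcComm s g = ⟨0, 0, 0, 0, 0, red g.i * s.k4, 0, red g.j * s.k4⟩ := by
  obtain ⟨ti, tj, t2, t3, t4⟩ := pcComm_coord_of_third hi hj h2 g
  rw [h3, mul_zero] at t4
  have e5 := congrArg CoverModel.k5 (mul_eq_mul_pcComm s g)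
  have ea := congrArg CoverModel.a (mul_eq_mul_pcComm s g)
  have eb := congrArg CoverModel.b (mul_eq_mul_pcComm s g)
  simp only [mul_k5, mul_a, mul_b, mul_k4, mul_k3, mul_k2, mul_j, ti, tj, t2, t3, t4, hi,
    hj, h2, h3, map_zero, ch_two_zero, ch_three_zero, ch_four_zero] at e5 ea eb
  have five : (5 : ZMod 5) = 0 := rfl
  ext
  · exact ti
  · exact tj
  · exact t2
  · exact t3
  · exact t4
  · linear_combination -e5
  · linear_combination -ea
  · linear_combination -eb + (red g.j * s.k4) * five

theorem pow_five_of_red_i (hi : red g.i = 0) : g ^ 5 = ⟨0, 5 * g.j, 0, 0, 0, 0, 0, 0⟩ := by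
  have h5 : ∀ i : ZMod 25, red i = 0 → i + i + i + i + i = 0 := by decide
  have five : (5 : ZMod 5) = 0 := rfl
  simp only [pow_succ, pow_zero, one_mul]
  ext <;> simp only [mul_k5, mul_a, mul_b, mul_k4, mul_k3, mul_k2, mul_i, mul_j, hi, map_add,
    ch_two_zero, ch_three_zero, ch_four_zero]
  · exact h5 _ hi
  · ring
  · linear_combination g.k2 * five
  · linear_combination g.k3 * five
  · linear_combination g.k4 * five
  · linear_combination g.k5 * five
  · linear_combination g.a * five
  · linear_combination g.b * five

/-- Modulo 5 the norm 1 + X + ⋯ + X⁴ of the action X of x is (X - 1)⁴, which kills s₂, …, s₅ but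
sends y to s₅; hence the condition on the exponent of y. -/
theorem pow_five_of_red_j (hj : red g.j = 0) : g ^ 5 = ⟨5 * g.i, 0, 0, 0, 0, 0, 0, 0⟩ := by
  have h5 : ∀ i : ZMod 25, red i = 0 → i + i + i + i + i = 0 := by decide
  simp only [pow_succ, pow_zero, one_mul]
  ext <;> simp only [mul_k5, mul_a, mul_b, mul_k4, mul_k3, mul_k2, mul_i, mul_j, hj, map_add]
  · ring
  · exact h5 _ hj
  all_goals ring_nf; reduce_mod_char

/-- The central elements `s₅ᵏ uᵇ`. -/
def central (k b : ZMod 5) : CoverModel := ⟨0, 0, 0, 0, 0, k, 0, b⟩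

theorem central_mul (k b k' b' : ZMod 5) :
    central k b * central k' b' = central (k + k') (b + b') := by
  ext <;> simp [central, mul_i, mul_j, mul_k2, mul_k3, mul_k4, mul_k5, mul_a, mul_b]

theorem central_pow (k b : ZMod 5) (n : ℕ) : central k b ^ n = central (n * k) (n * b) := by
  induction n with
  | zero => simp [central, one_def]
  | succ n ih => rw [pow_succ, ih, central_mul]; push_cast; congr 1 <;> ring

theorem S5_pow_mul_U5_pow (m n : ℕ) : S5 gx gy ^ m * U5 gx gy ^ n = central m n := by
  have h1 : S5 gx gy = central 1 0 := S5_eq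
  have h2 : U5 gx gy = central 0 1 := U5_eq
  rw [h1, h2, central_pow, central_pow, central_mul]
  simp

/-- The universal property of the covering group, for the concrete model. -/
theorem exists_lift {G : Type*} [Group G] {x y : G} (hG : CoveringRel x y) :
    ∃ f : CoverModel →* G, f gx = x ∧ f gy = y := by
  obtain ⟨p, px, py⟩ := CoveringGroup.exists_lift coveringRel
  have hs : Function.Surjective p :=
    surjective_of_closure_eq_top closure_eq_top p ⟨_, px⟩ ⟨_, py⟩
  have hb : Function.Bijective p := by
    have : Finite CoverModel := Nat.finite_of_card_ne_zero (by rw [card_eq]; norm_num)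
    refine (Nat.bijective_iff_surjective_and_card p).2 ⟨hs, ?_⟩
    rw [card_eq, CoveringGroup.card_eq]
  let e := MulEquiv.ofBijective p hb
  obtain ⟨f, hx, hy⟩ := CoveringGroup.exists_lift hG
  refine ⟨f.comp e.symm.toMonoidHom, ?_, ?_⟩
  · have : e.symm gx = CoveringGroup.x := by rw [MulEquiv.symm_apply_eq]; exact px.symm
    simp [this, hx]
  · have : e.symm gy = CoveringGroup.y := by rw [MulEquiv.symm_apply_eq]; exact py.symm
    simp [this, hy]

end CoverModel

open CoverModel

theorem CoverRel.u_ne_one {G : Type*} [Group G] {b d e : ℕ} {x y : G}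
    (hgen : Subgroup.closure {x, y} = ⊤) (hG : CoverRel b d e x y)
    (hcard : Nat.card G = 5 ^ 7) : U5 x y ≠ 1 := fun hu => by
  have := (hG.card_le_of_u_eq_one hgen hu).2
  rw [hcard] at this
  norm_num at this

/-- In a cover of order `5⁷` the elements `s₅` and `u` are independent. -/
theorem CoverRel.independent {G : Type*} [Group G] {x y : G} {b d e : ℕ}
    (hgen : Subgroup.closure {x, y} = ⊤) (hG : CoverRel b d e x y) (hcard : Nat.card G = 5 ^ 7)
    {m n : ℕ} (h : S5 x y ^ m * U5 x y ^ n = 1) : 5 ∣ m ∧ 5 ∣ n := by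
  have hu : U5 x y ≠ 1 := hG.u_ne_one hgen hcard
  have hm : 5 ∣ m := by
    -- Otherwise s₅ becomes trivial in G/⟨u⟩, whose order is then at most 5⁵, so |G| would be at
    -- most 5⁶.
    by_contra hm
    have hcop : Nat.Coprime 5 m := (Nat.Prime.coprime_iff_not_dvd (by norm_num)).2 hm
    have hn := normal_of_central (Subgroup.zpowers (U5 x y))
      (zpowers_central (hG.u_central hgen))
    let q := QuotientGroup.mk' (Subgroup.zpowers (U5 x y))
    have hq : Function.Surjective q := QuotientGroup.mk'_surjective _
    have hQ := hG.map q
    have qu : U5 (q x) (q y) = 1 := by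
      rw [← map_U5]; exact (QuotientGroup.eq_one_iff _).2 (Subgroup.mem_zpowers _)
    have qs : S5 (q x) (q y) = 1 := by
      have h1 := congrArg q h
      rw [map_mul, map_pow, map_pow, map_S5, map_U5, qu, one_pow, mul_one, map_one] at h1
      exact eq_one_of_pow_five_of_pow hQ.s5_pow h1 hcop
    have hle : Nat.card (G ⧸ Subgroup.zpowers (U5 x y)) ≤ 5 ^ 5 :=
      (card_le_class_four (closure_pair_map_eq_top hgen q hq) hQ.toCoveringRel qs qu
        (by rw [hQ.r, qu, one_pow]) (by rw [hQ.px, qs, qu]; simp)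
        (by rw [hQ.py, qs, qu]; simp)).2
    have h5 := (finite_and_card_zpowers_le hG.u_pow).2
    have := Subgroup.card_eq_card_quotient_mul_card_subgroup (Subgroup.zpowers (U5 x y))
    rw [hcard] at this
    have := Nat.mul_le_mul hle h5
    omega
  refine ⟨hm, ?_⟩
  by_contra hn
  obtain ⟨m, rfl⟩ := hm
  rw [pow_mul, hG.s5_pow, one_pow, one_mul] at h
  exact hu (eq_one_of_pow_five_of_pow hG.u_pow h
    ((Nat.Prime.coprime_iff_not_dvd (by norm_num)).2 hn))

/-- The parameter of a cover does not depend on the choice of generators. -/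
theorem CoverRel.parameter_unique {G : Type*} [Group G] {x y x' y' : G} {b b' : ℕ}
    (hgen : Subgroup.closure {x, y} = ⊤) (hG : CoverRel b 0 0 x y) (hcard : Nat.card G = 5 ^ 7)
    (hG' : CoverRel b' 0 0 x' y') (hu' : U5 x' y' ≠ 1) : (b : ZMod 5) = b' := by
  obtain ⟨f, fx, fy⟩ := CoverModel.exists_lift hG.toCoveringRel
  have hf : Function.Surjective f := surjective_of_closure_eq_top hgen f ⟨_, fx⟩ ⟨_, fy⟩
  have fc : ∀ m n : ℕ, f (central m n) = S5 x y ^ m * U5 x y ^ n := fun m n => by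
    rw [← S5_pow_mul_U5_pow, map_mul, map_pow, map_pow, map_S5, map_U5, fx, fy]
  have inj1 : ∀ k b : ZMod 5, f (central k b) = 1 → k = 0 ∧ b = 0 := fun k b hk => by
    rw [← ZMod.natCast_zmod_val k, ← ZMod.natCast_zmod_val b, fc] at hk
    obtain ⟨h1, h2⟩ := hG.independent hgen hcard hk
    rw [← ZMod.natCast_zmod_val k, ← ZMod.natCast_zmod_val b]
    exact ⟨(ZMod.natCast_eq_zero_iff _ _).2 h1, (ZMod.natCast_eq_zero_iff _ _).2 h2⟩
  have inj : ∀ {k b k' b' : ZMod 5}, f (central k b) = f (central k' b') → k = k' ∧ b = b' := by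
    intro k b k' b' hk
    have h1 : f (central (k - k') (b - b')) = 1 := by
      have h2 := congrArg f (central_mul (k - k') (b - b') k' b')
      rw [sub_add_cancel, sub_add_cancel, map_mul, hk] at h2
      exact mul_eq_right.1 h2
    obtain ⟨h2, h3⟩ := inj1 _ _ h1
    exact ⟨sub_eq_zero.1 h2, sub_eq_zero.1 h3⟩
  obtain ⟨g, rfl⟩ := hf x'
  obtain ⟨h, rfl⟩ := hf y'
  set i := red g.i with hi
  set j := red g.j with hj
  set l := red h.i with hl
  set m := red h.j with hm
  obtain ⟨ai, aj, a2⟩ := pcComm_coord h g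
  change (S2 g h).i = _ at ai
  change (S2 g h).j = _ at aj
  change (S2 g h).k2 = _ at a2
  rw [← hi, ← hj, ← hl, ← hm] at a2
  obtain ⟨bi, bj, b2, b3⟩ := pcComm_coord_of_derived ai aj g
  change (S3 g h).i = _ at bi
  change (S3 g h).j = _ at bj
  change (S3 g h).k2 = _ at b2
  change (S3 g h).k3 = _ at b3
  obtain ⟨ci, cj, c2, c3, c4⟩ := pcComm_coord_of_third bi bj b2 g
  change (S4 g h).i = _ at ci
  change (S4 g h).j = _ at cj
  change (S4 g h).k2 = _ at c2
  change (S4 g h).k3 = _ at c3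
  change (S4 g h).k4 = _ at c4
  have e5 : S5 (f g) (f h) = f (central (i * (S4 g h).k4) (j * (S4 g h).k4)) := by
    rw [← map_S5]; exact congrArg f (pcComm_eq_of_fourth ci cj c2 c3 g)
  have eu : U5 (f g) (f h) = f (central (l * (S4 g h).k4) (m * (S4 g h).k4)) := by
    -- The word u is evaluated as [s₄, y'] instead of [s₃, y'], because commutators with s₄ are
    -- already bilinear in the model.
    rw [← hG'.s4_y, ← map_S4, ← map_pcComm]
    exact congrArg f (pcComm_eq_of_fourth ci cj c2 c3 h)
  rw [b3, a2, ← hi] at c4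
  -- `l = 0`
  have hlD : l * (S2 g h).k2 = 0 := by
    -- Let D be the s₂-coordinate of [h, g]. The lift of [s₂, y'] = 1 has s₃-coordinate lD, and two
    -- commutators with x move it to the s₅-coordinate, where f is injective.
    obtain ⟨di, dj, d2, d3⟩ := pcComm_coord_of_derived ai aj h
    obtain ⟨ei, ej, e2, e3, e4⟩ := pcComm_coord_of_third di dj d2 gx
    have e5 := pcComm_eq_of_fourth ei ej e2 e3 gx
    have h1 : f (pcComm (S2 g h) h) = 1 := by
      rw [map_pcComm, map_S2]; exact hG'.r.trans (pow_zero _)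
    have h2 : f (pcComm (pcComm (pcComm (S2 g h) h) gx) gx) = 1 := by
      rw [map_pcComm, map_pcComm, h1]; simp [pcComm]
    rw [e5, e4, d3, show red gx.i = 1 from rfl, show red gx.j = 0 from rfl, one_mul, one_mul,
      zero_mul, ← hl] at h2
    exact (inj1 _ _ h2).1
  -- Were D zero, the s₄-coordinate would vanish, and u would be trivial for the new pair.
  have hD : (S2 g h).k2 ≠ 0 := fun hD => by
    rw [← a2, hD, mul_zero, mul_zero] at c4
    rw [eu, c4, mul_zero, mul_zero] at hu'
    exact hu' (by simpa using fc 0 0)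
  have l0 : l = 0 := (mul_eq_zero.1 hlD).resolve_right hD
  rw [l0, zero_mul, sub_zero] at a2
  rw [l0, zero_mul, sub_zero] at c4
  rw [a2] at hD
  have i0 : i ≠ 0 := left_ne_zero_of_mul hD
  have m0 : m ≠ 0 := right_ne_zero_of_mul hD
  have i4 : i ^ 4 = 1 := ZMod.pow_card_sub_one_eq_one i0
  rw [c4] at e5 eu
  have red5 : ∀ z : ZMod 25, 5 * z = ((5 * (red z).val : ℕ) : ZMod 25) := by decide
  -- `j = 0`
  have hy : f (h ^ 5) = f (central (4 * m) 0) := by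
    rw [pow_five_of_red_i l0, red5, ← gy_pow, map_pow, fy, pow_mul, hG.py, pow_zero, mul_one,
      ← pow_mul, ← hm]
    have := fc (4 * m.val) 0
    rw [pow_zero, mul_one] at this
    rw [← this]
    push_cast
    rw [ZMod.natCast_zmod_val]
  have hy' := hG'.py
  rw [pow_zero, mul_one, e5, ← map_pow, ← map_pow, hy, central_pow] at hy'
  obtain ⟨-, h2⟩ := inj hy'
  have j0 : j = 0 := by
    have h4 : (4 : ZMod 5) ≠ 0 := by decide
    simpa [h4, i0, m0] using h2.symm
  -- the parameter
  have hx : f (g ^ 5) = f (central i (b * i)) := by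
    rw [pow_five_of_red_j j0, red5, ← gx_pow, map_pow, fx, pow_mul, hG.px,
      (hG.s5_central hgen _).mul_pow, ← pow_mul, ← hi, ← fc]
    push_cast
    rw [ZMod.natCast_zmod_val]
  have hx' := hG'.px
  rw [e5, eu, ← map_pow, ← map_pow, ← map_mul, hx, central_pow, central_mul, l0, j0] at hx'
  obtain ⟨h3, h4⟩ := inj hx'
  -- Comparing exponents in the relation for the fifth power of the first new generator: s₅ gives i
  -- = i⁴m = m, and u gives bi = b'i³m² = b'i.
  have him : i = m := by linear_combination h3 + m * i4
  rw [← him] at h4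
  have : ((b : ZMod 5) - b') * i = 0 := by linear_combination h4 + b' * i * i4
  exact sub_eq_zero.1 ((mul_eq_zero.1 this).resolve_right i0)

/-! ### The presented groups -/

section Presentation

variable {G : Type*} [Group G]

/-- The relations of the power-commutator presentations, in terms of the two generators. -/
structure PcRel (a b : ℕ) (x y : G) : Prop extends CoveringRel x y where
  px : x ^ 5 = S5 x y ^ a * U5 x y ^ b
  py : y ^ 5 = S5 x y ^ 4
  r : R2 x y = 1

theorem pcRel_one_iff {b : ℕ} {x y : G} : PcRel 1 b x y ↔ CoverRel b 0 0 x y := by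
  constructor
  · intro h
    exact ⟨h.toCoveringRel, by rw [h.px, pow_one], by rw [h.py, pow_zero, mul_one],
      by rw [h.r, pow_zero]⟩
  · intro h
    exact ⟨h.toCoveringRel, by rw [h.px, pow_one], by rw [h.py, pow_zero, mul_one],
      by rw [h.r, pow_zero]⟩

/-- The listed equations force the other five generators to be the words in x and y. Conversely, the
equations absent from `PcRel` follow from the centrality of s₅ and u, and u⁴ = u⁻¹. -/
theorem pcEquations_iff (φ : FreeGroup PcGen →* G) (a b : ℕ) {x y : G}
    (hx : φ (pcOf .x) = x) (hy : φ (pcOf .y) = y) :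
    (∀ e ∈ pcEquations a b, φ e.1 = φ e.2) ↔
      PcRel a b x y ∧ φ (pcOf .s2) = S2 x y ∧ φ (pcOf .s3) = S3 x y ∧ φ (pcOf .s4) = S4 x y ∧
        φ (pcOf .s5) = S5 x y ∧ φ (pcOf .u5) = U5 x y := by
  simp only [pcEquations, Set.mem_insert_iff, Set.mem_singleton_iff, forall_eq_or_imp, forall_eq,
    map_mul, map_pow, map_pcComm, map_one, hx, hy]
  constructor
  · rintro ⟨px, py, p2, p3, p4, p5, pu, e2, e3, e4, e5, c5x, cux, r, eu, c4y, c5y, cuy, c32, c42,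
      c52, cu2, c43, c53, cu3, c54, cu4, cu5⟩
    generalize φ (pcOf .s2) = s2 at *
    generalize φ (pcOf .s3) = s3 at *
    generalize φ (pcOf .s4) = s4 at *
    generalize φ (pcOf .s5) = s5 at *
    generalize φ (pcOf .u5) = u5 at *
    obtain rfl : s2 = S2 x y := e2.symm
    obtain rfl : s3 = S3 x y := e3.symm
    obtain rfl : s4 = S4 x y := e4.symm
    obtain rfl : s5 = S5 x y := e5.symm
    obtain rfl : u5 = U5 x y := eu.symm
    rw [pcComm_eq_one_iff] at c5x cux c5y cuy c42 c43
    have r' : R2 x y = 1 := r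
    refine ⟨⟨{
      s5_x := c5x
      s5_y := c5y
      u_x := cux
      u_y := cuy
      r_x := by rw [r']; exact Commute.one_left _
      r_y := by rw [r']; exact Commute.one_left _
      px_y := by rw [px]; exact (c5y.pow_left a).mul_left (cuy.pow_left b)
      py_x := by rw [py]; exact c5x.pow_left 4
      s2_pow := p2
      s3_pow := p3
      s4_pow := p4
      s5_pow := p5
      u_pow := pu
      r_pow := by rw [r', one_pow]
      px_pow := by
        rw [px, ((commute_words c5x c5y).2.2.2.2.1.pow_pow a b).mul_pow, ← pow_mul, ← pow_mul,
          mul_comm a, mul_comm b, pow_mul, pow_mul, p5, pu, one_pow, one_pow, mul_one]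
      py_pow := by rw [py, ← pow_mul, mul_comm, pow_mul, p5, one_pow]
      s4_y := c4y
      s3_s2 := by rw [c32, ← pow_succ, pu]
      s4_s2 := c42
      s4_s3 := c43 }, px, py, r'⟩, rfl, rfl, rfl, rfl, rfl⟩
  · rintro ⟨h, e2, e3, e4, e5, eu⟩
    rw [e2, e3, e4, e5, eu]
    obtain ⟨a2, a3, a4, -, au, -⟩ := commute_words h.s5_x h.s5_y
    obtain ⟨b2, b3, b4, b5, -, -⟩ := commute_words h.u_x h.u_y
    refine ⟨h.px, h.py, h.s2_pow, h.s3_pow, h.s4_pow, h.s5_pow, h.u_pow, rfl, rfl, rfl, rfl,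
      h.s5_x.pcComm_eq, h.u_x.pcComm_eq, h.r, rfl, h.s4_y, h.s5_y.pcComm_eq, h.u_y.pcComm_eq, ?_,
      h.s4_s2.pcComm_eq, a2.pcComm_eq, b2.pcComm_eq, h.s4_s3.pcComm_eq, a3.pcComm_eq,
      b3.pcComm_eq, a4.pcComm_eq, b4.pcComm_eq, b5.pcComm_eq⟩
    rw [eq_inv_of_mul_eq_one_left h.s3_s2, inv_eq_iff_mul_eq_one, ← pow_succ', h.u_pow]

theorem pcRelators_iff (φ : FreeGroup PcGen →* G) (a b : ℕ) :
    (∀ w ∈ pcRelators a b, φ w = 1) ↔ ∀ e ∈ pcEquations a b, φ e.1 = φ e.2 := by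
  simp only [pcRelators, Set.forall_mem_image, map_mul, map_inv, mul_inv_eq_one]

/-- The generators of the presented group satisfy the relations. -/
theorem pcRel_presentedGroup {a b : ℕ} {rels : Set (FreeGroup PcGen)}
    (h : pcRelators a b ⊆ rels) :
    Subgroup.closure {(PresentedGroup.of .x : PresentedGroup rels), PresentedGroup.of .y} = ⊤ ∧
      PcRel a b (PresentedGroup.of .x : PresentedGroup rels) (PresentedGroup.of .y) ∧
      (PresentedGroup.of .u5 : PresentedGroup rels) =
        U5 (PresentedGroup.of .x) (PresentedGroup.of .y) := by
  obtain ⟨hG, e2, e3, e4, e5, eu⟩ := (pcEquations_iff (PresentedGroup.mk rels) a b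
    (x := PresentedGroup.of .x) (y := PresentedGroup.of .y) rfl rfl).1
    ((pcRelators_iff _ a b).1 fun w hw => PresentedGroup.one_of_mem (h hw))
  refine ⟨?_, hG, eu⟩
  rw [eq_top_iff, ← PresentedGroup.closure_range_of, Subgroup.closure_le]
  set K := Subgroup.closure {(PresentedGroup.of .x : PresentedGroup rels), PresentedGroup.of .y}
  have mx : PresentedGroup.of .x ∈ K := Subgroup.subset_closure (by simp)
  have my : PresentedGroup.of .y ∈ K := Subgroup.subset_closure (by simp)
  have mc : ∀ {g h}, g ∈ K → h ∈ K → pcComm g h ∈ K := fun hg hh =>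
    mul_mem (mul_mem (mul_mem (inv_mem hg) (inv_mem hh)) hg) hh
  rintro _ ⟨c, rfl⟩
  cases c
  · exact mx
  · exact my
  · exact (congrArg (· ∈ K) e2).mpr (mc my mx)
  · exact (congrArg (· ∈ K) e3).mpr (mc (mc my mx) mx)
  · exact (congrArg (· ∈ K) e4).mpr (mc (mc (mc my mx) mx) mx)
  · exact (congrArg (· ∈ K) e5).mpr (mc (mc (mc (mc my mx) mx) mx) mx)
  · exact (congrArg (· ∈ K) eu).mpr (mc (mc (mc my mx) mx) my)

/-- A free group homomorphism with the images of the generators prescribed by the relations. -/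
theorem PcRel.exists_freeGroup_hom {a b : ℕ} {x y : G} (hG : PcRel a b x y) :
    ∃ F : PcGen → G, F .x = x ∧ F .y = y ∧ F .u5 = U5 x y ∧
      ∀ w ∈ pcRelators a b, FreeGroup.lift F w = 1 := by
  let F : PcGen → G := fun c => match c with
    | .x => x
    | .y => y
    | .s2 => S2 x y
    | .s3 => S3 x y
    | .s4 => S4 x y
    | .s5 => S5 x y
    | .u5 => U5 x y
  have hF : ∀ c, FreeGroup.lift F (pcOf c) = F c := fun c => FreeGroup.lift_apply_of
  refine ⟨F, rfl, rfl, rfl, (pcRelators_iff _ a b).2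
    ((pcEquations_iff _ a b (hF .x) (hF .y)).2 ⟨hG, hF _, hF _, hF _, hF _, hF _⟩)⟩

theorem PcRel.exists_surjective {a b : ℕ} {x y : G} (hgen : Subgroup.closure {x, y} = ⊤)
    (hG : PcRel a b x y) : ∃ f : PresentedGroup (pcRelators a b) →* G, Function.Surjective f := by
  obtain ⟨F, hx, hy, -, hF⟩ := hG.exists_freeGroup_hom
  exact ⟨PresentedGroup.toGroup hF, surjective_of_closure_eq_top hgen _
    ⟨PresentedGroup.of .x, by simp [hx]⟩ ⟨PresentedGroup.of .y, by simp [hy]⟩⟩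

theorem CoverRel.exists_surjective_of_u_eq_one {x y : G} (hgen : Subgroup.closure {x, y} = ⊤)
    (hG : CoverRel 0 0 0 x y) (hu : U5 x y = 1) :
    ∃ f : SmallGroup15625n635 →* G, Function.Surjective f := by
  obtain ⟨F, hx, hy, hFu, hF⟩ := (pcRel_one_iff.2 hG).exists_freeGroup_hom
  have hF' : ∀ w ∈ pcRelators 1 0 ∪ {pcOf PcGen.u5}, FreeGroup.lift F w = 1 := by
    rintro w (hw | rfl)
    · exact hF w hw
    · exact (FreeGroup.lift_apply_of).trans (hFu.trans hu)
  exact ⟨PresentedGroup.toGroup hF', surjective_of_closure_eq_top hgen _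
    ⟨PresentedGroup.of .x, by simp [hx]⟩ ⟨PresentedGroup.of .y, by simp [hy]⟩⟩

/-- Replacing `y` by a power changes the exponents. -/
theorem PcRel.pow_right {a b a' b' : ℕ} {x y : G} (hgen : Subgroup.closure {x, y} = ⊤)
    (hG : PcRel a b x y) {j k : ℕ} (hjk : j * k ≡ 1 [MOD 25]) (ha : a ≡ j * a' [MOD 5])
    (hb : b ≡ j * j * b' [MOD 5]) :
    Subgroup.closure {x, y ^ j} = ⊤ ∧ PcRel a' b' x (y ^ j) := by
  obtain ⟨-, -, -, e5, eu, er⟩ := hG.words_pow hgen hG.r j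
  refine ⟨?_, hG.toCoveringRel.pow_right hgen hG.r j, ?_, ?_, er⟩
  · rw [eq_top_iff, ← hgen, Subgroup.closure_le]
    rintro w (rfl | rfl)
    · exact Subgroup.subset_closure (by simp)
    · have h1 : (w ^ j) ^ k = w := by
        rw [← pow_mul, pow_eq_pow_of_modEq hjk, pow_one]
        rw [show 25 = 5 * 5 by norm_num, pow_mul, hG.py_pow]
      have h2 : w ^ j ∈ Subgroup.closure {x, w ^ j} := Subgroup.subset_closure (by simp)
      simpa only [SetLike.mem_coe, h1] using pow_mem h2 k
  · rw [hG.px, e5, eu, ← pow_mul, ← pow_mul, pow_eq_pow_of_modEq ha hG.s5_pow,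
      pow_eq_pow_of_modEq hb hG.u_pow]
  · rw [← pow_mul, mul_comm, pow_mul, hG.py, e5, ← pow_mul, ← pow_mul, mul_comm]

end Presentation

/-! ### The metabelian group -/

namespace SmallGroup15625n635

theorem exists_generators : ∃ x y : SmallGroup15625n635, Subgroup.closure {x, y} = ⊤ ∧
    CoverRel 0 0 0 x y ∧ U5 x y = 1 := by
  obtain ⟨hgen, hG, hu⟩ := pcRel_presentedGroup (a := 1) (b := 0)
    (rels := pcRelators 1 0 ∪ {pcOf PcGen.u5}) Set.subset_union_left
  exact ⟨_, _, hgen, pcRel_one_iff.1 hG,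
    hu.symm.trans (PresentedGroup.one_of_mem (Set.mem_union_right _ rfl))⟩

theorem finite_and_card : Finite SmallGroup15625n635 ∧ Nat.card SmallGroup15625n635 = 5 ^ 6 := by
  obtain ⟨x, y, hgen, hG, hu⟩ := exists_generators
  obtain ⟨hfin, hle⟩ := hG.card_le_of_u_eq_one hgen hu
  refine ⟨hfin, le_antisymm hle ?_⟩
  obtain ⟨E, _, x', y', hgen', hE, hu', hcard⟩ := exists_coverRel_of_u_eq_one
  obtain ⟨f, hf⟩ := hE.exists_surjective_of_u_eq_one hgen' hu'
  rw [← hcard]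
  exact Nat.card_le_card_of_surjective f hf

instance : Finite SmallGroup15625n635 := finite_and_card.1

theorem card_eq : Nat.card SmallGroup15625n635 = 5 ^ 6 := finite_and_card.2

theorem derivedSeries_eq_bot : derivedSeries SmallGroup15625n635 2 = ⊥ := by
  obtain ⟨x, y, hgen, hG, hu⟩ := exists_generators
  exact hG.derivedSeries_eq_bot hgen hu

theorem relationRank_eq : relationRank 5 SmallGroup15625n635 = 4 := by
  obtain ⟨x, y, hgen, hG, hu⟩ := exists_generators
  exact hG.relationRank_eq_of_u_eq_one hgen hu card_eq

theorem mem_cover : isoClass SmallGroup15625n635 ∈ cover 5 SmallGroup15625n635 :=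
  ⟨SmallGroup15625n635, inferInstance, rfl, inferInstance, IsPGroup.of_card card_eq,
    ⟨(QuotientGroup.quotientMulEquivOfEq derivedSeries_eq_bot).trans
      QuotientGroup.quotientBot⟩⟩

/-- A characterization of the group. -/
theorem nonempty_mulEquiv {G : Type*} [Group G] {x y : G} (hgen : Subgroup.closure {x, y} = ⊤)
    (hG : CoverRel 0 0 0 x y) (hu : U5 x y = 1) (hcard : Nat.card G = 5 ^ 6) :
    Nonempty (SmallGroup15625n635 ≃* G) := by
  obtain ⟨f, hf⟩ := hG.exists_surjective_of_u_eq_one hgen hu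
  exact ⟨MulEquiv.ofBijective f ((Nat.bijective_iff_surjective_and_card f).2
    ⟨hf, card_eq.trans hcard.symm⟩)⟩

end SmallGroup15625n635

/-! ### The five covers -/

/-- The numbers of the five groups. -/
def coverNumbers : Set ℕ := {361, 373, 374, 385, 386}

/-- The parameter `b` of the group `⟨78125, n⟩` when presented with `x⁵ = s₅ u₅ᵇ`. -/
def coverParameter (n : ℕ) : ℕ :=
  if n = 361 then 0 else if n = 373 then 1 else if n = 374 then 4 else if n = 385 then 2 else 3

theorem coverParameter_injOn :
    Set.InjOn (fun n => (coverParameter n : ZMod 5)) coverNumbers := by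
  rintro m (rfl | rfl | rfl | rfl | rfl) n (rfl | rfl | rfl | rfl | rfl) h <;>
    first | rfl | (revert h; decide)

theorem exists_coverParameter_eq (b : ℕ) :
    ∃ n ∈ coverNumbers, b ≡ coverParameter n [MOD 5] := by
  have h : b % 5 < 5 := Nat.mod_lt b (by norm_num)
  have e : b ≡ b % 5 [MOD 5] := (Nat.mod_modEq b 5).symm
  interval_cases b % 5
  · exact ⟨361, by simp [coverNumbers], e⟩
  · exact ⟨373, by simp [coverNumbers], e⟩
  · exact ⟨385, by simp [coverNumbers], e⟩
  · exact ⟨386, by simp [coverNumbers], e⟩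
  · exact ⟨374, by simp [coverNumbers], e⟩

namespace SmallGroup78125

variable {n : ℕ}

theorem exists_generators (hn : n ∈ coverNumbers) : ∃ x y : SmallGroup78125 n,
    Subgroup.closure {x, y} = ⊤ ∧ CoverRel (coverParameter n) 0 0 x y := by
  obtain ⟨hgen, hG, -⟩ := pcRel_presentedGroup (a := (relatorExponents n).1)
    (b := (relatorExponents n).2) (rels := _) subset_rfl
  rcases hn with rfl | rfl | rfl | rfl | rfl
  · exact ⟨_, _, hgen, pcRel_one_iff.1 hG⟩
  · exact ⟨_, _, hgen, pcRel_one_iff.1 hG⟩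
  -- Replacing y by y² normalizes the exponent of s₅ to 1: for (2, 1) one needs 2 = 2 · 1 and 1 ≡ 4
  -- · 4 mod 5; for (2, 2) below, 2 ≡ 4 · 3. The inverse 13 of 2 modulo 25 recovers y, as y²⁵ = 1.
  · obtain ⟨hgen', hG'⟩ := hG.pow_right hgen (a' := 1) (b' := 4) (j := 2) (k := 13) rfl rfl rfl
    exact ⟨_, _, hgen', pcRel_one_iff.1 hG'⟩
  · exact ⟨_, _, hgen, pcRel_one_iff.1 hG⟩
  · obtain ⟨hgen', hG'⟩ := hG.pow_right hgen (a' := 1) (b' := 3) (j := 2) (k := 13) rfl rfl rfl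
    exact ⟨_, _, hgen', pcRel_one_iff.1 hG'⟩

theorem exists_surjective (hn : n ∈ coverNumbers) {G : Type*} [Group G] {x y : G}
    (hgen : Subgroup.closure {x, y} = ⊤) (hG : CoverRel (coverParameter n) 0 0 x y) :
    ∃ f : SmallGroup78125 n →* G, Function.Surjective f := by
  have h := pcRel_one_iff.2 hG
  rcases hn with rfl | rfl | rfl | rfl | rfl
  · exact h.exists_surjective hgen
  · exact h.exists_surjective hgen
  -- The reverse substitution uses 3 ≡ 2⁻¹ mod 5, with inverse 17 modulo 25: 1 ≡ 3 · 2 and 4 ≡ 9 ·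
  -- 1, and below 3 ≡ 9 · 2.
  · obtain ⟨hgen', hG'⟩ := h.pow_right hgen (a' := 2) (b' := 1) (j := 3) (k := 17) rfl rfl rfl
    exact hG'.exists_surjective hgen'
  · exact h.exists_surjective hgen
  · obtain ⟨hgen', hG'⟩ := h.pow_right hgen (a' := 2) (b' := 2) (j := 3) (k := 17) rfl rfl rfl
    exact hG'.exists_surjective hgen'

theorem finite_and_card (hn : n ∈ coverNumbers) :
    Finite (SmallGroup78125 n) ∧ Nat.card (SmallGroup78125 n) = 5 ^ 7 := by
  obtain ⟨x, y, hgen, hG⟩ := exists_generators hn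
  obtain ⟨hfin, hle⟩ := hG.card_le hgen
  refine ⟨hfin, le_antisymm hle ?_⟩
  obtain ⟨E, _, x', y', hgen', hE, hcard⟩ := exists_coverRel (coverParameter n) 0 0
  obtain ⟨f, hf⟩ := exists_surjective hn hgen' hE
  rw [← hcard]
  exact Nat.card_le_card_of_surjective f hf

theorem nonempty_mulEquiv (hn : n ∈ coverNumbers) {G : Type*} [Group G] {x y : G}
    (hgen : Subgroup.closure {x, y} = ⊤) (hG : CoverRel (coverParameter n) 0 0 x y)
    (hcard : Nat.card G = 5 ^ 7) : Nonempty (SmallGroup78125 n ≃* G) := by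
  obtain ⟨f, hf⟩ := exists_surjective hn hgen hG
  have := (finite_and_card hn).1
  exact ⟨MulEquiv.ofBijective f ((Nat.bijective_iff_surjective_and_card f).2
    ⟨hf, (finite_and_card hn).2.trans hcard.symm⟩)⟩

end SmallGroup78125

theorem CoverRel.card_eq_mul_five {G : Type*} [Group G] {b d e : ℕ} {x y : G}
    (hgen : Subgroup.closure {x, y} = ⊤) (hG : CoverRel b d e x y) (hu : U5 x y ≠ 1) :
    Nat.card G = Nat.card (G ⧸ derivedSeries G 2) * 5 := by
  rw [Subgroup.card_eq_card_quotient_mul_card_subgroup (derivedSeries G 2)]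
  congr 1
  rw [hG.derivedSeries_eq hgen, Nat.card_zpowers, orderOf_eq_prime hG.u_pow hu]

/-! ### Invariants of the five covers and their pairwise non-isomorphism -/

namespace SmallGroup78125

variable {n : ℕ}

theorem not_isMetabelianGroup (hn : n ∈ coverNumbers) :
    ¬ IsMetabelianGroup (SmallGroup78125 n) := by
  obtain ⟨x, y, hgen, hG⟩ := exists_generators hn
  intro h
  rw [IsMetabelianGroup, hG.derivedSeries_eq hgen, Subgroup.zpowers_eq_bot] at h
  exact hG.u_ne_one hgen (finite_and_card hn).2 h

theorem relationRank_eq (hn : n ∈ coverNumbers) : relationRank 5 (SmallGroup78125 n) = 3 := by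
  obtain ⟨x, y, hgen, hG⟩ := exists_generators hn
  exact hG.relationRank_eq hgen (finite_and_card hn).2

theorem mem_cover (hn : n ∈ coverNumbers) :
    isoClass (SmallGroup78125 n) ∈ cover 5 SmallGroup15625n635 := by
  obtain ⟨hfin, hcard⟩ := finite_and_card hn
  refine ⟨SmallGroup78125 n, inferInstance, rfl, hfin, IsPGroup.of_card hcard, ?_⟩
  obtain ⟨x, y, hgen, hG⟩ := exists_generators hn
  let q := QuotientGroup.mk' (derivedSeries (SmallGroup78125 n) 2)
  have hq : Function.Surjective q := QuotientGroup.mk'_surjective _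
  have hQ := hG.map q
  have hu : U5 (q x) (q y) = 1 := by
    rw [← map_U5]
    exact (QuotientGroup.eq_one_iff _).2 hG.u_mem_derivedSeries
  -- The parameter occurs only as an exponent of u, which dies modulo G''; so all five groups have
  -- the same metabelian quotient.
  have hQ0 : CoverRel 0 0 0 (q x) (q y) :=
    ⟨hQ.toCoveringRel, by rw [hQ.px, hu, one_pow, one_pow], hQ.py, hQ.r⟩
  have hc := hG.card_eq_mul_five hgen (hG.u_ne_one hgen hcard)
  rw [hcard] at hc
  obtain ⟨e⟩ := SmallGroup15625n635.nonempty_mulEquiv (closure_pair_map_eq_top hgen q hq) hQ0 hu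
    (by omega)
  exact ⟨e.symm⟩

theorem isoClass_injOn :
    Set.InjOn (fun n : ℕ => isoClass (SmallGroup78125 n)) coverNumbers := by
  intro m hm n hn h
  obtain ⟨e⟩ : Nonempty (SmallGroup78125 m ≃* SmallGroup78125 n) :=
    Quotient.exact (s := groupIsoSetoid) h
  obtain ⟨x, y, hgen, hG⟩ := exists_generators hm
  obtain ⟨x', y', hgen', hG'⟩ := exists_generators hn
  refine coverParameter_injOn hm hn (hG.parameter_unique hgen (finite_and_card hm).2
    (hG'.map e.symm.toMonoidHom) ?_)
  rw [← map_U5]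
  intro h1
  exact hG'.u_ne_one hgen' (finite_and_card hn).2 (e.symm.map_eq_one_iff.1 h1)

end SmallGroup78125

/-- The classes in the cover of relation rank at most three. -/
theorem isoClass_mem_image_of_relationRank_le {c : GroupIsoClass}
    (hc : c ∈ cover 5 SmallGroup15625n635) {H : Type} [Group H] (hH : isoClass H = c)
    (hr : relationRank 5 H ≤ 3) :
    c ∈ (fun n : ℕ => isoClass (SmallGroup78125 n)) '' coverNumbers := by
  obtain ⟨G, _, rfl, hfin, hp, ⟨e⟩⟩ := hc
  obtain ⟨k⟩ : Nonempty (H ≃* G) := Quotient.exact (s := groupIsoSetoid) hH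
  let f : G →* SmallGroup15625n635 := e.toMonoidHom.comp (QuotientGroup.mk' (derivedSeries G 2))
  have hf : Function.Surjective f := e.surjective.comp (QuotientGroup.mk'_surjective _)
  have hker : f.ker = derivedSeries G 2 := by
    ext g
    rw [MonoidHom.mem_ker, ← QuotientGroup.eq_one_iff (N := derivedSeries G 2)]
    exact e.map_eq_one_iff
  obtain ⟨g, h, hgen, hM, hu⟩ := SmallGroup15625n635.exists_generators
  obtain ⟨x, y, b, hgenG, hG⟩ := exists_coverRel_zero_zero hp f hf hker hgen hM hu
  have hQ : Nat.card (G ⧸ derivedSeries G 2) = 5 ^ 6 :=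
    (Nat.card_congr e.toEquiv).trans SmallGroup15625n635.card_eq
  by_cases hu1 : U5 x y = 1
  · exfalso
    have hb : CoverRel 0 0 0 x y :=
      ⟨hG.toCoveringRel, by rw [hG.px, hu1, one_pow, one_pow], hG.py, hG.r⟩
    have hcard : Nat.card G = 5 ^ 6 := by
      rw [Subgroup.card_eq_card_quotient_mul_card_subgroup (derivedSeries G 2), hQ,
        hG.derivedSeries_eq_bot hgenG hu1, Subgroup.card_bot, mul_one]
    -- The relations are transported to the representative H itself, so the isomorphism invariance
    -- of the relation rank is not required.
    have hH' := (hb.map k.symm.toMonoidHom).relationRank_eq_of_u_eq_one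
      (closure_pair_map_eq_top hgenG k.symm.toMonoidHom k.symm.surjective)
      (by rw [← map_U5, hu1, map_one]) ((Nat.card_congr k.toEquiv).trans hcard)
    omega
  · have hcard : Nat.card G = 5 ^ 7 := by
      rw [hG.card_eq_mul_five hgenG hu1, hQ]
      norm_num
    obtain ⟨n, hn, hbn⟩ := exists_coverParameter_eq b
    have hb : CoverRel (coverParameter n) 0 0 x y :=
      ⟨hG.toCoveringRel, by rw [hG.px, pow_eq_pow_of_modEq hbn hG.u_pow], hG.py, hG.r⟩
    obtain ⟨l⟩ := SmallGroup78125.nonempty_mulEquiv hn hgenG hb hcard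
    exact ⟨n, hn, Quotient.sound (s := groupIsoSetoid) ⟨l⟩⟩

/-! ### Real quadratic fields -/

section RealQuadratic

variable {K : Type u} [Field K] [NumberField K]

theorem units_rank_of_real_quadratic (hquadratic : Module.finrank ℚ K = 2)
    (hreal : NumberField.IsTotallyReal K) : NumberField.Units.rank K = 1 := by
  rw [NumberField.Units.rank, NumberField.InfinitePlace.card_eq_nrRealPlaces_add_nrComplexPlaces,
    NumberField.IsTotallyReal.nrComplexPlaces_eq_zero, ← NumberField.IsTotallyReal.finrank,
    hquadratic]

theorem rootOfUnityIndicator_of_real {p : ℕ} (hp : 2 < p)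
    (hreal : NumberField.IsTotallyReal K) : rootOfUnityIndicator p K = 0 := by
  rw [rootOfUnityIndicator, if_neg]
  rintro ⟨z, hz⟩
  have h := NumberField.InfinitePlace.IsPrimitiveRoot.nrRealPlaces_eq_zero_of_two_lt hp hz
  rw [← NumberField.IsTotallyReal.finrank] at h
  exact Module.finrank_pos.ne' h

end RealQuadratic

theorem theorem6p3 (K : Type u) [Field K] [NumberField K]
    (hquadratic : Module.finrank ℚ K = 2) (hreal : NumberField.IsTotallyReal K)
    (hrank : pClassRank 5 K = 2) :
    -- the Shafarevich cover, which has exactly five elements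
    shafarevichCover 5 SmallGroup15625n635 K =
        (fun n : ℕ => isoClass (SmallGroup78125 n)) '' {361, 373, 374, 385, 386} ∧
      (shafarevichCover 5 SmallGroup15625n635 K).ncard = 5 ∧
      -- its elements are non-metabelian of relation rank three
      (∀ n ∈ ({361, 373, 374, 385, 386} : Set ℕ),
        Nat.card (SmallGroup78125 n) = 78125 ∧
        ¬ IsMetabelianGroup (SmallGroup78125 n) ∧
        relationRank 5 (SmallGroup78125 n) = 3) ∧
      -- the metabelian group lies in the cover, but its relation rank is too big
      Nat.card SmallGroup15625n635 = 15625 ∧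
      IsMetabelianGroup SmallGroup15625n635 ∧
      relationRank 5 SmallGroup15625n635 = 4 ∧
      isoClass SmallGroup15625n635 ∈ cover 5 SmallGroup15625n635 ∧
      isoClass SmallGroup15625n635 ∉ shafarevichCover 5 SmallGroup15625n635 K := by
  have hcover : shafarevichCover 5 SmallGroup15625n635 K =
      (fun n : ℕ => isoClass (SmallGroup78125 n)) '' coverNumbers := by
    ext c
    simp only [shafarevichCover, hrank, units_rank_of_real_quadratic hquadratic hreal,
      rootOfUnityIndicator_of_real (show 2 < 5 by norm_num) hreal, Set.mem_ofPred_eq]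
    constructor
    · rintro ⟨hc, H, _, hH, -, hr⟩
      exact isoClass_mem_image_of_relationRank_le hc hH hr
    · rintro ⟨n, hn, rfl⟩
      have h3 := SmallGroup78125.relationRank_eq hn
      exact ⟨SmallGroup78125.mem_cover hn, SmallGroup78125 n, inferInstance, rfl, by omega,
        by omega⟩
  refine ⟨hcover, ?_, fun n hn => ⟨(SmallGroup78125.finite_and_card hn).2,
    SmallGroup78125.not_isMetabelianGroup hn, SmallGroup78125.relationRank_eq hn⟩,
    SmallGroup15625n635.card_eq, SmallGroup15625n635.derivedSeries_eq_bot,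
    SmallGroup15625n635.relationRank_eq, SmallGroup15625n635.mem_cover, ?_⟩
  · rw [hcover, SmallGroup78125.isoClass_injOn.ncard_image,
      show coverNumbers = (({361, 373, 374, 385, 386} : Finset ℕ) : Set ℕ) by simp [coverNumbers],
      Set.ncard_coe_finset]
    rfl
  · rw [hcover]
    rintro ⟨n, hn, h⟩
    obtain ⟨e⟩ : Nonempty (SmallGroup78125 n ≃* SmallGroup15625n635) :=
      Quotient.exact (s := groupIsoSetoid) h
    have h1 := Nat.card_congr e.toEquiv
    rw [(SmallGroup78125.finite_and_card hn).2, SmallGroup15625n635.card_eq] at h1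
    norm_num at h1
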